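/- Machines are deterministic Turing machines with a read-only input tape, one read-write two-way infinite work tape, and a write-only output tape. On an ordinary (\emph{offline}) machine the input $w$ is written between two endmarkers and the input head moves in both directions between them. An \emph{online} machine is one whose input head never moves to the left. An online machine \emph{with shifted input} finds on its input tape, between the endmarkers, $|w|$ empty symbols followed by $w$. A machine \emph{decides} a language $L$ if on every input $w$ it halts with the one-bit output that tells whether $w\in L$. Space is the number of work-tape cells visited. $\mathrm{1DSPACE}'(g)$ denotes the class of all languages decided by an online machine with shifted input, with an arbitrary finite work alphabet, using $O(g(n))$ work cells on inputs of length $n$. \textbf{Corollary.} Let $f:\mathbb N\to\mathbb N$ satisfy $f(n)=\Omega(\log\log n)$, and suppose that the function $1^n\mapsto f(n)$ (with $f(n)$ written in binary) is computed by an offline machine, with some finite work alphabet, using $O(f(n)\cdot 2^{f(n)})$ work cells. Let $L$ be a language over a finite alphabet that is decided by an offline machine whose work alphabet consists of two symbols (one of which is the blank) and which uses at most $f(n)$ work cells on every input of length $n$, for all sufficiently large $n$. Then $L\in \mathrm{1DSPACE}'(f\cdot 2^f)$. -/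

import Mathlib

open Filter Asymptotics

namespace SublinearSpace

/-- One-step displacement of a head. -/
inductive Move
  | left
  | stay
  | right

/-- Symbols that can occur on the read-only input tape over the input alphabet `α`:
letters, the empty symbol, and the two endmarkers. -/
inductive InputSymbol (α : Type)
  | letter (a : α)
  | blank
  | leftEnd
  | rightEnd

/-- What a machine does in one step: go to a state, write on the scanned work cell, move the two
heads, and possibly print one bit on the (write-only) output tape. -/
structure Action (Q Γ : Type) where
  state : Q
  write : Γ
  workMove : Move
  inputMove : Move
  print : Option Bool

/-- A deterministic Turing machine with a two-way read-only input tape, one read-write work tape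
over the alphabet `Γ` (the blank is `default`), and a write-only output tape.
The machine halts when `δ` gives `none`. -/
structure Machine (α Γ : Type) where
  Q : Type
  finite_Q : Finite Q
  start : Q
  δ : Q → InputSymbol α → Γ → Option (Action Q Γ)

/-- A configuration: state, position of the input head, contents of the (two-way infinite) work
tape, position of the work head, and the bits printed so far. -/
structure Config (Q Γ : Type) where
  state : Q
  inputPos : ℕ
  work : ℤ → Γ
  workPos : ℤ
  output : List Bool

/-- Displacement of the input head on a tape with `len` cells, numbered `0, …, len - 1`;
the head cannot leave the tape. -/
def Move.onInput (len : ℕ) : Move → ℕ → ℕ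
  | .left, p => p - 1
  | .stay, p => p
  | .right, p => min (p + 1) (len - 1)

/-- Displacement of the work head. -/
def Move.onWork : Move → ℤ → ℤ
  | .left, z => z - 1
  | .stay, z => z
  | .right, z => z + 1

/-- The contents `⊢ w ⊣` of the input tape of an ordinary machine on the input `w`. -/
def plainTape {α : Type} (w : List α) : List (InputSymbol α) :=
  .leftEnd :: (w.map .letter ++ [.rightEnd])

/-- The contents of the input tape of a machine with shifted input: the input `w` is preceded by
`|w|` empty symbols. -/
def shiftedTape {α : Type} (w : List α) : List (InputSymbol α) :=
  .leftEnd :: (List.replicate w.length .blank ++ w.map .letter ++ [.rightEnd])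

namespace Machine

variable {α Γ : Type} (M : Machine α Γ)

/-- One step of the machine on the input tape `tape`; `none` if the machine has halted. -/
def step (tape : List (InputSymbol α)) (c : Config M.Q Γ) : Option (Config M.Q Γ) :=
  (M.δ c.state (tape.getD c.inputPos .rightEnd) (c.work c.workPos)).map fun a =>
    { state := a.state
      inputPos := a.inputMove.onInput tape.length c.inputPos
      work := Function.update c.work c.workPos a.write
      workPos := a.workMove.onWork c.workPos
      output := c.output ++ a.print.toList }

/-- The initial configuration: the work tape is blank, the input head is on the left endmarker. -/
def init [Inhabited Γ] : Config M.Q Γ where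
  state := M.start
  inputPos := 0
  work := fun _ => default
  workPos := 0
  output := []

/-- The work cells that are visited in the computation on the input tape `tape`. -/
def usedCells [Inhabited Γ] (tape : List (InputSymbol α)) : Set ℤ :=
  {z | ∃ c, StateTransition.Reaches (M.step tape) M.init c ∧ c.workPos = z}

/-- The computation on `tape` halts with the string `v` on the output tape. -/
def Outputs [Inhabited Γ] (tape : List (InputSymbol α)) (v : List Bool) : Prop :=
  ∃ c, StateTransition.Reaches (M.step tape) M.init c ∧ M.step tape c = none ∧ c.output = v

/-- On every input `w`, presented on the input tape as `present w`, the machine halts with output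
`F w` and uses at most `s |w|` cells of the work tape. -/
def ComputesInSpace [Inhabited Γ] (present : List α → List (InputSymbol α))
    (F : List α → List Bool) (s : ℕ → ℕ) : Prop :=
  ∀ w, M.Outputs (present w) (F w) ∧ (M.usedCells (present w)).encard ≤ s w.length

/-- A machine is online if its input head never moves to the left. -/
def IsOnline : Prop :=
  ∀ q a g, ∀ t ∈ M.δ q a g, t.inputMove ≠ Move.left

end Machine

open Classical in
/-- A language as a function with one bit of output. -/
noncomputable def indicator {α : Type} (L : Language α) (w : List α) : List Bool :=
  [decide (w ∈ L)]

/-- The binary representation of a number, most significant bit first, without leading zeros. -/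
def binary (k : ℕ) : List Bool :=
  k.bits.reverse

/-- The function `1ⁿ ↦ f(n)` (with `f(n)` in binary) is computable by an offline machine with
`O(g(n))` cells of the work tape. -/
def UnaryComputableInSpace (f g : ℕ → ℕ) : Prop :=
  ∃ (Γ : Type) (_ : Finite Γ) (_ : Inhabited Γ) (M : Machine Unit Γ) (s : ℕ → ℕ),
    (fun n => (s n : ℝ)) =O[atTop] (fun n => (g n : ℝ)) ∧
    M.ComputesInSpace plainTape (fun w => binary (f w.length)) s

/-- The language `L` is decided by an offline machine with the binary work alphabet that uses at
most `f(n)` cells of the work tape on all inputs of length `n`, for all sufficiently large `n`. -/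
def BinaryOfflineDecidable {α : Type} (L : Language α) (f : ℕ → ℕ) : Prop :=
  ∃ (M : Machine α Bool) (s : ℕ → ℕ),
    (∀ᶠ n in atTop, s n ≤ f n) ∧ M.ComputesInSpace plainTape (indicator L) s

/-- The class of the languages over `α` that are decided by online machines with shifted input
that use `O(g(n))` cells of the work tape. -/
def OneDSpacePrime (α : Type) (g : ℕ → ℕ) : Set (Language α) :=
  {L | ∃ (Γ : Type) (_ : Finite Γ) (_ : Inhabited Γ) (M : Machine α Γ) (s : ℕ → ℕ),
    M.IsOnline ∧ (fun n => (s n : ℝ)) =O[atTop] (fun n => (g n : ℝ)) ∧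
    M.ComputesInSpace shiftedTape (indicator L) s}

end SublinearSpace

/-!
An online machine can simulate an offline machine `M` with one pass over the input if, along with
the current cell of the input tape, it remembers the *transition table* of the part of the tape
already seen: for every work configuration in which `M` scans that cell, the work configuration in
which `M` first moves on to the next cell, or the output if `M` halts before. The table of a cell is
determined by its symbol and the table of the preceding cell, and the last table gives the output.
A machine with two work symbols and `m = f(n) + O(1)` work cells has `O(2 ^ m)` work configurations
if its work tape is made cyclic, which leaves only the position of the work head relative to the
contents. A table thus is a string of `O(2 ^ m)` entries with `O(m)` bits each, which accounts for
the bound `f * 2 ^ f`.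

To know `m`, the machine counts the blanks in front of the input and simulates the machine that
computes `f`. The count takes `log n` bits. This is `O(f(n) * 2 ^ f(n))`: on a unary input that is
longer than the number of its work configurations, a machine cannot tell `n` from `n + k * n!`, so
that `f` would take the same value infinitely often.

All these algorithms are programs for a fixed number of registers which they increment, decrement
and test for zero. Their registers are bounded by a polynomial in the numbers that occur, so that
the binary representations fit on the tracks of a work tape of the required length.
-/

namespace SublinearSpace

/-! ### Paths of integers with steps of length at most one -/

theorem exists_eq_of_mem_uIcc {g : ℕ → ℤ} {s t : ℕ} (hst : s ≤ t)
    (hg : ∀ i, s ≤ i → i < t → |g (i + 1) - g i| ≤ 1) {v : ℤ} (hv : v ∈ Set.uIcc (g s) (g t)) :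
    ∃ r ∈ Set.Icc s t, g r = v := by
  induction t, hst using Nat.le_induction with
  | base => exact ⟨s, Set.left_mem_Icc.2 le_rfl, by simpa [eq_comm] using hv⟩
  | succ t hst ih =>
    by_cases h : v ∈ Set.uIcc (g s) (g t)
    · obtain ⟨r, ⟨hsr, hrt⟩, hr⟩ := ih (fun i hi hit => hg i hi (by omega)) h
      exact ⟨r, ⟨hsr, by omega⟩, hr⟩
    · have hstep := abs_le.1 (hg t hst (Nat.lt_succ_self t))
      rw [Set.mem_uIcc] at hv h
      exact ⟨t + 1, ⟨by omega, le_rfl⟩, by omega⟩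

theorem exists_forall_mem_Ico_of_card_image_le {g : ℕ → ℤ} {T S : ℕ}
    (hg : ∀ i < T, |g (i + 1) - g i| ≤ 1) (hS : ((Finset.range (T + 1)).image g).card ≤ S) :
    ∃ lo : ℤ, ∀ i ≤ T, g i ∈ Set.Ico lo (lo + S) := by
  obtain ⟨i₀, hi₀, hmin⟩ := (Finset.range (T + 1)).exists_min_image g ⟨0, by simp⟩
  simp only [Finset.mem_range, Nat.lt_succ_iff] at hi₀ hmin
  refine ⟨g i₀, fun i hi => ⟨hmin i hi, ?_⟩⟩
  have hsub : Finset.Icc (g i₀) (g i) ⊆ (Finset.range (T + 1)).image g := fun v hv => by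
    obtain ⟨hv₁, hv₂⟩ := Finset.mem_Icc.1 hv
    obtain ⟨r, hr, rfl⟩ : ∃ r ≤ T, g r = v := by
      rcases le_total i₀ i with h | h
      · obtain ⟨r, hr, hrv⟩ := exists_eq_of_mem_uIcc h (fun j _ hj => hg j (by omega))
          (Set.mem_uIcc_of_le hv₁ hv₂)
        exact ⟨r, hr.2.trans hi, hrv⟩
      · obtain ⟨r, hr, hrv⟩ := exists_eq_of_mem_uIcc h (fun j _ hj => hg j (by omega))
          (Set.mem_uIcc_of_ge hv₁ hv₂)
        exact ⟨r, hr.2.trans hi₀, hrv⟩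
    exact Finset.mem_image_of_mem g (Finset.mem_range.2 (Nat.lt_succ_iff.2 hr))
  have hcard := (Finset.card_le_card hsub).trans hS
  rw [Int.card_Icc] at hcard
  omega

/-- Pigeonhole on the first visits to the levels `1, …, n`. -/
theorem exists_eq_of_card_lt {X : Type*} {x : ℕ → X} {g : ℕ → ℤ} {s t n : ℕ} (hst : s ≤ t)
    (hg : ∀ i, s ≤ i → i < t → |g (i + 1) - g i| ≤ 1) (hs : g s = 0) (ht : n ≤ g t)
    {F : Finset X} (hF : F.card < n) (hx : ∀ i, s ≤ i → i ≤ t → x i ∈ F) :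
    ∃ a b, s ≤ a ∧ a < b ∧ b ≤ t ∧ x a = x b ∧ 1 ≤ g a ∧ g a < g b ∧ g b ≤ n := by
  classical
  have hvisit (j : ℕ) : ∃ r, s ≤ r ∧ (j ≤ n → r ≤ t ∧ g r = j) := by
    by_cases hj : j ≤ n
    · obtain ⟨r, hr, hrj⟩ := exists_eq_of_mem_uIcc hst hg (v := j)
        (Set.mem_uIcc_of_le (by omega) (by omega))
      exact ⟨r, hr.1, fun _ => ⟨hr.2, hrj⟩⟩
    · exact ⟨s, le_rfl, fun h => absurd h hj⟩
  let firstVisit (j : ℕ) : ℕ := Nat.find (hvisit j)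
  have hfirst (j : ℕ) : s ≤ firstVisit j ∧ (j ≤ n → firstVisit j ≤ t ∧ g (firstVisit j) = j) :=
    Nat.find_spec (hvisit j)
  have hmono : ∀ i j, i < j → j ≤ n → firstVisit i < firstVisit j := fun i j hij hj => by
    obtain ⟨hsj, hj'⟩ := hfirst j
    obtain ⟨hjt, hgj⟩ := hj' hj
    obtain ⟨r, hr, hri⟩ := exists_eq_of_mem_uIcc hsj (fun i hi hi' => hg i hi (by omega))
      (v := i) (Set.mem_uIcc_of_le (by omega) (by omega))
    refine lt_of_le_of_lt (Nat.find_min' _ ⟨hr.1, fun _ => ⟨hr.2.trans hjt, hri⟩⟩)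
      (lt_of_le_of_ne hr.2 ?_)
    rintro rfl
    omega
  obtain ⟨i, hi, j, hj, hne, hxij⟩ := Finset.exists_ne_map_eq_of_card_lt_of_maps_to
    (s := Finset.Icc 1 n) (t := F) (f := fun j => x (firstVisit j)) (by simpa using hF)
    (fun j hj => hx _ (hfirst j).1 ((hfirst j).2 (Finset.mem_Icc.1 hj).2).1)
  wlog hij : i < j generalizing i j
  · exact this j hj i hi hne.symm hxij.symm (by omega)
  rw [Finset.mem_Icc] at hi hj
  obtain ⟨-, hgi⟩ := (hfirst i).2 hi.2
  obtain ⟨hjt, hgj⟩ := (hfirst j).2 hj.2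
  exact ⟨firstVisit i, firstVisit j, (hfirst i).1, hmono i j hij hj.2, hjt, hxij,
    by omega, by omega, by omega⟩

/-! ### Complete computations -/

/-- `c 0, …, c T` is a complete computation of `M`. -/
structure IsRun {α Γ : Type} [Inhabited Γ] (M : Machine α Γ) (tape : List (InputSymbol α))
    (c : ℕ → Config M.Q Γ) (T : ℕ) : Prop where
  zero : c 0 = M.init
  step : ∀ i < T, M.step tape (c i) = some (c (i + 1))
  halt : M.step tape (c T) = none

section

variable {α Γ : Type} {M : Machine α Γ} {tape : List (InputSymbol α)} {c c' : Config M.Q Γ}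

theorem exists_chain_of_reaches (h : StateTransition.Reaches (M.step tape) c c') :
    ∃ (d : ℕ → Config M.Q Γ) (T : ℕ),
      d 0 = c ∧ d T = c' ∧ ∀ i < T, M.step tape (d i) = some (d (i + 1)) := by
  induction h using Relation.ReflTransGen.head_induction_on with
  | refl => exact ⟨fun _ => c', 0, rfl, rfl, fun i hi => absurd hi (Nat.not_lt_zero i)⟩
  | @head a a' hstep _ ih =>
    obtain ⟨d, T, rfl, hT, hd⟩ := ih
    refine ⟨fun i => Nat.casesOn i a d, T + 1, rfl, hT, fun i hi => ?_⟩
    cases i with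
    | zero => exact hstep
    | succ i => exact hd i (Nat.lt_of_succ_lt_succ hi)

theorem Machine.Outputs.exists_isRun [Inhabited Γ] {v : List Bool} (h : M.Outputs tape v) :
    ∃ c T, IsRun M tape c T ∧ (c T).output = v := by
  obtain ⟨d, hd, hhalt, hv⟩ := h
  obtain ⟨c, T, h0, rfl, hc⟩ := exists_chain_of_reaches hd
  exact ⟨c, T, ⟨h0, hc, hhalt⟩, hv⟩

theorem Machine.Outputs.unique [Inhabited Γ] {u v : List Bool} (hu : M.Outputs tape u)
    (hv : M.Outputs tape v) : u = v := by
  obtain ⟨c, hc, hch, rfl⟩ := hu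
  obtain ⟨d, hd, hdh, rfl⟩ := hv
  rw [Part.mem_unique (StateTransition.mem_eval.2 ⟨hc, hch⟩)
    (StateTransition.mem_eval.2 ⟨hd, hdh⟩)]

theorem abs_workPos_sub_le_one_of_step (h : M.step tape c = some c') :
    |c'.workPos - c.workPos| ≤ 1 := by
  obtain ⟨a, -, rfl⟩ := Option.map_eq_some_iff.1 h
  cases a.workMove <;> simp [Move.onWork]

theorem abs_inputPos_sub_le_one_of_step (h : M.step tape c = some c')
    (hc : c.inputPos ≤ tape.length - 1) : |(c'.inputPos : ℤ) - c.inputPos| ≤ 1 := by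
  obtain ⟨a, -, rfl⟩ := Option.map_eq_some_iff.1 h
  rw [abs_le]
  cases a.inputMove <;> simp only [Move.onInput] <;> omega

theorem work_eq_of_step (h : M.step tape c = some c') {z : ℤ} (hz : z ≠ c.workPos) :
    c'.work z = c.work z := by
  obtain ⟨a, -, rfl⟩ := Option.map_eq_some_iff.1 h
  exact Function.update_of_ne hz _ _

theorem output_prefix_of_step (h : M.step tape c = some c') : c.output <+: c'.output := by
  obtain ⟨a, -, rfl⟩ := Option.map_eq_some_iff.1 h
  exact List.prefix_append _ _

theorem inputPos_le_of_step (h : M.step tape c = some c')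
    (hc : c.inputPos ≤ tape.length - 1) : c'.inputPos ≤ tape.length - 1 := by
  obtain ⟨a, -, rfl⟩ := Option.map_eq_some_iff.1 h
  change a.inputMove.onInput tape.length c.inputPos ≤ tape.length - 1
  cases a.inputMove <;> simp only [Move.onInput] <;> omega

end

namespace IsRun

variable {α Γ : Type} [Inhabited Γ] {M : Machine α Γ} {tape : List (InputSymbol α)}
  {c : ℕ → Config M.Q Γ} {T : ℕ}

theorem reaches (h : IsRun M tape c T) {i : ℕ} (hi : i ≤ T) :
    StateTransition.Reaches (M.step tape) M.init (c i) := by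
  induction i with
  | zero => rw [h.zero]; exact Relation.ReflTransGen.refl
  | succ i ih => exact (ih (by omega)).tail (h.step i hi)

theorem inputPos_le (h : IsRun M tape c T) {i : ℕ} (hi : i ≤ T) :
    (c i).inputPos ≤ tape.length - 1 := by
  induction i with
  | zero => rw [h.zero]; exact Nat.zero_le _
  | succ i ih => exact inputPos_le_of_step (h.step i hi) (ih (by omega))

theorem output_prefix (h : IsRun M tape c T) {i : ℕ} (hi : i ≤ T) :
    (c i).output <+: (c T).output := by
  induction hi using Nat.decreasingInduction with
  | self => exact List.prefix_rfl
  | of_succ i hi ih => exact (output_prefix_of_step (h.step i hi)).trans ih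

theorem work_eq_default (h : IsRun M tape c T) {i : ℕ} (hi : i ≤ T) {z : ℤ}
    (hz : ∀ j ≤ T, (c j).workPos ≠ z) : (c i).work z = default := by
  induction i with
  | zero => rw [h.zero]; rfl
  | succ i ih =>
    rw [work_eq_of_step (h.step i hi) (hz i (by omega)).symm, ih (by omega)]

theorem exists_workPos_mem_Ico (h : IsRun M tape c T) {S : ℕ}
    (hS : (M.usedCells tape).encard ≤ S) :
    ∃ lo : ℤ, ∀ i ≤ T, (c i).workPos ∈ Set.Ico lo (lo + S) := by
  refine exists_forall_mem_Ico_of_card_image_le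
    (fun i hi => abs_workPos_sub_le_one_of_step (h.step i hi)) ?_
  rw [← Nat.cast_le (α := ℕ∞), ← Set.encard_coe_eq_coe_finsetCard]
  refine (Set.encard_le_encard fun z hz => ?_).trans hS
  obtain ⟨i, hi, rfl⟩ := Finset.mem_image.1 (Finset.mem_coe.1 hz)
  exact ⟨c i, h.reaches (Nat.lt_succ_iff.1 (Finset.mem_range.1 hi)), rfl⟩

end IsRun

/-! ### Pumping the input of a machine with a unary input alphabet -/

/-- The input tape of an offline machine on the unary input of length `n`. -/
def unaryTape (n : ℕ) : List (InputSymbol Unit) := plainTape (List.replicate n ())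

theorem length_plainTape {α : Type} (w : List α) : (plainTape w).length = w.length + 2 := by
  simp [plainTape]

theorem getD_plainTape {α : Type} (w : List α) (p : ℕ) : (plainTape w).getD p .rightEnd =
    if p = 0 then .leftEnd else (w[p - 1]?).elim .rightEnd .letter := by
  cases p with
  | zero => rfl
  | succ p =>
    rw [plainTape, List.getD_cons_succ, if_neg p.succ_ne_zero, Nat.add_sub_cancel]
    by_cases hp : p < w.length
    · rw [List.getD_append _ _ _ _ (by simpa using hp)]
      simp [hp]
    · rw [List.getD_append_right _ _ _ _ (by simpa using hp),
        List.getElem?_eq_none (Nat.le_of_not_lt hp)]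
      cases p - (w.map InputSymbol.letter).length <;> simp

theorem length_unaryTape (n : ℕ) : (unaryTape n).length = n + 2 := by
  rw [unaryTape, length_plainTape, List.length_replicate]

theorem getD_unaryTape (n p : ℕ) : (unaryTape n).getD p .rightEnd =
    if p = 0 then .leftEnd else if p ≤ n then .letter () else .rightEnd := by
  rw [unaryTape, getD_plainTape, List.getElem?_replicate]
  split_ifs <;> first | rfl | omega

/-- The configuration `c` with the input head moved to the cell `p`. -/
def Config.setPos {Q Γ : Type} (c : Config Q Γ) (p : ℕ) : Config Q Γ := { c with inputPos := p }

/-- The configuration `c` with the input head displaced by `e` cells. -/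
def Config.shift {Q Γ : Type} (c : Config Q Γ) (e : ℤ) : Config Q Γ :=
  c.setPos (c.inputPos + e).toNat

theorem Config.shift_eq_shift {Q Γ : Type} {c c' : Config Q Γ} (h : c.setPos 0 = c'.setPos 0)
    {e e' : ℤ} (he : c.inputPos + e = c'.inputPos + e') : c.shift e = c'.shift e' := by
  cases c
  cases c'
  simp only [Config.setPos, Config.mk.injEq] at h
  simp only at he
  simp [Config.shift, Config.setPos, h, he]

/-- The head positions `p` on `unaryTape n` and `p + e` on `unaryTape n'` are of the same kind:
both on the left endmarker, both on the right endmarker, or both in between. -/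
def PosAgree (n n' : ℕ) (e : ℤ) (p : ℕ) : Prop :=
  p ≤ n + 1 ∧ 0 ≤ p + e ∧ p + e ≤ n' + 1 ∧ (p = 0 ↔ p + e = 0) ∧ (p = n + 1 ↔ p + e = n' + 1)

theorem PosAgree.getD_eq {n n' p : ℕ} {e : ℤ} (h : PosAgree n n' e p) :
    (unaryTape n').getD (p + e).toNat .rightEnd = (unaryTape n).getD p .rightEnd := by
  obtain ⟨h1, h2, h3, h4, h5⟩ := h
  rw [getD_unaryTape, getD_unaryTape]
  split_ifs <;> first | rfl | omega

theorem PosAgree.onInput_add {n n' p : ℕ} {e : ℤ} (h : PosAgree n n' e p) (m : Move) :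
    m.onInput (n' + 2) (p + e).toNat = (m.onInput (n + 2) p + e).toNat := by
  obtain ⟨h1, h2, h3, h4, h5⟩ := h
  cases m <;> simp only [Move.onInput] <;> omega

theorem posAgree_of_mem_Icc {n d p : ℕ} {e : ℤ} (hp : p ∈ Set.Icc 1 n)
    (he : e ∈ Set.Icc 0 (d : ℤ)) : PosAgree n (n + d) e p := by
  obtain ⟨hp1, hpn⟩ := hp
  obtain ⟨he0, hed⟩ := he
  refine ⟨?_, ?_, ?_, ?_, ?_⟩ <;> push_cast <;> omega

/-- The cell `p` of `unaryTape n` holds an endmarker. -/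
def AtEnd (n p : ℕ) : Prop := p = 0 ∨ p = n + 1

/-- The displacement of the endmarker in the cell `p` when the unary input gets longer by `d`. -/
def endShift (d p : ℕ) : ℤ := if p = 0 then 0 else d

theorem endShift_mem_Icc (d p : ℕ) : endShift d p ∈ Set.Icc 0 (d : ℤ) := by
  unfold endShift
  split_ifs <;> simp

theorem AtEnd.posAgree {n p : ℕ} (hp : AtEnd n p) (d : ℕ) :
    PosAgree n (n + d) (endShift d p) p := by
  rcases hp with rfl | rfl <;> simp only [endShift] <;> refine ⟨?_, ?_, ?_, ?_, ?_⟩ <;> grind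

section

variable {Γ : Type} {M : Machine Unit Γ} {n n' : ℕ} {e : ℤ}

theorem step_shift {c c' : Config M.Q Γ} (h : M.step (unaryTape n) c = some c')
    (ha : PosAgree n n' e c.inputPos) :
    M.step (unaryTape n') (c.shift e) = some (c'.shift e) := by
  obtain ⟨a, hδ, rfl⟩ := Option.map_eq_some_iff.1 h
  unfold Machine.step
  rw [show (unaryTape n').getD (c.shift e).inputPos .rightEnd = _ from ha.getD_eq,
    length_unaryTape, length_unaryTape]
  change Option.map _ (M.δ c.state _ (c.work c.workPos)) = _
  rw [hδ, Option.map_some]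
  congr 1
  simp only [Config.shift, Config.setPos, Config.mk.injEq, true_and, and_true]
  exact ha.onInput_add a.inputMove

theorem step_shift_eq_none {c : Config M.Q Γ} (h : M.step (unaryTape n) c = none)
    (ha : PosAgree n n' e c.inputPos) : M.step (unaryTape n') (c.shift e) = none := by
  unfold Machine.step at h ⊢
  rw [show (unaryTape n').getD (c.shift e).inputPos .rightEnd = _ from ha.getD_eq]
  rw [Option.map_eq_none_iff] at h ⊢
  exact h

variable {c : ℕ → Config M.Q Γ} {T : ℕ}

theorem reaches_shift (hc : ∀ i < T, M.step (unaryTape n) (c i) = some (c (i + 1))) {a b : ℕ}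
    (hab : a ≤ b) (hb : b ≤ T) (h : ∀ r, a ≤ r → r < b → PosAgree n n' e (c r).inputPos) :
    StateTransition.Reaches (M.step (unaryTape n')) ((c a).shift e) ((c b).shift e) := by
  induction b, hab using Nat.le_induction with
  | base => exact Relation.ReflTransGen.refl
  | succ b hab ih =>
    exact (ih (by omega) fun r h1 h2 => h r h1 (by omega)).tail
      (step_shift (hc b (by omega)) (h b hab (Nat.lt_succ_self b)))

theorem reaches_shift_of_inputPos_mem_Icc
    (hc : ∀ i < T, M.step (unaryTape n) (c i) = some (c (i + 1))) {a b d : ℕ} (hab : a ≤ b)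
    (hb : b ≤ T) (he : e ∈ Set.Icc 0 (d : ℤ)) (ha : PosAgree n (n + d) e (c a).inputPos)
    (hin : ∀ r, a < r → r < b → (c r).inputPos ∈ Set.Icc 1 n) :
    StateTransition.Reaches (M.step (unaryTape (n + d))) ((c a).shift e) ((c b).shift e) := by
  refine reaches_shift hc hab hb fun r hr hrb => ?_
  rcases hr.eq_or_lt with rfl | hr
  · exact ha
  · exact posAgree_of_mem_Icc (hin r hr hrb) he

theorem reaches_shift_loop (hc : ∀ i < T, M.step (unaryTape n) (c i) = some (c (i + 1)))
    {a b d : ℕ} (hab : a ≤ b) (hb : b ≤ T) (hcore : (c a).setPos 0 = (c b).setPos 0)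
    (hin : ∀ r, a ≤ r → r < b → (c r).inputPos ∈ Set.Icc 1 n) (he : e ∈ Set.Icc 0 (d : ℤ)) (l : ℕ)
    (hl : e + l * ((c b).inputPos - (c a).inputPos) ∈ Set.Icc 0 (d : ℤ)) :
    StateTransition.Reaches (M.step (unaryTape (n + d))) ((c a).shift e)
      ((c a).shift (e + l * ((c b).inputPos - (c a).inputPos))) := by
  induction l with
  | zero => simp only [Nat.cast_zero, zero_mul, add_zero]; exact Relation.ReflTransGen.refl
  | succ l ih =>
    have hl' : e + l * ((c b).inputPos - (c a).inputPos) ∈ Set.Icc 0 (d : ℤ) := by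
      obtain ⟨he0, hed⟩ := he
      obtain ⟨hl0, hld⟩ := hl
      push_cast at hl0 hld
      rcases le_total (0 : ℤ) ((c b).inputPos - (c a).inputPos) with h | h <;>
        constructor <;> nlinarith
    have hloop := reaches_shift hc hab hb fun r hr hrb => posAgree_of_mem_Icc (hin r hr hrb) hl'
    rw [Config.shift_eq_shift (c := c b) hcore.symm
      (e' := e + (l + 1 : ℕ) * ((c b).inputPos - (c a).inputPos)) (by push_cast; ring)] at hloop
    exact (ih hl').trans hloop

theorem exists_loop_of_inputPos_ne
    (hc : ∀ i < T, |((c (i + 1)).inputPos : ℤ) - (c i).inputPos| ≤ 1)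
    {F : Finset (Config M.Q Γ)} (hF : F.card < n) (hcF : ∀ i ≤ T, (c i).setPos 0 ∈ F)
    {d : ℕ} (hd : ∀ k, 1 ≤ k → k ≤ n → k ∣ d) {s t : ℕ} (hst : s ≤ t) (htT : t ≤ T)
    (hs : AtEnd n (c s).inputPos) (ht : AtEnd n (c t).inputPos)
    (hne : (c s).inputPos ≠ (c t).inputPos) :
    ∃ a b l : ℕ, s < a ∧ a < b ∧ b < t ∧ (c a).setPos 0 = (c b).setPos 0 ∧
      endShift d (c s).inputPos + l * ((c b).inputPos - (c a).inputPos) =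
        endShift d (c t).inputPos := by
  obtain ⟨σ, hσ, hσst⟩ : ∃ σ : ℤ, |σ| = 1 ∧ (c t).inputPos - (c s).inputPos = σ * (n + 1) ∧
      endShift d (c t).inputPos - endShift d (c s).inputPos = σ * d := by
    rcases hs with hs | hs <;> rcases ht with ht | ht
    · exact absurd (hs.trans ht.symm) hne
    · exact ⟨1, rfl, by simp [hs, ht, endShift]⟩
    · exact ⟨-1, rfl, by simp [hs, ht, endShift]⟩
    · exact absurd (hs.trans ht.symm) hne
  have hσσ : σ * σ = 1 := by rw [← abs_mul_abs_self, hσ, one_mul]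
  obtain ⟨hpos, hshift⟩ := hσst
  have hgt : σ * ((c t).inputPos - (c s).inputPos : ℤ) = n + 1 := by
    rw [hpos, ← mul_assoc, hσσ, one_mul]
  obtain ⟨a, b, hsa, hab, hbt, hcore, ha, hgab, hb⟩ := exists_eq_of_card_lt
    (x := fun i => (c i).setPos 0) (g := fun i => σ * ((c i).inputPos - (c s).inputPos)) (n := n)
    hst (fun i _ hi => by
      rw [← mul_sub, sub_sub_sub_cancel_right, abs_mul, hσ, one_mul]
      exact hc i (by omega)) (by simp) (by omega) hF (fun i _ hi => hcF i (by omega))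
  have hgap : σ * ((c b).inputPos - (c a).inputPos : ℤ) =
      σ * ((c b).inputPos - (c s).inputPos) - σ * ((c a).inputPos - (c s).inputPos) := by ring
  obtain ⟨l, hl⟩ := hd (σ * ((c b).inputPos - (c a).inputPos)).toNat (by omega) (by omega)
  refine ⟨a, b, l, lt_of_le_of_ne hsa ?_, hab, lt_of_le_of_ne hbt ?_, hcore, ?_⟩
  · rintro rfl
    simp at ha
  · rintro rfl
    omega
  · have hdl : (d : ℤ) = σ * ((c b).inputPos - (c a).inputPos) * l := by
      rw [hl, Nat.cast_mul, Int.toNat_of_nonneg (by omega)]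
    rw [hdl] at hshift
    linear_combination -hshift + l * ((c b).inputPos - (c a).inputPos) * (-hσσ)

theorem reaches_shift_endShift (hc : ∀ i < T, M.step (unaryTape n) (c i) = some (c (i + 1)))
    (hcn : ∀ i ≤ T, (c i).inputPos ≤ n + 1)
    {F : Finset (Config M.Q Γ)} (hF : F.card < n) (hcF : ∀ i ≤ T, (c i).setPos 0 ∈ F)
    {d : ℕ} (hd : ∀ k, 1 ≤ k → k ≤ n → k ∣ d) {s t : ℕ} (hst : s ≤ t) (htT : t ≤ T)
    (hs : AtEnd n (c s).inputPos) (ht : AtEnd n (c t).inputPos)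
    (hin : ∀ r, s < r → r < t → (c r).inputPos ∈ Set.Icc 1 n) :
    StateTransition.Reaches (M.step (unaryTape (n + d)))
      ((c s).shift (endShift d (c s).inputPos)) ((c t).shift (endShift d (c t).inputPos)) := by
  have hes := endShift_mem_Icc d (c s).inputPos
  have het := endShift_mem_Icc d (c t).inputPos
  by_cases hne : (c s).inputPos = (c t).inputPos
  · rw [← hne]
    exact reaches_shift_of_inputPos_mem_Icc hc hst htT hes (hs.posAgree d) hin
  · obtain ⟨a, b, l, hsa, hab, hbt, hcore, hl⟩ := exists_loop_of_inputPos_ne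
      (fun i hi => abs_inputPos_sub_le_one_of_step (hc i hi)
        (by simpa [length_unaryTape] using hcn i hi.le)) hF hcF hd hst htT hs ht hne
    have hto := reaches_shift_of_inputPos_mem_Icc hc hsa.le (by omega) hes (hs.posAgree d)
      fun r hr hra => hin r hr (by omega)
    have hloop := reaches_shift_loop hc hab.le (by omega) hcore
      (fun r hr hrb => hin r (by omega) (by omega)) hes l (hl ▸ het)
    have hfrom := reaches_shift_of_inputPos_mem_Icc hc (hab.trans hbt).le htT het
      (posAgree_of_mem_Icc (hin a hsa (by omega)) het) fun r hr hrt => hin r (by omega) hrt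
    rw [hl] at hloop
    exact hto.trans (hloop.trans hfrom)

end

theorem exists_last_of_lt {P : ℕ → Prop} {i : ℕ} (h0 : P 0) (hi : 0 < i) :
    ∃ s < i, P s ∧ ∀ r, s < r → r < i → ¬ P r := by
  classical
  exact ⟨Nat.findGreatest P (i - 1), by have := Nat.findGreatest_le (P := P) (i - 1); omega,
    Nat.findGreatest_spec (Nat.zero_le _) h0,
    fun r hr hri => Nat.findGreatest_is_greatest hr (by omega)⟩

namespace IsRun

variable {Γ : Type} [Inhabited Γ] {M : Machine Unit Γ} {n : ℕ} {c : ℕ → Config M.Q Γ} {T : ℕ}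

theorem exists_last_atEnd (hc : IsRun M (unaryTape n) c T) {i : ℕ} (hi : 0 < i)
    (hiT : i ≤ T + 1) : ∃ s < i, AtEnd n (c s).inputPos ∧
      ∀ r, s < r → r < i → (c r).inputPos ∈ Set.Icc 1 n := by
  obtain ⟨s, hsi, hs, hlast⟩ := exists_last_of_lt (P := fun i => AtEnd n (c i).inputPos)
    (Or.inl (by rw [hc.zero]; rfl)) hi
  refine ⟨s, hsi, hs, fun r hr hri => ?_⟩
  have hle := hc.inputPos_le (i := r) (by omega)
  have hin := hlast r hr hri
  simp only [AtEnd, length_unaryTape] at hin hle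
  exact ⟨by omega, by omega⟩

/-- On every trip between the endmarkers a work configuration occurs at two distances from the
start, and repeating the part in between adapts the trip to the longer input. -/
theorem outputs_add (hc : IsRun M (unaryTape n) c T) {F : Finset (Config M.Q Γ)}
    (hF : F.card < n) (hcF : ∀ i ≤ T, (c i).setPos 0 ∈ F)
    {d : ℕ} (hd : ∀ k, 1 ≤ k → k ≤ n → k ∣ d) :
    M.Outputs (unaryTape (n + d)) (c T).output := by
  have hcn : ∀ i ≤ T, (c i).inputPos ≤ n + 1 := fun i hi => by
    simpa [length_unaryTape] using hc.inputPos_le hi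
  have hreach : ∀ i ≤ T, AtEnd n (c i).inputPos →
      StateTransition.Reaches (M.step (unaryTape (n + d))) M.init
        ((c i).shift (endShift d (c i).inputPos)) := by
    intro i
    induction i using Nat.strong_induction_on with
    | _ i ih =>
      intro hiT hi
      rcases Nat.eq_zero_or_pos i with rfl | hi0
      · rw [hc.zero]
        exact Relation.ReflTransGen.refl
      · obtain ⟨s, hsi, hs, hin⟩ := hc.exists_last_atEnd hi0 (by omega)
        exact (ih s hsi (by omega) hs).trans
          (reaches_shift_endShift hc.step hcn hF hcF hd hsi.le hiT hs hi hin)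
  obtain ⟨s, hsT, hs, hin⟩ := hc.exists_last_atEnd (Nat.succ_pos T) le_rfl
  have hes := endShift_mem_Icc d (c s).inputPos
  have hlast := reaches_shift_of_inputPos_mem_Icc hc.step (Nat.lt_succ_iff.1 hsT) le_rfl hes
    (hs.posAgree d) fun r hr hrT => hin r hr (by omega)
  refine ⟨_, (hreach s (by omega) hs).trans hlast, step_shift_eq_none hc.halt ?_, rfl⟩
  rcases (Nat.lt_succ_iff.1 hsT).eq_or_lt with rfl | hsT
  · exact hs.posAgree d
  · exact posAgree_of_mem_Icc (hin T hsT (Nat.lt_succ_self T)) hes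

end IsRun

/-! ### Computable functions of the input length grow logarithmically -/

/-- The number with a given binary representation, most significant bit first. -/
def bitVal (l : List Bool) : ℕ := l.foldl (fun a b => 2 * a + b.toNat) 0

theorem bitVal_append (l l' : List Bool) :
    bitVal (l ++ l') = l'.foldl (fun a b => 2 * a + b.toNat) (bitVal l) :=
  List.foldl_append ..

theorem bitVal_mono {l l' : List Bool} (h : l <+: l') : bitVal l ≤ bitVal l' := by
  obtain ⟨t, rfl⟩ := h
  rw [bitVal_append]
  generalize bitVal l = a
  induction t generalizing a with
  | nil => exact le_rfl
  | cons b t ih => exact le_trans (by omega) (ih (2 * a + b.toNat))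

theorem bitVal_binary (k : ℕ) : bitVal (binary k) = k := by
  unfold bitVal binary
  rw [List.foldl_reverse]
  induction k using Nat.binaryRec' with
  | zero => simp
  | bit b n h ih =>
    rw [Nat.bits_append_bit n b h, List.foldr_cons, ih, Nat.bit_val]

theorem length_binary_le (k : ℕ) : (binary k).length ≤ k := by
  rw [binary, List.length_reverse, Nat.size_eq_bits_len]
  exact Nat.size_le.2 Nat.lt_two_pow_self

namespace IsRun

variable {α Γ : Type} [Inhabited Γ] {M : Machine α Γ} {tape : List (InputSymbol α)}
  {c : ℕ → Config M.Q Γ} {T : ℕ}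

theorem setPos_eq_setPos (hc : IsRun M tape c T) {lo : ℤ} {S : ℕ}
    (hlo : ∀ i ≤ T, (c i).workPos ∈ Set.Ico lo (lo + S)) {i j : ℕ} (hi : i ≤ T) (hj : j ≤ T)
    (hstate : (c i).state = (c j).state)
    (hwork : ∀ k : Fin S, (c i).work (lo + k) = (c j).work (lo + k))
    (hpos : (c i).workPos = (c j).workPos)
    (hlen : (c i).output.length = (c j).output.length) (p : ℕ) :
    (c i).setPos p = (c j).setPos p := by
  simp only [Config.setPos, Config.mk.injEq, hstate, hpos, true_and]
  refine ⟨funext fun z => ?_, (List.prefix_of_prefix_length_le (hc.output_prefix hi)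
    (hc.output_prefix hj) hlen.le).eq_of_length hlen⟩
  by_cases hz : z ∈ Set.Ico lo (lo + S)
  · obtain ⟨k, rfl⟩ := Int.le.dest hz.1
    exact hwork ⟨k, by have := hz.2; omega⟩
  · have hunvisited : ∀ j ≤ T, (c j).workPos ≠ z := fun j hj hjz => hz (hjz ▸ hlo j hj)
    rw [hc.work_eq_default hi hunvisited, hc.work_eq_default hj hunvisited]

theorem exists_finset_card_le [Finite Γ] (hc : IsRun M tape c T) {S : ℕ}
    (hS : (M.usedCells tape).encard ≤ S) (p : ℕ) :
    ∃ F : Finset (Config M.Q Γ), (∀ i ≤ T, (c i).setPos p ∈ F) ∧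
      F.card ≤ Nat.card M.Q * (Nat.card Γ ^ S * (S * ((c T).output.length + 1))) := by
  classical
  have := M.finite_Q
  have := Fintype.ofFinite M.Q
  have := Fintype.ofFinite Γ
  obtain ⟨lo, hlo⟩ := hc.exists_workPos_mem_Ico hS
  let code (d : Config M.Q Γ) : M.Q × (Fin S → Γ) × ℕ × ℕ :=
    (d.state, fun k => d.work (lo + k), (d.workPos - lo).toNat, d.output.length)
  let codes : Finset (M.Q × (Fin S → Γ) × ℕ × ℕ) :=
    .univ ×ˢ .univ ×ˢ .range S ×ˢ .range ((c T).output.length + 1)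
  let F := (Finset.range (T + 1)).image fun i => (c i).setPos p
  refine ⟨F, fun i hi => Finset.mem_image_of_mem (fun i => (c i).setPos p)
    (Finset.mem_range.2 (Nat.lt_succ_iff.2 hi)), ?_⟩
  have hF : ∀ d ∈ F, ∃ i ≤ T, (c i).setPos p = d := fun d hd => by
    simpa [F, Nat.lt_succ_iff] using hd
  have hcard : F.card ≤ codes.card := by
    refine Finset.card_le_card_of_injOn code (fun d hd => ?_) fun d hd d' hd' h => ?_
    · obtain ⟨i, hi, rfl⟩ := hF d hd
      obtain ⟨h1, h2⟩ := hlo i hi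
      have hlen := (hc.output_prefix hi).length_le
      simp only [codes, code, Config.setPos, Finset.coe_product, Set.mem_prod, Finset.coe_univ,
        Set.mem_univ, Finset.mem_coe, Finset.mem_range, true_and]
      omega
    · obtain ⟨i, hi, rfl⟩ := hF d hd
      obtain ⟨j, hj, rfl⟩ := hF d' hd'
      simp only [code, Config.setPos, Prod.mk.injEq] at h
      have hi' := (hlo i hi).1
      have hj' := (hlo j hj).1
      exact hc.setPos_eq_setPos hlo hi hj h.1 (congrFun h.2.1) (by omega) h.2.2.2 p
  simpa [codes, Nat.card_eq_fintype_card] using hcard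

end IsRun

theorem le_of_computesInSpace {Γ : Type} [Inhabited Γ] [Finite Γ] {M : Machine Unit Γ}
    {f s : ℕ → ℕ} (hM : M.ComputesInSpace plainTape (fun w => binary (f w.length)) s)
    (hf : Tendsto f atTop atTop) (n : ℕ) :
    n ≤ Nat.card M.Q * (Nat.card Γ ^ s n * (s n * (f n + 1))) := by
  by_contra! hlt
  have hM' (n : ℕ) : M.Outputs (unaryTape n) (binary (f n)) ∧
      (M.usedCells (unaryTape n)).encard ≤ s n := by
    simpa only [unaryTape, List.length_replicate] using hM (List.replicate n ())
  obtain ⟨c, T, hc, hout⟩ := (hM' n).1.exists_isRun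
  obtain ⟨F, hcF, hcard⟩ := hc.exists_finset_card_le (hM' n).2 0
  have hF : F.card < n := by
    refine lt_of_le_of_lt (hcard.trans ?_) hlt
    rw [hout]
    have := length_binary_le (f n)
    gcongr
  have hconst (k : ℕ) : f (n + k * n.factorial) = f n := by
    have hpump := hc.outputs_add hF hcF (d := k * n.factorial) fun i hi hin =>
      Dvd.dvd.mul_left (Nat.dvd_factorial hi hin) k
    rw [hout] at hpump
    simpa only [bitVal_binary] using congrArg bitVal ((hM' _).1.unique hpump)
  obtain ⟨N, hN⟩ := (hf.eventually_ge_atTop (f n + 1)).exists_forall_of_atTop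
  have hbig := hN (n + N * n.factorial)
    (le_add_left (Nat.le_mul_of_pos_right _ n.factorial_pos))
  rw [hconst] at hbig
  omega

/-! ### Register programs -/

/-- Structured programs over registers holding natural numbers, with one-way access to the
input tape. `loop r p` repeats `p` while the register `r` is not `0`, and `switch` branches on the
scanned input symbol. -/
inductive Prog (α : Type) : Type
  | skip
  | inc (r : ℕ)
  | dec (r : ℕ)
  | seq (p q : Prog α)
  | loop (r : ℕ) (p : Prog α)
  | ifz (r : ℕ) (p q : Prog α)
  | switch (f : InputSymbol α → Prog α)
  | advance
  | print (b : Bool)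

/-- The data a register program works on: the registers, the position of the input head, and the
bits printed so far. -/
structure ProgState where
  regs : ℕ → ℕ
  ipos : ℕ
  out : List Bool

/-- Big-step semantics of register programs in which registers never grow beyond `B`. -/
inductive Run {α : Type} (tape : List (InputSymbol α)) (B : ℕ) :
    Prog α → ProgState → ProgState → Prop
  | skip (w) : Run tape B .skip w w
  | inc (r) (w : ProgState) : w.regs r + 1 ≤ B →
      Run tape B (.inc r) w { w with regs := Function.update w.regs r (w.regs r + 1) }
  | dec (r) (w : ProgState) : w.regs r ≠ 0 →
      Run tape B (.dec r) w { w with regs := Function.update w.regs r (w.regs r - 1) }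
  | seq {p q w₁ w₂ w₃} :
      Run tape B p w₁ w₂ → Run tape B q w₂ w₃ → Run tape B (.seq p q) w₁ w₃
  | loop_done {r p} {w : ProgState} : w.regs r = 0 → Run tape B (.loop r p) w w
  | loop_step {r p} {w₁ w₂ w₃ : ProgState} : w₁.regs r ≠ 0 → Run tape B p w₁ w₂ →
      Run tape B (.loop r p) w₂ w₃ → Run tape B (.loop r p) w₁ w₃
  | ifz_zero {r p q} {w₁ w₂ : ProgState} : w₁.regs r = 0 → Run tape B p w₁ w₂ →
      Run tape B (.ifz r p q) w₁ w₂
  | ifz_pos {r p q} {w₁ w₂ : ProgState} : w₁.regs r ≠ 0 → Run tape B q w₁ w₂ →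
      Run tape B (.ifz r p q) w₁ w₂
  | switch {f} {w₁ w₂ : ProgState} : Run tape B (f (tape.getD w₁.ipos .rightEnd)) w₁ w₂ →
      Run tape B (.switch f) w₁ w₂
  | advance (w : ProgState) :
      Run tape B .advance w { w with ipos := Move.right.onInput tape.length w.ipos }
  | print (b) (w : ProgState) : Run tape B (.print b) w { w with out := w.out ++ [b] }

/-- All registers of the program are among `0, …, k`. -/
def Prog.UsesUpTo {α : Type} (k : ℕ) : Prog α → Prop
  | .skip => True
  | .inc r => r ≤ k
  | .dec r => r ≤ k
  | .seq p q => p.UsesUpTo k ∧ q.UsesUpTo k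
  | .loop r p => r ≤ k ∧ p.UsesUpTo k
  | .ifz r p q => r ≤ k ∧ p.UsesUpTo k ∧ q.UsesUpTo k
  | .switch f => ∀ a, (f a).UsesUpTo k
  | .advance => True
  | .print _ => True

theorem Prog.UsesUpTo.mono {α : Type} {k l : ℕ} (h : k ≤ l) {p : Prog α} (hp : p.UsesUpTo k) :
    p.UsesUpTo l := by
  induction p with
  | skip => trivial
  | inc r => exact le_trans hp h
  | dec r => exact le_trans hp h
  | seq p q ihp ihq => exact ⟨ihp hp.1, ihq hp.2⟩
  | loop r p ih => exact ⟨hp.1.trans h, ih hp.2⟩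
  | ifz r p q ihp ihq => exact ⟨hp.1.trans h, ihp hp.2.1, ihq hp.2.2⟩
  | switch f ih => exact fun a => ih a (hp a)
  | advance => trivial
  | print b => trivial

instance {α : Type} [Finite α] : Finite (InputSymbol α) :=
  Finite.of_injective
    (fun a : InputSymbol α => (match a with
      | .letter a => .inl a
      | .blank => .inr 0
      | .leftEnd => .inr 1
      | .rightEnd => .inr 2 : α ⊕ Fin 3))
    (by intro a b h; cases a <;> cases b <;> simp_all)

theorem Prog.exists_usesUpTo {α : Type} [Finite α] (p : Prog α) : ∃ k, p.UsesUpTo k := by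
  induction p with
  | skip => exact ⟨0, trivial⟩
  | inc r => exact ⟨r, le_refl r⟩
  | dec r => exact ⟨r, le_refl r⟩
  | seq p q ihp ihq =>
    obtain ⟨k, hk⟩ := ihp
    obtain ⟨l, hl⟩ := ihq
    exact ⟨max k l, hk.mono (le_max_left _ _), hl.mono (le_max_right _ _)⟩
  | loop r p ih =>
    obtain ⟨k, hk⟩ := ih
    exact ⟨max r k, le_max_left _ _, hk.mono (le_max_right _ _)⟩
  | ifz r p q ihp ihq =>
    obtain ⟨k, hk⟩ := ihp
    obtain ⟨l, hl⟩ := ihq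
    exact ⟨max r (max k l), le_max_left _ _, hk.mono (by omega), hl.mono (by omega)⟩
  | switch f ih =>
    choose k hk using ih
    obtain ⟨l, hl⟩ := (Set.finite_range k).bddAbove
    exact ⟨l, fun a => (hk a).mono (hl ⟨a, rfl⟩)⟩
  | advance => exact ⟨0, trivial⟩
  | print b => exact ⟨0, trivial⟩

theorem Run.regs_le {α : Type} {tape : List (InputSymbol α)} {B : ℕ} {p : Prog α}
    {w w' : ProgState} (h : Run tape B p w w') (hw : ∀ r, w.regs r ≤ B) : ∀ r, w'.regs r ≤ B := by
  induction h with
  | skip | advance | print => exact hw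
  | inc r w h =>
    intro j
    rcases eq_or_ne j r with rfl | hj
    · simpa using h
    · simpa [hj] using hw j
  | dec r w h =>
    intro j
    rcases eq_or_ne j r with rfl | hj
    · simpa using (hw j).trans (Nat.le_succ _)
    · simpa [hj] using hw j
  | seq _ _ ih₁ ih₂ => exact ih₂ (ih₁ hw)
  | loop_done => exact hw
  | loop_step _ _ _ ih₁ ih₂ => exact ih₂ (ih₁ hw)
  | ifz_zero _ _ ih => exact ih hw
  | ifz_pos _ _ ih => exact ih hw
  | switch _ ih => exact ih hw
/-! ### Registers on the tracks of a work tape -/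

/-- Work cells with `k + 1` tracks. Cells that are not in use are `none`; the boolean component
marks the origin of the tape. -/
abbrev Cell (k : ℕ) := Option (Bool × (Fin (k + 1) → Bool))

/-- The work tape whose first `ℓ` cells are in use and hold the registers in binary, least
significant bit first. -/
def regTape (k ℓ : ℕ) (σ : ℕ → ℕ) : ℤ → Cell k := fun z =>
  if 0 ≤ z ∧ z < ℓ then some (decide (z = 0), fun r => (σ r).testBit z.toNat) else none

theorem regTape_of_lt {k ℓ i : ℕ} (σ : ℕ → ℕ) (h : i < ℓ) :
    regTape k ℓ σ i = some (decide (i = 0), fun r : Fin (k + 1) => (σ r).testBit i) := by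
  simp [regTape, h]

theorem regTape_self (k ℓ : ℕ) (σ : ℕ → ℕ) : regTape k ℓ σ ℓ = none := by
  simp [regTape]

theorem update_regTape {k ℓ i v : ℕ} {r : Fin (k + 1)} {σ : ℕ → ℕ} (hi : i < ℓ)
    (hv : ∀ j, j ≠ i → v.testBit j = (σ r).testBit j) :
    Function.update (regTape k ℓ σ) i (some (decide (i = 0), Function.update
      (fun r' : Fin (k + 1) => (σ r').testBit i) r (v.testBit i))) =
      regTape k ℓ (Function.update σ r v) := by
  funext z
  by_cases hz : z = i
  · subst hz
    rw [Function.update_self, regTape_of_lt _ hi]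
    congr 2
    funext r'
    simp only [Function.update_apply, Fin.val_inj]
    split_ifs <;> rfl
  · rw [Function.update_of_ne hz]
    unfold regTape
    split_ifs with h
    · congr 2
      funext r'
      by_cases hr' : (r' : ℕ) = r
      · rw [hr', Function.update_self, hv _ (by omega)]
      · rw [Function.update_of_ne hr']
    · rfl

theorem testBit_add_two_pow {y i : ℕ} (h : y.testBit i = false) (j : ℕ) :
    (y + 2 ^ i).testBit j = if j = i then true else y.testBit j := by
  rw [Nat.add_comm]
  rcases lt_trichotomy j i with hj | rfl | hj
  · rw [Nat.testBit_two_pow_add_gt hj, if_neg hj.ne]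
  · rw [Nat.testBit_two_pow_add_eq, h, if_pos rfl, Bool.not_false]
  · have heven : y / 2 ^ i % 2 = 0 := by
      simpa [Nat.testBit_eq_decide_div_mod_eq] using h
    have hquot : (2 ^ i + y) / 2 ^ i = y / 2 ^ i + 1 := Nat.add_div_left _ (by positivity)
    obtain ⟨d, rfl⟩ := Nat.exists_eq_add_of_lt hj
    rw [if_neg hj.ne', show i + d + 1 = d + 1 + i by omega, Nat.testBit_add, Nat.testBit_add y,
      hquot, Nat.testBit_add_one, Nat.testBit_add_one (y / 2 ^ i)]
    congr 1
    omega

theorem testBit_sub_two_pow {y i : ℕ} (h : y.testBit i = true) (j : ℕ) :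
    (y - 2 ^ i).testBit j = if j = i then false else y.testBit j := by
  have hle : 2 ^ i ≤ y := Nat.ge_two_pow_of_testBit h
  have hi : (y - 2 ^ i).testBit i = false := by
    have hflip := Nat.testBit_two_pow_add_eq (y - 2 ^ i) i
    rw [Nat.add_sub_cancel' hle, h] at hflip
    simpa using hflip.symm
  have hj := testBit_add_two_pow hi j
  rw [Nat.sub_add_cancel hle] at hj
  split_ifs with hji
  · rw [hji, hi]
  · rw [hj, if_neg hji]

theorem add_two_pow_lt_of_testBit_eq_false {y i ℓ : ℕ} (hy : y < 2 ^ ℓ) (hi : i < ℓ)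
    (h : y.testBit i = false) : y + 2 ^ i < 2 ^ ℓ := by
  refine Nat.lt_pow_two_of_testBit _ fun j hj => ?_
  rw [testBit_add_two_pow h, if_neg (by omega)]
  exact Nat.testBit_lt_two_pow (hy.trans_le (Nat.pow_le_pow_right two_pos hj))

theorem update_regTape_self {k ℓ : ℕ} {r : Fin (k + 1)} {σ : ℕ → ℕ} (hℓ : ℓ ≠ 0)
    (hσ : ∀ j ≤ k, σ j < 2 ^ ℓ) :
    Function.update (regTape k ℓ σ) ℓ (some (false, fun r' => decide (r' = r))) =
      regTape k (ℓ + 1) (Function.update σ r (σ r + 2 ^ ℓ)) := by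
  have htop (r' : Fin (k + 1)) : (σ r').testBit ℓ = false :=
    Nat.testBit_lt_two_pow (hσ r' (by omega))
  have hbit (r' : Fin (k + 1)) (j : ℕ) : (Function.update σ r (σ r + 2 ^ ℓ) r').testBit j =
      if j = ℓ then decide (r' = r) else (σ r').testBit j := by
    simp only [Function.update_apply, Fin.val_inj]
    split_ifs with hr hj hj
    · rw [testBit_add_two_pow (htop r), if_pos hj, decide_eq_true hr]
    · rw [testBit_add_two_pow (htop r), if_neg hj, hr]
    · rw [hj, htop, decide_eq_false hr]
    · rfl
  funext z
  by_cases hz : z = ℓ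
  · subst hz
    rw [Function.update_self, regTape_of_lt _ (Nat.lt_succ_self ℓ)]
    simp [hbit, hℓ]
  · rw [Function.update_of_ne hz]
    unfold regTape
    by_cases h : 0 ≤ z ∧ z < ℓ
    · rw [if_pos h, if_pos ⟨h.1, by push_cast; omega⟩]
      congr 2
      funext r'
      rw [hbit, if_neg (by omega)]
    · rw [if_neg h, if_neg (by push_cast; omega)]

/-! ### Elementary register operations on the work tape -/

/-- The elementary register operations. -/
inductive RegOp
  | inc
  | dec
  | test

/-- What an operation does to a cell it scans; a boolean tells that the operation is over. -/
def RegOp.onCell {k : ℕ} (r : Fin (k + 1)) : RegOp → Cell k → Cell k × Option Bool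
  | .inc, none => (some (false, fun r' => decide (r' = r)), some true)
  | .inc, some (o, b) =>
      if b r then (some (o, Function.update b r false), none)
      else (some (o, Function.update b r true), some true)
  | .dec, none => (none, some true)
  | .dec, some (o, b) =>
      if b r then (some (o, Function.update b r false), some true)
      else (some (o, Function.update b r true), none)
  | .test, none => (none, some false)
  | .test, some (o, b) => if b r then (some (o, b), some true) else (some (o, b), none)

/-- Control of an elementary operation: scan to the right, then go back to the origin. -/
inductive ScanState
  | scan
  | home (e : Bool)

instance : Finite ScanState :=
  Finite.of_injective
    (fun s : ScanState => (match s with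
      | .scan => none
      | .home e => some e : Option Bool))
    (by intro a b h; cases a <;> cases b <;> simp_all)

/-- The transitions of an elementary operation; it is left with its boolean result. -/
def scanStep {k : ℕ} (o : RegOp) (r : Fin (k + 1)) :
    ScanState → Cell k → Cell k × Move × (ScanState ⊕ Bool)
  | .scan, g =>
    match o.onCell r g with
    | (g', none) => (g', .right, .inl .scan)
    | (g', some e) => (g', .stay, .inl (.home e))
  | .home e, some (true, b) => (some (true, b), .stay, .inr e)
  | .home e, some (false, b) => (some (false, b), .left, .inl (.home e))
  | .home e, none => (none, .left, .inl (.home e))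

/-- Reachability by computations on the work cells `0, …, S`. -/
def ReachesIn {α Γ : Type} (M : Machine α Γ) (tape : List (InputSymbol α)) (S : ℕ) :
    Config M.Q Γ → Config M.Q Γ → Prop :=
  Relation.ReflTransGen fun c c' => M.step tape c = some c' ∧ 0 ≤ c.workPos ∧ c.workPos ≤ S

/-- The operation `o` on register `r` is a part of the machine `M`. -/
def EmbedsOp {α : Type} {k : ℕ} (M : Machine α (Cell k)) (o : RegOp) (r : Fin (k + 1))
    (ι : ScanState ⊕ Bool → M.Q) : Prop :=
  ∀ s a g, M.δ (ι (.inl s)) a g = some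
    { state := ι (scanStep o r s g).2.2, write := (scanStep o r s g).1,
      workMove := (scanStep o r s g).2.1, inputMove := .stay, print := none }

section

variable {α : Type} {k : ℕ} {M : Machine α (Cell k)} {o : RegOp} {r : Fin (k + 1)}
  {ι : ScanState ⊕ Bool → M.Q} {tape : List (InputSymbol α)} {S ℓ : ℕ}

theorem reachesIn_head {c c' c'' : Config M.Q (Cell k)} (h : M.step tape c = some c')
    (h0 : 0 ≤ c.workPos) (hS : c.workPos ≤ S) (h' : ReachesIn M tape S c' c'') :
    ReachesIn M tape S c c'' :=
  Relation.ReflTransGen.head ⟨h, h0, hS⟩ h'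

theorem reachesIn_home (hM : EmbedsOp M o r ι) (e : Bool) (hℓ : ℓ ≠ 0)
    (hS : ℓ ≤ S) (σ : ℕ → ℕ) (i : ℕ) (hi : i ≤ ℓ) (p : ℕ) (u : List Bool) :
    ReachesIn M tape S ⟨ι (.inl (.home e)), p, regTape k ℓ σ, i, u⟩
      ⟨ι (.inr e), p, regTape k ℓ σ, 0, u⟩ := by
  induction i with
  | zero =>
    refine reachesIn_head (c' := ⟨ι (.inr e), p, regTape k ℓ σ, 0, u⟩) ?_ le_rfl
      (Int.natCast_nonneg S) Relation.ReflTransGen.refl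
    have horigin := regTape_of_lt (k := k) σ (Nat.pos_of_ne_zero hℓ)
    simp only [Nat.cast_zero] at horigin
    simp [Machine.step, hM _ _ _, horigin, scanStep, Move.onInput, Move.onWork]
  | succ i ih =>
    refine reachesIn_head (c' := ⟨ι (.inl (.home e)), p, regTape k ℓ σ, i, u⟩) ?_
      (Int.natCast_nonneg _) (Int.ofNat_le.2 (by omega)) (ih (by omega))
    have hleft : scanStep o r (.home e) (regTape k ℓ σ ((i + 1 : ℕ) : ℤ)) =
        (regTape k ℓ σ ((i + 1 : ℕ) : ℤ), .left, .inl (.home e)) := by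
      rcases hi.lt_or_eq with h | h
      · rw [regTape_of_lt _ h]; simp [scanStep]
      · rw [h, regTape_self]; simp [scanStep]
    simp only [Machine.step, hM _ _ _, hleft, Option.map_some, Function.update_eq_self]
    simp [Move.onInput, Move.onWork]

theorem reachesIn_scan_return (hM : EmbedsOp M o r ι) {e : Bool} {ℓ' : ℕ} (hℓ : ℓ' ≠ 0)
    (hS : ℓ' ≤ S) {σ σ' : ℕ → ℕ} {i : ℕ} (hi : i ≤ ℓ') {p : ℕ} {u : List Bool}
    {g : Cell k} (hg : o.onCell r (regTape k ℓ σ i) = (g, some e))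
    (hu : Function.update (regTape k ℓ σ) i g = regTape k ℓ' σ') :
    ReachesIn M tape S ⟨ι (.inl .scan), p, regTape k ℓ σ, i, u⟩
      ⟨ι (.inr e), p, regTape k ℓ' σ', 0, u⟩ := by
  refine reachesIn_head (c' := ⟨ι (.inl (.home e)), p, regTape k ℓ' σ', i, u⟩) ?_
    (Int.natCast_nonneg i) (Int.ofNat_le.2 (hi.trans hS)) (reachesIn_home hM e hℓ hS σ' i hi p u)
  simp [Machine.step, hM _ _ _, scanStep, hg, hu, Move.onInput, Move.onWork]

theorem reachesIn_scan_go (hM : EmbedsOp M o r ι) (hS : ℓ ≤ S)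
    {σ σ' : ℕ → ℕ} {i : ℕ} (hi : i < ℓ) {p : ℕ} {u : List Bool} {g : Cell k}
    (hg : o.onCell r (regTape k ℓ σ i) = (g, none))
    (hu : Function.update (regTape k ℓ σ) i g = regTape k ℓ σ') {c : Config M.Q (Cell k)}
    (h : ReachesIn M tape S ⟨ι (.inl .scan), p, regTape k ℓ σ', (i + 1 : ℕ), u⟩ c) :
    ReachesIn M tape S ⟨ι (.inl .scan), p, regTape k ℓ σ, i, u⟩ c := by
  refine reachesIn_head ?_ (Int.natCast_nonneg i) (Int.ofNat_le.2 (hi.le.trans hS)) h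
  simp [Machine.step, hM _ _ _, scanStep, hg, hu, Move.onInput, Move.onWork]

variable {σ : ℕ → ℕ} {i : ℕ}

theorem exists_onCell_of_testBit_eq_true (hi : i < ℓ) (h : (σ r).testBit i = true) :
    ∃ g : Cell k, Function.update (regTape k ℓ σ) i g =
        regTape k ℓ (Function.update σ r (σ r - 2 ^ i)) ∧
      RegOp.onCell r .inc (regTape k ℓ σ i) = (g, none) ∧
      RegOp.onCell r .dec (regTape k ℓ σ i) = (g, some true) := by
  refine ⟨_, update_regTape hi fun j hj => by rw [testBit_sub_two_pow h, if_neg hj], ?_, ?_⟩ <;>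
  simp [regTape_of_lt σ hi, testBit_sub_two_pow h, RegOp.onCell, h]

theorem exists_onCell_of_testBit_eq_false (hi : i < ℓ) (h : (σ r).testBit i = false) :
    ∃ g : Cell k, Function.update (regTape k ℓ σ) i g =
        regTape k ℓ (Function.update σ r (σ r + 2 ^ i)) ∧
      RegOp.onCell r .inc (regTape k ℓ σ i) = (g, some true) ∧
      RegOp.onCell r .dec (regTape k ℓ σ i) = (g, none) := by
  refine ⟨_, update_regTape hi fun j hj => by rw [testBit_add_two_pow h, if_neg hj], ?_, ?_⟩ <;>
  simp [regTape_of_lt σ hi, testBit_add_two_pow h, RegOp.onCell, h]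

theorem update_lt_of_lt {B v : ℕ} (hσ : ∀ j ≤ k, σ j < B) (hv : v < B) (r : ℕ) :
    ∀ j ≤ k, Function.update σ r v j < B := fun j hj => by
  rw [Function.update_apply]
  split_ifs
  exacts [hv, hσ j hj]

/-- A carry of weight `2 ^ i` is on its way to the cell `i`. -/
theorem reachesIn_inc_of_carry (hM : EmbedsOp M .inc r ι) (hℓ : ℓ ≠ 0) (hS : ℓ ≤ S) (p : ℕ)
    (u : List Bool) (hi : i ≤ ℓ) (hσ : ∀ j ≤ k, σ j < 2 ^ ℓ) (hlt : σ r + 2 ^ i < 2 ^ S) :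
    ∃ ℓ', ℓ ≤ ℓ' ∧ ℓ' ≤ S ∧ σ r + 2 ^ i < 2 ^ ℓ' ∧
      ReachesIn M tape S ⟨ι (.inl .scan), p, regTape k ℓ σ, i, u⟩
        ⟨ι (.inr true), p, regTape k ℓ' (Function.update σ r (σ r + 2 ^ i)), 0, u⟩ := by
  have hr := hσ r (by omega)
  induction hi using Nat.decreasingInduction generalizing σ with
  | self =>
    have hℓS : ℓ < S := (Nat.pow_lt_pow_iff_right one_lt_two).1
      (lt_of_le_of_lt (Nat.le_add_left _ _) hlt)
    exact ⟨ℓ + 1, Nat.le_succ ℓ, hℓS, by rw [pow_succ]; omega,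
      reachesIn_scan_return hM (Nat.succ_ne_zero ℓ) hℓS (Nat.le_succ ℓ) (by rw [regTape_self]; rfl)
        (update_regTape_self hℓ hσ)⟩
  | of_succ i hi ih =>
    cases hb : (σ r).testBit i with
    | true =>
      obtain ⟨g, hupdate, hg, -⟩ := exists_onCell_of_testBit_eq_true hi hb
      have hcarry : σ r - 2 ^ i + 2 ^ (i + 1) = σ r + 2 ^ i := by
        have := Nat.ge_two_pow_of_testBit hb
        rw [pow_succ]
        omega
      have hr' : σ r - 2 ^ i < 2 ^ ℓ := lt_of_le_of_lt (Nat.sub_le _ _) hr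
      have hih := ih (update_lt_of_lt hσ hr' r)
      simp only [Function.update_self, Function.update_idem, hcarry] at hih
      obtain ⟨ℓ', hle, hℓ'S, hlt', hreach⟩ := hih hlt hr'
      exact ⟨ℓ', hle, hℓ'S, hlt', reachesIn_scan_go hM hS hi hg hupdate hreach⟩
    | false =>
      obtain ⟨g, hupdate, hg, -⟩ := exists_onCell_of_testBit_eq_false hi hb
      exact ⟨ℓ, le_rfl, hS, add_two_pow_lt_of_testBit_eq_false hr hi hb,
        reachesIn_scan_return hM hℓ hS hi.le hg hupdate⟩

/-- A borrow of weight `2 ^ i` is on its way to the cell `i`. -/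
theorem reachesIn_dec_of_borrow (hM : EmbedsOp M .dec r ι) (hS : ℓ ≤ S) (p : ℕ)
    (u : List Bool) (hi : i ≤ ℓ) (hσ : ∀ j ≤ k, σ j < 2 ^ ℓ) (hle : 2 ^ i ≤ σ r) :
    ReachesIn M tape S ⟨ι (.inl .scan), p, regTape k ℓ σ, i, u⟩
      ⟨ι (.inr true), p, regTape k ℓ (Function.update σ r (σ r - 2 ^ i)), 0, u⟩ := by
  have hr := hσ r (by omega)
  induction hi using Nat.decreasingInduction generalizing σ with
  | self => exact absurd hle hr.not_ge
  | of_succ i hi ih =>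
    cases hb : (σ r).testBit i with
    | true =>
      obtain ⟨g, hupdate, -, hg⟩ := exists_onCell_of_testBit_eq_true hi hb
      exact reachesIn_scan_return hM (by omega) hS hi.le hg hupdate
    | false =>
      obtain ⟨g, hupdate, -, hg⟩ := exists_onCell_of_testBit_eq_false hi hb
      have hr' := add_two_pow_lt_of_testBit_eq_false hr hi hb
      have hborrow : σ r + 2 ^ i - 2 ^ (i + 1) = σ r - 2 ^ i := by rw [pow_succ]; omega
      have hih := ih (update_lt_of_lt hσ hr' r)
      simp only [Function.update_self, Function.update_idem, hborrow] at hih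
      exact reachesIn_scan_go hM hS hi hg hupdate (hih (by rw [pow_succ]; omega) hr')

theorem reachesIn_test_of_forall_testBit (hM : EmbedsOp M .test r ι) (hℓ : ℓ ≠ 0) (hS : ℓ ≤ S)
    (p : ℕ) (u : List Bool) (hr : σ r < 2 ^ ℓ) (hi : i ≤ ℓ)
    (hlow : ∀ j < i, (σ r).testBit j = false) :
    ReachesIn M tape S ⟨ι (.inl .scan), p, regTape k ℓ σ, i, u⟩
      ⟨ι (.inr (decide (σ r ≠ 0))), p, regTape k ℓ σ, 0, u⟩ := by
  induction hi using Nat.decreasingInduction with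
  | self =>
    have hzero : σ r = 0 := Nat.eq_of_testBit_eq fun j => by
      rw [Nat.zero_testBit]
      rcases lt_or_ge j ℓ with hj | hj
      · exact hlow j hj
      · exact Nat.testBit_lt_two_pow (hr.trans_le (Nat.pow_le_pow_right two_pos hj))
    rw [decide_eq_false (not_not.2 hzero)]
    exact reachesIn_scan_return hM hℓ hS le_rfl (by rw [regTape_self]; rfl)
      (by rw [← regTape_self k ℓ σ, Function.update_eq_self])
  | of_succ i hi ih =>
    cases hb : (σ r).testBit i with
    | true =>
      have hne : σ r ≠ 0 := fun h => by simp [h] at hb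
      rw [decide_eq_true hne]
      exact reachesIn_scan_return hM hℓ hS hi.le
        (by simp [regTape_of_lt σ hi, RegOp.onCell, hb]) (Function.update_eq_self _ _)
    | false =>
      refine reachesIn_scan_go hM hS hi (by simp [regTape_of_lt σ hi, RegOp.onCell, hb])
        (Function.update_eq_self _ _) (ih fun j hj => ?_)
      rcases Nat.lt_succ_iff_lt_or_eq.1 hj with hj | rfl
      exacts [hlow j hj, hb]

end

/-! ### Compilation of register programs -/

/-- Change of the target state of an action. -/
def Action.map {Q Q' Γ : Type} (f : Q → Q') (t : Action Q Γ) : Action Q' Γ :=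
  { state := f t.state, write := t.write, workMove := t.workMove, inputMove := t.inputMove,
    print := t.print }

@[simp] theorem Action.map_map {Q Q' Q'' Γ : Type} (f : Q → Q') (g : Q' → Q'')
    (t : Action Q Γ) : (t.map f).map g = t.map (g ∘ f) := rfl

/-- The states of the compiled program. -/
def Prog.St {α : Type} : Prog α → Type
  | .skip => Unit
  | .inc _ => ScanState
  | .dec _ => ScanState
  | .seq p q => p.St ⊕ q.St
  | .loop _ p => ScanState ⊕ p.St
  | .ifz _ p q => ScanState ⊕ (p.St ⊕ q.St)
  | .switch f => Option (Σ a, (f a).St)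
  | .advance => Unit
  | .print _ => Unit

theorem Prog.finite_st {α : Type} [Finite α] (p : Prog α) : Finite p.St := by
  induction p with
  | skip | advance | print => exact inferInstanceAs (Finite Unit)
  | inc | dec => exact inferInstanceAs (Finite ScanState)
  | seq p q ihp ihq => exact inferInstanceAs (Finite (p.St ⊕ q.St))
  | loop r p ih => exact inferInstanceAs (Finite (ScanState ⊕ p.St))
  | ifz r p q ihp ihq => exact inferInstanceAs (Finite (ScanState ⊕ (p.St ⊕ q.St)))
  | switch f ih => exact inferInstanceAs (Finite (Option (Σ a, (f a).St)))

/-- The first state of the compiled program. -/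
def Prog.entry {α : Type} : (p : Prog α) → p.St
  | .skip => ()
  | .inc _ => .scan
  | .dec _ => .scan
  | .seq p _ => .inl p.entry
  | .loop _ _ => .inl .scan
  | .ifz _ _ _ => .inl .scan
  | .switch _ => none
  | .advance => ()
  | .print _ => ()

/-- The action of an elementary operation, with continuation `f`. -/
def opAction {k : ℕ} {Q : Type} (o : RegOp) (r : ℕ) (f : ScanState ⊕ Bool → Q) (s : ScanState)
    (g : Cell k) : Action Q (Cell k) where
  state := f (scanStep o (Fin.ofNat (k + 1) r) s g).2.2
  write := (scanStep o (Fin.ofNat (k + 1) r) s g).1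
  workMove := (scanStep o (Fin.ofNat (k + 1) r) s g).2.1
  inputMove := .stay
  print := none

/-- The transitions of the compiled program; the state `none` is its exit. -/
def Prog.trans {α : Type} (k : ℕ) :
    (p : Prog α) → p.St → InputSymbol α → Cell k → Action (Option p.St) (Cell k)
  | .skip, _, _, g => ⟨none, g, .stay, .stay, none⟩
  | .inc r, s, _, g => opAction .inc r (Sum.elim some fun _ => none) s g
  | .dec r, s, _, g => opAction .dec r (Sum.elim some fun _ => none) s g
  | .seq p q, .inl s, a, g => (p.trans k s a g).map fun o => some (o.elim (.inr q.entry) .inl)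
  | .seq _ q, .inr s, a, g => (q.trans k s a g).map fun o => o.map .inr
  | .loop r p, .inl s, _, g =>
    opAction .test r (Sum.elim (fun s => some (.inl s))
      fun e => if e then some (.inr p.entry) else none) s g
  | .loop _ p, .inr s, a, g => (p.trans k s a g).map fun o => some (o.elim (.inl .scan) .inr)
  | .ifz r p q, .inl s, _, g =>
    opAction .test r (Sum.elim (fun s => some (.inl s))
      fun e => if e then some (.inr (.inr q.entry)) else some (.inr (.inl p.entry))) s g
  | .ifz _ p _, .inr (.inl s), a, g => (p.trans k s a g).map fun o => o.map (.inr ∘ .inl)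
  | .ifz _ _ q, .inr (.inr s), a, g => (q.trans k s a g).map fun o => o.map (.inr ∘ .inr)
  | .switch f, none, a, g => ⟨some (some ⟨a, (f a).entry⟩), g, .stay, .stay, none⟩
  | .switch f, some ⟨b, s⟩, a, g =>
    ((f b).trans k s a g).map fun o => o.map fun s => some ⟨b, s⟩
  | .advance, _, _, g => ⟨none, g, .stay, .right, none⟩
  | .print b, _, _, g => ⟨none, g, .stay, .stay, some b⟩

theorem Prog.trans_inputMove_ne_left {α : Type} {k : ℕ} (p : Prog α) (s : p.St) (a : InputSymbol α)
    (g : Cell k) : (p.trans k s a g).inputMove ≠ .left := by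
  induction p with
  | skip | advance | print => simp [Prog.trans]
  | inc | dec => simp [Prog.trans, opAction]
  | seq p q ihp ihq =>
    rcases s with s | s
    · exact ihp s
    · exact ihq s
  | loop r p ih =>
    rcases s with _ | s
    · simp [Prog.trans, opAction]
    · exact ih s
  | ifz r p q ihp ihq =>
    rcases s with _ | s | s
    · simp [Prog.trans, opAction]
    · exact ihp s
    · exact ihq s
  | switch f ih =>
    rcases s with _ | ⟨b, s⟩
    · simp [Prog.trans]
    · exact ih b s

/-- The compiled program `p` is a part of the machine `M`, with exit `e`. -/
def Embeds {α : Type} {k : ℕ} (M : Machine α (Cell k)) (p : Prog α) (ι : p.St → M.Q) (e : M.Q) :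
    Prop :=
  ∀ s a g, M.δ (ι s) a g = some ((p.trans k s a g).map fun o => o.elim e ι)

/-- The configuration between two operations: the work head is at the origin, and `ℓ` cells are in
use. -/
def progConfig {k : ℕ} {Q : Type} (q : Q) (ℓ : ℕ) (w : ProgState) : Config Q (Cell k) :=
  ⟨q, w.ipos, regTape k ℓ w.regs, 0, w.out⟩

/-- The machine `M` gets from the state `q` to the state `q'` and thereby takes the program state
`w` to `w'`, whenever `w` is written on at most `S` cells; the number of cells in use may grow. -/
def Simulates {α : Type} {k : ℕ} (M : Machine α (Cell k)) (tape : List (InputSymbol α)) (S : ℕ)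
    (q : M.Q) (w : ProgState) (q' : M.Q) (w' : ProgState) : Prop :=
  ∀ ℓ, ℓ ≠ 0 → ℓ ≤ S → (∀ j ≤ k, w.regs j < 2 ^ ℓ) →
    ∃ ℓ', ℓ' ≠ 0 ∧ ℓ' ≤ S ∧ (∀ j ≤ k, w'.regs j < 2 ^ ℓ') ∧
      ReachesIn M tape S (progConfig q ℓ w) (progConfig q' ℓ' w')

section

variable {α : Type} {k : ℕ} {M : Machine α (Cell k)} {tape : List (InputSymbol α)} {S B r : ℕ}

theorem Simulates.trans {q₁ q₂ q₃ : M.Q} {w₁ w₂ w₃ : ProgState}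
    (h₁₂ : Simulates M tape S q₁ w₁ q₂ w₂) (h₂₃ : Simulates M tape S q₂ w₂ q₃ w₃) :
    Simulates M tape S q₁ w₁ q₃ w₃ := by
  intro ℓ hℓ hS hw
  obtain ⟨ℓ₂, hℓ₂, hS₂, hw₂, hreach₂⟩ := h₁₂ ℓ hℓ hS hw
  obtain ⟨ℓ₃, hℓ₃, hS₃, hw₃, hreach₃⟩ := h₂₃ ℓ₂ hℓ₂ hS₂ hw₂
  exact ⟨ℓ₃, hℓ₃, hS₃, hw₃, Relation.ReflTransGen.trans hreach₂ hreach₃⟩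

theorem simulates_of_step {q q' : M.Q} {w w' : ProgState} (hregs : w'.regs = w.regs)
    (h : ∀ ℓ, M.step tape (progConfig q ℓ w) = some (progConfig q' ℓ w')) :
    Simulates M tape S q w q' w' :=
  fun ℓ hℓ hS hw => ⟨ℓ, hℓ, hS, by rwa [hregs],
    reachesIn_head (h ℓ) le_rfl (Int.natCast_nonneg S) Relation.ReflTransGen.refl⟩

theorem val_ofNat_of_le (hr : r ≤ k) : (Fin.ofNat (k + 1) r : ℕ) = r :=
  Nat.mod_eq_of_lt (Nat.lt_succ_of_le hr)

theorem simulates_inc {ι : ScanState ⊕ Bool → M.Q}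
    (hM : EmbedsOp M .inc (Fin.ofNat (k + 1) r) ι) (hr : r ≤ k) (w : ProgState)
    (hlt : w.regs r + 1 < 2 ^ S) :
    Simulates M tape S (ι (.inl .scan)) w (ι (.inr true))
      { w with regs := Function.update w.regs r (w.regs r + 1) } := by
  intro ℓ hℓ hS hw
  obtain ⟨ℓ', hle, hS', hlt', hreach⟩ := reachesIn_inc_of_carry (tape := tape) hM hℓ hS w.ipos w.out
    (Nat.zero_le ℓ) hw (by rwa [val_ofNat_of_le hr])
  rw [val_ofNat_of_le hr] at hlt' hreach
  refine ⟨ℓ', by omega, hS', update_lt_of_lt (fun j hj => ?_) hlt' r, hreach⟩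
  exact (hw j hj).trans_le (Nat.pow_le_pow_right two_pos hle)

theorem simulates_dec {ι : ScanState ⊕ Bool → M.Q}
    (hM : EmbedsOp M .dec (Fin.ofNat (k + 1) r) ι) (hr : r ≤ k) (w : ProgState)
    (hne : w.regs r ≠ 0) :
    Simulates M tape S (ι (.inl .scan)) w (ι (.inr true))
      { w with regs := Function.update w.regs r (w.regs r - 1) } := by
  intro ℓ hℓ hS hw
  have hreach := reachesIn_dec_of_borrow (tape := tape) hM hS w.ipos w.out (Nat.zero_le ℓ) hw
    (by rw [val_ofNat_of_le hr]; exact Nat.one_le_iff_ne_zero.2 hne)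
  rw [val_ofNat_of_le hr] at hreach
  exact ⟨ℓ, hℓ, hS, update_lt_of_lt hw (lt_of_le_of_lt (Nat.sub_le _ _) (hw r hr)) r, hreach⟩

theorem simulates_test {ι : ScanState ⊕ Bool → M.Q}
    (hM : EmbedsOp M .test (Fin.ofNat (k + 1) r) ι) (hr : r ≤ k) (w : ProgState) :
    Simulates M tape S (ι (.inl .scan)) w (ι (.inr (decide (w.regs r ≠ 0)))) w := by
  intro ℓ hℓ hS hw
  have hreach := reachesIn_test_of_forall_testBit (tape := tape) hM hℓ hS w.ipos w.out
    (hw _ (by rw [val_ofNat_of_le hr]; exact hr)) (Nat.zero_le ℓ)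
    (fun j hj => absurd hj (Nat.not_lt_zero j))
  rw [val_ofNat_of_le hr] at hreach
  exact ⟨ℓ, hℓ, hS, hw, hreach⟩

theorem embedsOp_of_opAction {Q : Type} {o : RegOp} {ι : ScanState → M.Q} {f : Q → M.Q}
    {next : ScanState ⊕ Bool → Q}
    (hM : ∀ s a g, M.δ (ι s) a g = some ((opAction o r next s g).map f))
    (hι : ∀ s, f (next (.inl s)) = ι s) :
    EmbedsOp M o (Fin.ofNat (k + 1) r) (Sum.elim ι fun e => f (next (.inr e))) := by
  intro s a g
  rw [Sum.elim_inl, hM s a g]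
  simp only [opAction, Action.map]
  rcases (scanStep o (Fin.ofNat (k + 1) r) s g).2.2 with s' | e
  · rw [hι, Sum.elim_inl]
  · rw [Sum.elim_inr]

theorem Embeds.of_trans {p q : Prog α} {ι : p.St → M.Q} {ι' : q.St → M.Q} {e e' : M.Q}
    (hM : Embeds M p ι e) {f : q.St → p.St} {next : Option q.St → Option p.St}
    (htrans : ∀ s a g, p.trans k (f s) a g = (q.trans k s a g).map next)
    (hι : ∀ s, ι (f s) = ι' s) (hnext : ∀ o, (next o).elim e ι = o.elim e' ι') :
    Embeds M q ι' e' := by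
  intro s a g
  rw [← hι, hM, htrans, Action.map_map]
  exact congrArg (fun h => some ((q.trans k s a g).map h)) (funext hnext)

theorem Embeds.seq {p q : Prog α} {ι : (Prog.seq p q).St → M.Q} {e : M.Q}
    (hM : Embeds M (.seq p q) ι e) :
    Embeds M p (fun s => ι (.inl s)) (ι (.inr q.entry)) ∧ Embeds M q (fun s => ι (.inr s)) e :=
  ⟨hM.of_trans (fun _ _ _ => rfl) (fun _ => rfl) fun o => by cases o <;> rfl,
    hM.of_trans (fun _ _ _ => rfl) (fun _ => rfl) fun o => by cases o <;> rfl⟩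

theorem Embeds.loop {p : Prog α} {ι : (Prog.loop r p).St → M.Q} {e : M.Q}
    (hM : Embeds M (.loop r p) ι e) :
    Embeds M p (fun s => ι (.inr s)) (ι (Prog.loop r p).entry) :=
  hM.of_trans (fun _ _ _ => rfl) (fun _ => rfl) fun o => by cases o <;> rfl

theorem Embeds.ifz {p q : Prog α} {ι : (Prog.ifz r p q).St → M.Q} {e : M.Q}
    (hM : Embeds M (.ifz r p q) ι e) :
    Embeds M p (fun s => ι (.inr (.inl s))) e ∧ Embeds M q (fun s => ι (.inr (.inr s))) e :=
  ⟨hM.of_trans (fun _ _ _ => rfl) (fun _ => rfl) fun o => by cases o <;> rfl,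
    hM.of_trans (fun _ _ _ => rfl) (fun _ => rfl) fun o => by cases o <;> rfl⟩

theorem Embeds.switch {f : InputSymbol α → Prog α} {ι : (Prog.switch f).St → M.Q} {e : M.Q}
    (hM : Embeds M (.switch f) ι e) (a : InputSymbol α) :
    Embeds M (f a) (fun s => ι (some ⟨a, s⟩)) e :=
  hM.of_trans (fun _ _ _ => rfl) (fun _ => rfl) fun o => by cases o <;> rfl

theorem Embeds.simulates_loop_test {p : Prog α} {ι : (Prog.loop r p).St → M.Q} {e : M.Q}
    (hM : Embeds M (.loop r p) ι e) (hr : r ≤ k) (w : ProgState) :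
    Simulates M tape S (ι (Prog.loop r p).entry) w
      (if w.regs r = 0 then e else ι (.inr p.entry)) w := by
  have htest := simulates_test (tape := tape) (S := S)
    (embedsOp_of_opAction (fun s => hM (.inl s)) fun _ => rfl) hr w
  by_cases h : w.regs r = 0
  · rw [if_pos h]
    rwa [decide_eq_false (not_not.2 h)] at htest
  · rw [if_neg h]
    rwa [decide_eq_true h] at htest

theorem Embeds.simulates_ifz_test {p q : Prog α} {ι : (Prog.ifz r p q).St → M.Q} {e : M.Q}
    (hM : Embeds M (.ifz r p q) ι e) (hr : r ≤ k) (w : ProgState) :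
    Simulates M tape S (ι (Prog.ifz r p q).entry) w
      (ι (.inr (if w.regs r = 0 then .inl p.entry else .inr q.entry))) w := by
  have htest := simulates_test (tape := tape) (S := S)
    (embedsOp_of_opAction (fun s => hM (.inl s)) fun _ => rfl) hr w
  by_cases h : w.regs r = 0
  · rw [if_pos h]
    rwa [decide_eq_false (not_not.2 h)] at htest
  · rw [if_neg h]
    rwa [decide_eq_true h] at htest

theorem Embeds.simulates_switch {f : InputSymbol α → Prog α} {ι : (Prog.switch f).St → M.Q}
    {e : M.Q} (hM : Embeds M (.switch f) ι e) (w : ProgState) :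
    Simulates M tape S (ι (Prog.switch f).entry) w
      (ι (some ⟨tape.getD w.ipos .rightEnd, (f (tape.getD w.ipos .rightEnd)).entry⟩)) w :=
  simulates_of_step rfl fun ℓ => by
    have hδ := hM none (tape.getD w.ipos .rightEnd) (regTape k ℓ w.regs 0)
    simp only [Machine.step, progConfig, Prog.entry, hδ, Prog.trans, Action.map,
      Option.map_some, Move.onInput, Move.onWork, Option.elim, Option.toList,
      Function.update_eq_self, List.append_nil]

theorem Run.simulates (hBS : B < 2 ^ S) {p : Prog α} {w w' : ProgState} (h : Run tape B p w w')
    (hk : p.UsesUpTo k) {ι : p.St → M.Q} {e : M.Q} (hM : Embeds M p ι e) :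
    Simulates M tape S (ι p.entry) w e w' := by
  induction h generalizing e with
  | skip w | advance w | print b w =>
    refine simulates_of_step rfl fun ℓ => ?_
    simp [Machine.step, progConfig, hM _ _ _, Prog.trans, Action.map, Move.onInput, Move.onWork]
  | inc r w h =>
    exact simulates_inc (embedsOp_of_opAction hM fun _ => rfl) hk w (h.trans_lt hBS)
  | dec r w h => exact simulates_dec (embedsOp_of_opAction hM fun _ => rfl) hk w h
  | seq _ _ ihp ihq => exact (ihp hk.1 hM.seq.1).trans (ihq hk.2 hM.seq.2)
  | @loop_done r p w h =>
    simpa only [if_pos h] using hM.simulates_loop_test (tape := tape) (S := S) hk.1 w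
  | @loop_step r p w₁ w₂ w₃ h _ _ ihbody ihloop =>
    have htest := hM.simulates_loop_test (tape := tape) (S := S) hk.1 w₁
    rw [if_neg h] at htest
    exact htest.trans ((ihbody hk.2 hM.loop).trans (ihloop hk hM))
  | @ifz_zero r p q w w' h _ ih =>
    have htest := hM.simulates_ifz_test (tape := tape) (S := S) hk.1 w
    rw [if_pos h] at htest
    exact htest.trans (ih hk.2.1 hM.ifz.1)
  | @ifz_pos r p q w w' h _ ih =>
    have htest := hM.simulates_ifz_test (tape := tape) (S := S) hk.1 w
    rw [if_neg h] at htest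
    exact htest.trans (ih hk.2.2 hM.ifz.2)
  | @switch f w w' _ ih => exact (hM.simulates_switch w).trans (ih (hk _) (hM.switch _))

end

/-- The online machine that executes a program; its first step marks the origin of the work
tape. -/
def Prog.toMachine {α : Type} [Finite α] (p : Prog α) (k : ℕ) : Machine α (Cell k) where
  Q := Option (Option p.St)
  finite_Q := by have := p.finite_st; infer_instance
  start := none
  δ
    | none, _, _ => some ⟨some (some p.entry), some (true, fun _ => false), .stay, .stay, none⟩
    | some none, _, _ => none
    | some (some s), a, g => some ((p.trans k s a g).map some)

theorem Prog.isOnline_toMachine {α : Type} [Finite α] (p : Prog α) (k : ℕ) :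
    (p.toMachine k).IsOnline := by
  intro q a g t ht
  match q, ht with
  | none, ht =>
    obtain rfl := Option.some_inj.1 ht
    simp
  | some (some s), ht =>
    obtain rfl := Option.some_inj.1 ht
    exact p.trans_inputMove_ne_left s a g

theorem ReachesIn.workPos_mem {α Γ : Type} {M : Machine α Γ} {tape : List (InputSymbol α)}
    {S : ℕ} {a b c : Config M.Q Γ} (h : ReachesIn M tape S a b) (hb : M.step tape b = none)
    (h0 : 0 ≤ b.workPos) (hS : b.workPos ≤ S)
    (hc : StateTransition.Reaches (M.step tape) a c) : 0 ≤ c.workPos ∧ c.workPos ≤ S := by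
  induction h using Relation.ReflTransGen.head_induction_on with
  | refl =>
    rcases Relation.ReflTransGen.cases_head hc with rfl | ⟨d, hd, -⟩
    · exact ⟨h0, hS⟩
    · rw [hb] at hd; cases hd
  | head hstep _ ih =>
    rcases Relation.ReflTransGen.cases_head hc with rfl | ⟨d, hd, hdc⟩
    · exact hstep.2
    · rw [hstep.1] at hd
      obtain rfl : _ = d := Option.some_inj.1 hd
      exact ih hdc

theorem ReachesIn.reaches {α Γ : Type} {M : Machine α Γ} {tape : List (InputSymbol α)}
    {S : ℕ} {a b : Config M.Q Γ} (h : ReachesIn M tape S a b) :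
    StateTransition.Reaches (M.step tape) a b :=
  Relation.ReflTransGen.mono (fun _ _ h => h.1) _ _ h

theorem Prog.step_init_toMachine {α : Type} [Finite α] (p : Prog α) (k : ℕ)
    (tape : List (InputSymbol α)) :
    (p.toMachine k).step tape (p.toMachine k).init =
      some (progConfig (some (some p.entry)) 1 ⟨fun _ => 0, 0, []⟩) := by
  simp only [Machine.step, Machine.init, Prog.toMachine, Option.map_some, progConfig,
    Move.onInput, Move.onWork, Option.toList, List.append_nil]
  congr 2
  funext z
  by_cases hz : z = 0
  · subst hz
    simp [regTape]
  · rw [Function.update_of_ne hz, regTape, if_neg (by push_cast; omega)]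
    rfl

theorem Run.outputs {α : Type} [Finite α] {p : Prog α} {k : ℕ} (hk : p.UsesUpTo k)
    {tape : List (InputSymbol α)} {B S : ℕ} (hBS : B < 2 ^ S) (hS : S ≠ 0) {w : ProgState}
    (h : Run tape B p ⟨fun _ => 0, 0, []⟩ w) :
    (p.toMachine k).Outputs tape w.out ∧
      ((p.toMachine k).usedCells tape).encard ≤ (S + 1 : ℕ) := by
  have hembeds : Embeds (p.toMachine k) p (fun s => some (some s)) (some none) := by
    intro s a g
    change some ((p.trans k s a g).map some) = _
    congr 2
    funext o
    cases o <;> rfl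
  obtain ⟨ℓ, -, -, -, hreach⟩ := h.simulates hBS hk hembeds 1 one_ne_zero
    (Nat.one_le_iff_ne_zero.2 hS) fun _ _ => by simp
  have hinit := reachesIn_head (p.step_init_toMachine k tape) le_rfl (Int.natCast_nonneg S) hreach
  have hhalt : (p.toMachine k).step tape (progConfig (some none) ℓ w) = none := rfl
  refine ⟨⟨_, hinit.reaches, hhalt, rfl⟩, ?_⟩
  have hsub : (p.toMachine k).usedCells tape ⊆ ((Finset.Icc (0 : ℤ) S : Finset ℤ) : Set ℤ) := by
    rintro z ⟨c, hc, rfl⟩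
    simpa using hinit.workPos_mem hhalt le_rfl (Int.natCast_nonneg S) hc
  refine (Set.encard_le_encard hsub).trans ?_
  rw [Set.encard_coe_eq_coe_finsetCard]
  simp

/-! ### A pairing function that counters can compute -/

/-- Triangular numbers. -/
def tri : ℕ → ℕ
  | 0 => 0
  | n + 1 => tri n + (n + 1)

/-- Cantor's pairing function. -/
def cpair (a b : ℕ) : ℕ := tri (a + b) + b

theorem tri_le (n : ℕ) : tri n ≤ n ^ 2 := by
  induction n with
  | zero => simp [tri]
  | succ n ih =>
    simp only [tri]
    nlinarith

theorem le_tri (n : ℕ) : n ≤ tri n := by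
  cases n with
  | zero => simp
  | succ n => simp [tri]

theorem left_le_cpair (a b : ℕ) : a ≤ cpair a b := by
  have := le_tri (a + b)
  unfold cpair
  omega

theorem right_le_cpair (a b : ℕ) : b ≤ cpair a b := by
  unfold cpair
  omega

theorem tri_mono : Monotone tri :=
  monotone_nat_of_le_succ fun n => Nat.le_add_right (tri n) (n + 1)

theorem add_le_add_of_cpair_le {a b c d : ℕ} (h : cpair a b ≤ cpair c d) : a + b ≤ c + d := by
  by_contra! hlt
  have hmono := tri_mono (Nat.succ_le_of_lt hlt)
  simp only [cpair, tri] at h hmono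
  omega

theorem cpair_inj {x y x' y' : ℕ} (h : cpair x' y' = cpair x y) : x' = x ∧ y' = y := by
  have hsum : x' + y' = x + y :=
    le_antisymm (add_le_add_of_cpair_le h.le) (add_le_add_of_cpair_le h.ge)
  simp only [cpair, hsum] at h
  omega

theorem cpair_zero_add_one (y : ℕ) : cpair 0 y + 1 = cpair (y + 1) 0 := by
  simp only [cpair, tri, zero_add, add_zero]
  omega

theorem cpair_succ_add_one (x y : ℕ) : cpair (x + 1) y + 1 = cpair x (y + 1) := by
  rw [cpair, cpair, Nat.succ_add_eq_add_succ, add_assoc]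

theorem cpair_le (a b : ℕ) : cpair a b ≤ (a + b + 1) ^ 2 := by
  have htri := tri_le (a + b)
  have hsq : (a + b + 1) ^ 2 = (a + b) ^ 2 + 2 * (a + b) + 1 := by ring
  unfold cpair
  omega

/-- Types whose elements are represented by numbers. -/
class Enc (α : Type) where
  enc : α → ℕ

open Enc (enc)

instance : Enc ℕ := ⟨id⟩

instance {α β : Type} [Enc α] [Enc β] : Enc (α × β) := ⟨fun x => cpair (enc x.1) (enc x.2)⟩

@[simp] theorem enc_nat (n : ℕ) : enc n = n := rfl

theorem enc_pair {α β : Type} [Enc α] [Enc β] (x : α × β) :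
    enc x = cpair (enc x.1) (enc x.2) := rfl

/-! ### Polynomial bounds -/

theorem pow_le_pow_exp (x : ℕ) {c d : ℕ} (h : c ≤ d) : (x + 2) ^ c ≤ (x + 2) ^ d :=
  Nat.pow_le_pow_right (by omega) h

/-- `u` is bounded by a polynomial in `S`. -/
def PolyLe {ι : Type} (S u : ι → ℕ) : Prop :=
  ∃ c, ∀ i, u i ≤ (S i + 2) ^ (c + 1)

section

variable {ι κ : Type} {S u v : ι → ℕ}

theorem PolyLe.mono (h : PolyLe S u) (hv : ∀ i, v i ≤ u i) : PolyLe S v := by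
  obtain ⟨c, hc⟩ := h
  exact ⟨c, fun i => (hv i).trans (hc i)⟩

theorem PolyLe.self : PolyLe S S := ⟨0, fun i => by simp⟩

theorem PolyLe.const (k : ℕ) : PolyLe S fun _ => k :=
  ⟨k, fun i => (Nat.lt_two_pow_self.le.trans (Nat.pow_le_pow_left (by omega) k)).trans
    (pow_le_pow_exp _ (Nat.le_succ k))⟩

theorem PolyLe.mul (hu : PolyLe S u) (hv : PolyLe S v) : PolyLe S fun i => u i * v i := by
  obtain ⟨c, hc⟩ := hu
  obtain ⟨d, hd⟩ := hv
  exact ⟨c + 1 + d, fun i => (Nat.mul_le_mul (hc i) (hd i)).trans (by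
    rw [← pow_add]; exact pow_le_pow_exp _ (by omega))⟩

theorem PolyLe.add (hu : PolyLe S u) (hv : PolyLe S v) : PolyLe S fun i => u i + v i := by
  obtain ⟨c, hc⟩ := hu
  obtain ⟨d, hd⟩ := hv
  refine ⟨max c d + 1, fun i => ?_⟩
  have hu := (hc i).trans (pow_le_pow_exp (S i) (Nat.succ_le_succ (le_max_left c d)))
  have hv := (hd i).trans (pow_le_pow_exp (S i) (Nat.succ_le_succ (le_max_right c d)))
  rw [pow_succ _ (max c d + 1)]
  simp only [Nat.succ_eq_add_one] at hu hv
  nlinarith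

theorem PolyLe.sum {w : κ → ι → ℕ} (t : Finset κ) (hw : ∀ k, PolyLe S (w k)) :
    PolyLe S fun i => ∑ k ∈ t, w k i := by
  simp only [← Finset.sum_apply]
  exact Finset.sum_induction w (PolyLe S) (fun _ _ => .add) (.const 0) fun k _ => hw k

theorem PolyLe.pow (hu : PolyLe S u) (k : ℕ) : PolyLe S fun i => u i ^ k := by
  induction k with
  | zero => simpa using PolyLe.const 1
  | succ k ih => simpa only [pow_succ] using ih.mul hu

theorem PolyLe.cpair (hu : PolyLe S u) (hv : PolyLe S v) :
    PolyLe S fun i => cpair (u i) (v i) :=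
  (((hu.add hv).add (.const 1)).pow 2).mono fun _ => cpair_le _ _

theorem PolyLe.exists_bound {T w : κ → ℕ} (hw : PolyLe T w) (hu : PolyLe S u) :
    ∃ v : ι → ℕ, PolyLe S v ∧ ∀ i k, T k ≤ u i → w k ≤ v i := by
  obtain ⟨c, hc⟩ := hw
  exact ⟨_, (hu.add (.const 2)).pow (c + 1), fun i k hk =>
    (hc k).trans (Nat.pow_le_pow_left (Nat.add_le_add_right hk 2) _)⟩

theorem PolyLe.comp {T w : κ → ℕ} (hw : PolyLe T w) {f : ι → κ}
    (hf : PolyLe S fun i => T (f i)) : PolyLe S fun i => w (f i) := by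
  obtain ⟨v, hv, hle⟩ := hw.exists_bound hf
  exact hv.mono fun i => hle i (f i) le_rfl

end

/-! ### Frames of registers -/

/-- The registers below `b` are those of `σ`, the others hold the entries of `l`. -/
def frame (σ : ℕ → ℕ) (b : ℕ) (l : List ℕ) : ℕ → ℕ := fun j =>
  if j < b then σ j else l.getD (j - b) 0

theorem frame_add (σ : ℕ → ℕ) (b i : ℕ) (l : List ℕ) : frame σ b l (b + i) = l.getD i 0 := by
  simp [frame]

theorem frame_self (σ : ℕ → ℕ) (b : ℕ) (l : List ℕ) : frame σ b l b = l.getD 0 0 :=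
  frame_add σ b 0 l

theorem update_frame (σ : ℕ → ℕ) (b i v : ℕ) {l : List ℕ} (hi : i < l.length) :
    Function.update (frame σ b l) (b + i) v = frame σ b (l.set i v) := by
  funext j
  by_cases hj : j = b + i
  · subst hj
    simp [frame, hi]
  · rw [Function.update_of_ne hj]
    unfold frame
    split_ifs with h
    · rfl
    · rw [List.getD_eq_getElem?_getD, List.getD_eq_getElem?_getD, List.getElem?_set_ne]
      omega

theorem frame_frame (σ : ℕ → ℕ) (b : ℕ) (l l' : List ℕ) {b' : ℕ} (hb : b' = b + l.length) :
    frame (frame σ b l) b' l' = frame σ b (l ++ l') := by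
  subst hb
  funext j
  unfold frame
  by_cases h : j < b
  · simp [h, show j < b + l.length by omega]
  · by_cases h' : j < b + l.length
    · rw [if_pos h', if_neg h, if_neg h, List.getD_append]
      omega
    · rw [if_neg h', if_neg h, List.getD_append_right _ _ _ _ (by omega)]
      congr 1
      omega

theorem frame_append_zero (σ : ℕ → ℕ) (b : ℕ) (l : List ℕ) (n : ℕ) :
    frame σ b (l ++ List.replicate n 0) = frame σ b l := by
  funext j
  unfold frame
  split_ifs
  · rfl
  · by_cases h : j - b < l.length
    · rw [List.getD_append _ _ _ _ h]
    · rw [List.getD_append_right _ _ _ _ (by omega),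
        List.getD_eq_default (l := l) _ (by omega)]
      simp

/-! ### Programs that only use the registers -/

/-- Runs of a program that depend on the registers only. -/
def RegRun {α : Type} (tape : List (InputSymbol α)) (B : ℕ) (p : Prog α) (σ σ' : ℕ → ℕ) : Prop :=
  ∀ i o, Run tape B p ⟨σ, i, o⟩ ⟨σ', i, o⟩

section

variable {α : Type} {tape : List (InputSymbol α)} {B : ℕ} {p q : Prog α} {σ σ₁ σ₂ : ℕ → ℕ}

theorem RegRun.seq (h : RegRun tape B p σ σ₁) (h' : RegRun tape B q σ₁ σ₂) :
    RegRun tape B (.seq p q) σ σ₂ :=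
  fun i o => .seq (h i o) (h' i o)

theorem RegRun.loop_step {r : ℕ} (hr : σ r ≠ 0) (h : RegRun tape B p σ σ₁)
    (h' : RegRun tape B (.loop r p) σ₁ σ₂) : RegRun tape B (.loop r p) σ σ₂ :=
  fun i o => .loop_step hr (h i o) (h' i o)

theorem RegRun.loop_done {r : ℕ} (hr : σ r = 0) : RegRun tape B (.loop r p) σ σ :=
  fun _ _ => .loop_done hr

theorem RegRun.ifz_zero {r : ℕ} (hr : σ r = 0) (h : RegRun tape B p σ σ₁) :
    RegRun tape B (.ifz r p q) σ σ₁ :=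
  fun i o => .ifz_zero hr (h i o)

theorem RegRun.ifz_pos {r : ℕ} (hr : σ r ≠ 0) (h : RegRun tape B q σ σ₁) :
    RegRun tape B (.ifz r p q) σ σ₁ :=
  fun i o => .ifz_pos hr (h i o)

theorem RegRun.inc {r : ℕ} (h : σ r + 1 ≤ B) :
    RegRun tape B (.inc r) σ (Function.update σ r (σ r + 1)) :=
  fun i o => Run.inc r ⟨σ, i, o⟩ h

theorem RegRun.dec {r : ℕ} (h : σ r ≠ 0) :
    RegRun tape B (.dec r) σ (Function.update σ r (σ r - 1)) :=
  fun i o => Run.dec r ⟨σ, i, o⟩ h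

end

/-- Adds register `i` to register `j` and clears it. -/
def Prog.move {α : Type} (i j : ℕ) : Prog α := .loop i (.seq (.dec i) (.inc j))

/-- Adds register `i` to the registers `j` and `k` and clears it. -/
def Prog.moveBoth {α : Type} (i j k : ℕ) : Prog α :=
  .loop i (.seq (.dec i) (.seq (.inc j) (.inc k)))

/-- Clears a register. -/
def Prog.clear {α : Type} (i : ℕ) : Prog α := .loop i (.dec i)

/-- Replaces `0, x, y` by `cpair x y, 0, 0`. -/
def Prog.pair {α : Type} (b : ℕ) : Prog α :=
  .seq (.moveBoth (b + 2) (b + 1) b) (.loop (b + 1) (.seq (.moveBoth (b + 1) (b + 2) b)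
    (.seq (.dec (b + 2)) (.move (b + 2) (b + 1)))))

/-- Replaces the pair `x, y` in the registers `b + 1, b + 2` by its successor in Cantor's
enumeration of pairs, and decrements register `b`. -/
def Prog.unpairStep {α : Type} (b : ℕ) : Prog α :=
  .seq (.dec b) (.ifz (b + 1)
    (.seq (.inc (b + 1)) (.move (b + 2) (b + 1)))
    (.seq (.dec (b + 1)) (.inc (b + 2))))

/-- Replaces `cpair x y, 0, 0` by `0, x, y`. -/
def Prog.unpair {α : Type} (b : ℕ) : Prog α := .loop b (.unpairStep b)

section

variable {α : Type} {tape : List (InputSymbol α)} {B : ℕ}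

theorem RegRun.clear (i : ℕ) (σ : ℕ → ℕ) :
    RegRun tape B (.clear i) σ (Function.update σ i 0) := by
  induction hn : σ i generalizing σ with
  | zero =>
    rw [← hn, Function.update_eq_self]
    exact .loop_done hn
  | succ n ih =>
    refine .loop_step (by omega) (.dec (by omega)) ?_
    have hrest := ih (Function.update σ i (σ i - 1)) (by simp [hn])
    rwa [Function.update_idem] at hrest

theorem RegRun.move {i j : ℕ} (hij : i ≠ j) (σ : ℕ → ℕ) (hB : σ j + σ i ≤ B) :
    RegRun tape B (.move i j) σ (Function.update (Function.update σ i 0) j (σ j + σ i)) := by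
  induction hn : σ i generalizing σ with
  | zero =>
    rw [← hn, Function.update_eq_self, hn, add_zero, Function.update_eq_self]
    exact .loop_done hn
  | succ n ih =>
    refine .loop_step (by omega) (.seq (.dec (by omega)) (.inc ?_)) ?_
    · rw [Function.update_of_ne hij.symm]
      omega
    have hrest := ih (Function.update (Function.update σ i (σ i - 1)) j (σ j + 1))
      (by simp only [Function.update_self, Function.update_of_ne hij]; omega) (by simp [hij, hn])
    rw [Function.update_of_ne hij.symm]
    convert hrest using 1
    · rfl
    · funext r
      simp only [Function.update_apply]
      split_ifs <;> omega

theorem RegRun.moveBoth {i j k : ℕ} (hij : i ≠ j) (hik : i ≠ k) (hjk : j ≠ k) (σ : ℕ → ℕ)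
    (hBj : σ j + σ i ≤ B) (hBk : σ k + σ i ≤ B) :
    RegRun tape B (.moveBoth i j k) σ (Function.update (Function.update (Function.update σ i 0)
      j (σ j + σ i)) k (σ k + σ i)) := by
  induction hn : σ i generalizing σ with
  | zero =>
    rw [← hn, Function.update_eq_self, hn, add_zero, add_zero, Function.update_eq_self,
      Function.update_eq_self]
    exact .loop_done hn
  | succ n ih =>
    refine .loop_step (by omega) (.seq (.dec (by omega)) (.seq (.inc ?_) (.inc ?_))) ?_
    · rw [Function.update_of_ne hij.symm]
      omega
    · rw [Function.update_of_ne hjk.symm, Function.update_of_ne hik.symm]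
      omega
    have hrest := ih (Function.update (Function.update (Function.update σ i (σ i - 1)) j (σ j + 1))
      k (σ k + 1))
      (by simp only [Function.update_self, Function.update_of_ne hij, Function.update_of_ne hik,
            Function.update_of_ne hjk]; omega)
      (by simp only [Function.update_self, Function.update_of_ne hij, Function.update_of_ne hik]
          omega)
      (by simp [hij, hik, hn])
    rw [Function.update_of_ne hij.symm, Function.update_of_ne hjk.symm,
      Function.update_of_ne hik.symm]
    convert hrest using 1
    · rfl
    · funext r
      simp only [Function.update_apply]
      split_ifs <;> omega

theorem RegRun.inc_frame (σ : ℕ → ℕ) (b i : ℕ) {l : List ℕ} (hi : i < l.length)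
    (hB : l.getD i 0 + 1 ≤ B) :
    RegRun tape B (.inc (b + i)) (frame σ b l) (frame σ b (l.set i (l.getD i 0 + 1))) := by
  rw [← update_frame σ b i _ hi, ← frame_add σ b]
  exact .inc (by rwa [frame_add])

theorem RegRun.dec_frame (σ : ℕ → ℕ) (b i : ℕ) {l : List ℕ} (hi : i < l.length)
    (hne : l.getD i 0 ≠ 0) :
    RegRun tape B (.dec (b + i)) (frame σ b l) (frame σ b (l.set i (l.getD i 0 - 1))) := by
  rw [← update_frame σ b i _ hi, ← frame_add σ b]
  exact .dec (by rwa [frame_add])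

theorem RegRun.move_frame (σ : ℕ → ℕ) (b : ℕ) {i j : ℕ} {l : List ℕ} (hij : i ≠ j)
    (hi : i < l.length) (hj : j < l.length) (hB : l.getD j 0 + l.getD i 0 ≤ B) :
    RegRun tape B (.move (b + i) (b + j)) (frame σ b l)
      (frame σ b ((l.set i 0).set j (l.getD j 0 + l.getD i 0))) := by
  rw [← update_frame σ b j _ (by simpa), ← update_frame σ b i _ hi, ← frame_add σ b,
    ← frame_add σ b i l]
  exact .move (by omega) _ (by rwa [frame_add, frame_add])

theorem RegRun.moveBoth_frame (σ : ℕ → ℕ) (b : ℕ) {i j k : ℕ} {l : List ℕ} (hij : i ≠ j)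
    (hik : i ≠ k) (hjk : j ≠ k) (hi : i < l.length) (hj : j < l.length) (hk : k < l.length)
    (hBj : l.getD j 0 + l.getD i 0 ≤ B) (hBk : l.getD k 0 + l.getD i 0 ≤ B) :
    RegRun tape B (.moveBoth (b + i) (b + j) (b + k)) (frame σ b l)
      (frame σ b (((l.set i 0).set j (l.getD j 0 + l.getD i 0)).set k
        (l.getD k 0 + l.getD i 0))) := by
  rw [← update_frame σ b k _ (by simpa), ← update_frame σ b j _ (by simpa),
    ← update_frame σ b i _ hi, ← frame_add σ b j, ← frame_add σ b k, ← frame_add σ b i l]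
  exact .moveBoth (by omega) (by omega) (by omega) _ (by rwa [frame_add, frame_add])
    (by rwa [frame_add, frame_add])

theorem RegRun.pair_loop (σ : ℕ → ℕ) (b s y : ℕ) (hB : tri s + y ≤ B) :
    RegRun tape B (.loop (b + 1) (.seq (.moveBoth (b + 1) (b + 2) b)
      (.seq (.dec (b + 2)) (.move (b + 2) (b + 1)))))
      (frame σ b [y, s, 0]) (frame σ b [tri s + y, 0, 0]) := by
  induction s generalizing y with
  | zero => simpa [tri] using RegRun.loop_done (by simp [frame_add])
  | succ s ih =>
    simp only [tri] at hB
    have hboth : RegRun tape B (.moveBoth (b + 1) (b + 2) b) (frame σ b [y, s + 1, 0])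
        (frame σ b [y + (s + 1), 0, s + 1]) := by
      simpa using RegRun.moveBoth_frame (tape := tape) (B := B) σ b (i := 1) (j := 2) (k := 0)
        (l := [y, s + 1, 0]) (by simp) (by simp) (by simp) (by simp) (by simp) (by simp)
        (by simp; omega) (by simp; omega)
    have hdec : RegRun tape B (.dec (b + 2)) (frame σ b [y + (s + 1), 0, s + 1])
        (frame σ b [y + (s + 1), 0, s]) :=
      .dec_frame σ b 2 (by simp) (by simp)
    have hmove : RegRun tape B (.move (b + 2) (b + 1)) (frame σ b [y + (s + 1), 0, s])
        (frame σ b [y + (s + 1), s, 0]) := by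
      simpa using RegRun.move_frame (tape := tape) (B := B) σ b (i := 2) (j := 1)
        (l := [y + (s + 1), 0, s]) (by simp) (by simp) (by simp) (by simp; omega)
    refine .loop_step (by simp [frame_add]) (hboth.seq (hdec.seq hmove)) ?_
    convert ih (y + (s + 1)) (by omega) using 3
    simp only [tri]
    omega

theorem RegRun.pair (σ : ℕ → ℕ) (b x y : ℕ) (hB : cpair x y ≤ B) :
    RegRun tape B (.pair b) (frame σ b [0, x, y]) (frame σ b [cpair x y, 0, 0]) := by
  have hxy := le_tri (x + y)
  have hpair : cpair x y = tri (x + y) + y := rfl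
  have hboth : RegRun tape B (.moveBoth (b + 2) (b + 1) b) (frame σ b [0, x, y])
      (frame σ b [y, x + y, 0]) := by
    simpa using RegRun.moveBoth_frame (tape := tape) (B := B) σ b (i := 2) (j := 1) (k := 0)
      (l := [0, x, y]) (by simp) (by simp) (by simp) (by simp) (by simp) (by simp)
      (by simp; omega) (by simp; omega)
  exact hboth.seq (.pair_loop σ b _ _ hB)

theorem RegRun.unpairStep_zero (σ : ℕ → ℕ) (b m y : ℕ) (hB : y + 1 ≤ B) :
    RegRun tape B (.unpairStep b) (frame σ b [m + 1, 0, y]) (frame σ b [m, y + 1, 0]) := by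
  have hdec : RegRun tape B (.dec b) (frame σ b [m + 1, 0, y]) (frame σ b [m, 0, y]) :=
    .dec_frame σ b 0 (by simp) (by simp)
  have hinc : RegRun tape B (.inc (b + 1)) (frame σ b [m, 0, y]) (frame σ b [m, 1, y]) :=
    .inc_frame σ b 1 (by simp) (by simp; omega)
  have hmove : RegRun tape B (.move (b + 2) (b + 1)) (frame σ b [m, 1, y])
      (frame σ b [m, y + 1, 0]) := by
    simpa [add_comm] using RegRun.move_frame (tape := tape) (B := B) σ b (i := 2) (j := 1)
      (l := [m, 1, y]) (by simp) (by simp) (by simp) (by simp; omega)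
  exact hdec.seq (.ifz_zero (by simp [frame_add]) (hinc.seq hmove))

theorem RegRun.unpairStep_succ (σ : ℕ → ℕ) (b m x y : ℕ) (hB : y + 1 ≤ B) :
    RegRun tape B (.unpairStep b) (frame σ b [m + 1, x + 1, y]) (frame σ b [m, x, y + 1]) := by
  have hdec : RegRun tape B (.dec b) (frame σ b [m + 1, x + 1, y]) (frame σ b [m, x + 1, y]) :=
    .dec_frame σ b 0 (by simp) (by simp)
  have hdec' : RegRun tape B (.dec (b + 1)) (frame σ b [m, x + 1, y]) (frame σ b [m, x, y]) :=
    .dec_frame σ b 1 (by simp) (by simp)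
  have hinc : RegRun tape B (.inc (b + 2)) (frame σ b [m, x, y]) (frame σ b [m, x, y + 1]) :=
    .inc_frame σ b 2 (by simp) (by simpa)
  exact hdec.seq (.ifz_pos (by simp [frame_add]) (hdec'.seq hinc))

theorem RegRun.unpair_of_cpair_eq (σ : ℕ → ℕ) (b m x y x' y' : ℕ)
    (h : cpair x' y' = cpair x y + m) (hB : cpair x' y' + 1 ≤ B) :
    RegRun tape B (.unpair b) (frame σ b [m, x, y]) (frame σ b [0, x', y']) := by
  induction m generalizing x y with
  | zero =>
    obtain ⟨rfl, rfl⟩ := cpair_inj h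
    exact .loop_done (by simp [frame_self])
  | succ m ih =>
    have hy := right_le_cpair x y
    have hloop : frame σ b [m + 1, x, y] b ≠ 0 := by simp [frame_self]
    cases x with
    | zero =>
      have hsucc := cpair_zero_add_one y
      exact .loop_step hloop (.unpairStep_zero σ b m y (by omega)) (ih _ _ (by omega))
    | succ x =>
      have hsucc := cpair_succ_add_one x y
      exact .loop_step hloop (.unpairStep_succ σ b m x y (by omega)) (ih _ _ (by omega))

end

theorem frame_pad₂ (σ : ℕ → ℕ) (b x : ℕ) : frame σ b [x, 0, 0] = frame σ b [x] :=
  frame_append_zero σ b [x] 2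

section

variable {α : Type} {tape : List (InputSymbol α)} {B : ℕ}

theorem RegRun.clear_frame (σ : ℕ → ℕ) (b i : ℕ) {l : List ℕ} (hi : i < l.length) :
    RegRun tape B (.clear (b + i)) (frame σ b l) (frame σ b (l.set i 0)) := by
  rw [← update_frame σ b i _ hi]
  exact .clear _ _

/-- A program at base `b'` may be run above a longer frame. -/
theorem RegRun.append_frame {b b' v v' : ℕ} {p : Prog α} (l : List ℕ) (hb : b' = b + l.length)
    (h : ∀ σ, RegRun tape B p (frame σ b' [v]) (frame σ b' [v'])) (σ : ℕ → ℕ) :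
    RegRun tape B p (frame σ b (l ++ [v])) (frame σ b (l ++ [v'])) := by
  have hrun := h (frame σ b l)
  rwa [frame_frame _ _ _ _ hb, frame_frame _ _ _ _ hb] at hrun

theorem RegRun.unpair (σ : ℕ → ℕ) (b x y : ℕ) (hB : cpair x y + 1 ≤ B) :
    RegRun tape B (.unpair b) (frame σ b [cpair x y]) (frame σ b [0, x, y]) := by
  rw [← frame_pad₂]
  exact RegRun.unpair_of_cpair_eq σ b _ 0 0 x y (by simp [cpair, tri]) hB

theorem RegRun.duplicate (σ : ℕ → ℕ) (b x : ℕ) (hB : x ≤ B) :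
    RegRun tape B (.moveBoth b (b + 1) (b + 2)) (frame σ b [x]) (frame σ b [0, x, x]) := by
  rw [← frame_pad₂]
  simpa using RegRun.moveBoth_frame (tape := tape) (B := B) σ b (i := 0) (j := 1) (k := 2)
    (l := [x, 0, 0]) (by simp) (by simp) (by simp) (by simp) (by simp) (by simp)
    (by simpa) (by simpa)

end

/-! ### Functions computed in linear space -/

/-- `f` is computed by a program whose registers remain polynomially bounded. The program is
given for every base register; it leaves the registers below the base alone and needs the
registers above the base to be zero. -/
def LinSpace {α β : Type} [Enc α] [Enc β] (f : α → β) : Prop :=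
  ∃ (p : (γ : Type) → ℕ → Prog γ) (u : α → ℕ), PolyLe enc u ∧
    ∀ (γ : Type) (tape : List (InputSymbol γ)) (B b : ℕ) (σ : ℕ → ℕ) (a : α), u a ≤ B →
      RegRun tape B (p γ b) (frame σ b [enc a]) (frame σ b [enc (f a)])

section

variable {α β δ : Type} [Enc α] [Enc β] [Enc δ]

theorem LinSpace.polyLe {f : α → β} (hf : LinSpace f) : PolyLe enc fun a => enc (f a) := by
  obtain ⟨p, u, hu, hrun⟩ := hf
  refine (hu.add .self).mono fun a => ?_
  have hle := (hrun Unit [] (u a + enc a) 0 0 a (Nat.le_add_right _ _) 0 []).regs_le (by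
    intro r
    rcases r with _ | r <;> simp [frame]) 0
  simpa [frame] using hle

theorem LinSpace.of_eq {f g : α → β} (hf : LinSpace f) (h : ∀ a, f a = g a) : LinSpace g :=
  (funext h : f = g) ▸ hf

theorem LinSpace.recode {α' β' : Type} [Enc α'] [Enc β'] {f : α → β} (hf : LinSpace f) (i : α' → α)
    (hi : ∀ a, enc (i a) = enc a) (f' : α' → β') (hf' : ∀ a, enc (f' a) = enc (f (i a))) :
    LinSpace f' := by
  obtain ⟨p, u, ⟨c, hu⟩, hrun⟩ := hf
  refine ⟨p, fun a => u (i a), ⟨c, fun a => ?_⟩, fun γ tape B b σ a hB => ?_⟩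
  · rw [← hi]
    exact hu _
  · rw [← hi, hf']
    exact hrun γ tape B b σ (i a) hB

theorem LinSpace.id : LinSpace fun a : α => a :=
  ⟨fun _ _ => .skip, fun _ => 0, .const 0, fun _ _ _ _ _ _ _ _ _ => .skip _⟩

theorem LinSpace.comp {g : β → δ} {f : α → β} (hg : LinSpace g) (hf : LinSpace f) :
    LinSpace fun a => g (f a) := by
  have hpoly := hf.polyLe
  obtain ⟨p, u, hu, hrun⟩ := hf
  obtain ⟨q, v, hv, hrun'⟩ := hg
  refine ⟨fun γ b => .seq (p γ b) (q γ b), fun a => u a + v (f a), hu.add (hv.comp hpoly),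
    fun γ tape B b σ a hB => ?_⟩
  beta_reduce at hB
  exact .seq (hrun γ tape B b σ a (by omega)) (hrun' γ tape B b σ _ (by omega))

theorem LinSpace.succ : LinSpace fun n : ℕ => n + 1 :=
  ⟨fun _ b => .inc b, fun n => n + 1, PolyLe.self.add (.const 1),
    fun _ _ _ b σ _ hB => .inc_frame σ b 0 (by simp) (by simpa using hB)⟩

theorem LinSpace.zero : LinSpace fun _ : α => (0 : ℕ) :=
  ⟨fun _ b => .clear b, fun _ => 0, .const 0, fun _ _ _ b σ _ _ => .clear_frame σ b 0 (by simp)⟩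

theorem LinSpace.const (k : ℕ) : LinSpace fun _ : α => k := by
  induction k with
  | zero => exact .zero
  | succ k ih => exact LinSpace.succ.comp ih

theorem LinSpace.fst : LinSpace fun x : α × β => x.1 := by
  refine ⟨fun _ b => .seq (.unpair b) (.seq (.move (b + 1) b) (.clear (b + 2))),
    fun x => enc x + 1, PolyLe.self.add (.const 1), fun γ tape B b σ x hB => ?_⟩
  have hle := left_le_cpair (enc x.1) (enc x.2)
  beta_reduce at hB ⊢
  rw [enc_pair] at hB ⊢
  have hmove : RegRun tape B (.move (b + 1) b) (frame σ b [0, enc x.1, enc x.2])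
      (frame σ b [enc x.1, 0, enc x.2]) := by
    simpa using RegRun.move_frame (tape := tape) (B := B) σ b (i := 1) (j := 0)
      (l := [0, enc x.1, enc x.2]) (by simp) (by simp) (by simp) (by simp; omega)
  have hclear : RegRun tape B (.clear (b + 2)) (frame σ b [enc x.1, 0, enc x.2])
      (frame σ b [enc x.1]) := by
    rw [← frame_pad₂ σ b (enc x.1)]
    exact .clear_frame σ b 2 (by simp)
  exact (RegRun.unpair σ b _ _ hB).seq (hmove.seq hclear)

theorem LinSpace.snd : LinSpace fun x : α × β => x.2 := by
  refine ⟨fun _ b => .seq (.unpair b) (.seq (.move (b + 2) b) (.clear (b + 1))),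
    fun x => enc x + 1, PolyLe.self.add (.const 1), fun γ tape B b σ x hB => ?_⟩
  have hle := right_le_cpair (enc x.1) (enc x.2)
  beta_reduce at hB ⊢
  rw [enc_pair] at hB ⊢
  have hmove : RegRun tape B (.move (b + 2) b) (frame σ b [0, enc x.1, enc x.2])
      (frame σ b [enc x.2, enc x.1, 0]) := by
    simpa using RegRun.move_frame (tape := tape) (B := B) σ b (i := 2) (j := 0)
      (l := [0, enc x.1, enc x.2]) (by simp) (by simp) (by simp) (by simp; omega)
  have hclear : RegRun tape B (.clear (b + 1)) (frame σ b [enc x.2, enc x.1, 0])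
      (frame σ b [enc x.2]) := by
    rw [← frame_pad₂ σ b (enc x.2)]
    exact .clear_frame σ b 1 (by simp)
  exact (RegRun.unpair σ b _ _ hB).seq (hmove.seq hclear)

theorem RegRun.pair_of_runs {γ : Type} {tape : List (InputSymbol γ)} {B b x y z : ℕ}
    {p q : Prog γ} (hp : ∀ σ, RegRun tape B p (frame σ (b + 2) [x]) (frame σ (b + 2) [y]))
    (hq : ∀ σ, RegRun tape B q (frame σ (b + 3) [x]) (frame σ (b + 3) [z]))
    (hx : x ≤ B) (hyz : cpair y z ≤ B) (σ : ℕ → ℕ) :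
    RegRun tape B (.seq (.moveBoth b (b + 1) (b + 2)) (.seq p (.seq (.move (b + 1) (b + 3))
      (.seq q (.seq (.pair (b + 1)) (.move (b + 1) b))))))
      (frame σ b [x]) (frame σ b [cpair y z]) := by
  have hmove : RegRun tape B (.move (b + 1) (b + 3)) (frame σ b [0, x, y])
      (frame σ b [0, 0, y, x]) := by
    rw [← frame_append_zero σ b [0, x, y] 1]
    simpa using RegRun.move_frame (tape := tape) (B := B) σ b (i := 1) (j := 3)
      (l := [0, x, y, 0]) (by simp) (by simp) (by simp) (by simpa)
  have hpair : RegRun tape B (.pair (b + 1)) (frame σ b [0, 0, y, z])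
      (frame σ b [0, cpair y z, 0, 0]) := by
    have hrun := RegRun.pair (tape := tape) (B := B) (frame σ b [0]) (b + 1) y z hyz
    rwa [frame_frame σ b [0] _ (b' := b + 1) rfl, frame_frame σ b [0] _ (b' := b + 1) rfl] at hrun
  have hback : RegRun tape B (.move (b + 1) b) (frame σ b [0, cpair y z, 0, 0])
      (frame σ b [cpair y z]) := by
    rw [← frame_append_zero σ b [cpair y z] 3]
    simpa using RegRun.move_frame (tape := tape) (B := B) σ b (i := 1) (j := 0)
      (l := [0, cpair y z, 0, 0]) (by simp) (by simp) (by simp) (by simpa)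
  exact (RegRun.duplicate σ b x hx).seq ((RegRun.append_frame [0, x] rfl hp σ).seq
    (hmove.seq ((RegRun.append_frame [0, 0, y] rfl hq σ).seq (hpair.seq hback))))

theorem LinSpace.pair {f : α → β} {g : α → δ} (hf : LinSpace f) (hg : LinSpace g) :
    LinSpace fun a => (f a, g a) := by
  have hpf := hf.polyLe
  have hpg := hg.polyLe
  obtain ⟨p, u, hu, hrun⟩ := hf
  obtain ⟨q, v, hv, hrun'⟩ := hg
  refine ⟨fun γ b => .seq (.moveBoth b (b + 1) (b + 2)) (.seq (p γ (b + 2))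
      (.seq (.move (b + 1) (b + 3)) (.seq (q γ (b + 3)) (.seq (.pair (b + 1))
        (.move (b + 1) b))))),
    fun a => u a + (v a + (enc a + cpair (enc (f a)) (enc (g a)))),
    hu.add (hv.add (PolyLe.self.add (hpf.cpair hpg))), fun γ tape B b σ a hB => ?_⟩
  beta_reduce at hB
  exact RegRun.pair_of_runs (fun σ => hrun γ tape B _ σ a (by omega))
    (fun σ => hrun' γ tape B _ σ a (by omega)) (by omega) (by omega) σ

theorem LinSpace.ite_zero {c : α → ℕ} {f g : α → β} (hc : LinSpace c) (hf : LinSpace f)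
    (hg : LinSpace g) : LinSpace fun a => if c a = 0 then f a else g a := by
  obtain ⟨r, w, hw, hrun_c⟩ := hc
  obtain ⟨p, u, hu, hrun_f⟩ := hf
  obtain ⟨q, v, hv, hrun_g⟩ := hg
  refine ⟨fun γ b => .seq (.moveBoth b (b + 1) (b + 2)) (.seq (r γ (b + 2))
      (.seq (.move (b + 1) b) (.ifz (b + 2) (p γ b) (.seq (.clear (b + 2)) (q γ b))))),
    fun a => u a + (v a + (enc a + w a)),
    hu.add (hv.add (PolyLe.self.add hw)), fun γ tape B b σ a hB => ?_⟩
  beta_reduce at hB ⊢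
  have htest : RegRun tape B (r γ (b + 2)) (frame σ b [0, enc a, enc a])
      (frame σ b [0, enc a, c a]) :=
    RegRun.append_frame [0, enc a] rfl (fun σ => hrun_c γ tape B _ σ a (by omega)) σ
  have hmove : RegRun tape B (.move (b + 1) b) (frame σ b [0, enc a, c a])
      (frame σ b [enc a, 0, c a]) := by
    simpa using RegRun.move_frame (tape := tape) (B := B) σ b (i := 1) (j := 0)
      (l := [0, enc a, c a]) (by simp) (by simp) (by simp) (by simp; omega)
  refine (RegRun.duplicate σ b _ (by omega)).seq (htest.seq (hmove.seq ?_))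
  by_cases hz : c a = 0
  · rw [if_pos hz, hz, frame_pad₂]
    exact .ifz_zero (by simp [frame]) (hrun_f γ tape B b σ a (by omega))
  · have hclear : RegRun tape B (.clear (b + 2)) (frame σ b [enc a, 0, c a])
        (frame σ b [enc a]) := by
      rw [← frame_pad₂ σ b (enc a)]
      exact .clear_frame σ b 2 (by simp)
    rw [if_neg hz]
    exact .ifz_pos (by simpa [frame_add]) (hclear.seq (hrun_g γ tape B b σ a (by omega)))

theorem RegRun.iterate_loop {γ : Type} {tape : List (InputSymbol γ)} {B b : ℕ} {p : Prog γ}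
    {f : α → α} (σ : ℕ → ℕ) (n : ℕ) (a : α)
    (hp : ∀ i < n, ∀ σ, RegRun tape B p (frame σ (b + 2) [enc (f^[i] a)])
      (frame σ (b + 2) [enc (f^[i + 1] a)])) :
    RegRun tape B (.loop (b + 1) (.seq (.dec (b + 1)) p)) (frame σ b [0, n, enc a])
      (frame σ b [0, 0, enc (f^[n] a)]) := by
  induction n generalizing a with
  | zero => exact .loop_done (by simp [frame_add])
  | succ n ih =>
    have hdec : RegRun tape B (.dec (b + 1)) (frame σ b [0, n + 1, enc a])
        (frame σ b [0, n, enc a]) :=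
      .dec_frame σ b 1 (by simp) (by simp)
    have hstep : RegRun tape B p (frame σ b [0, n, enc a]) (frame σ b [0, n, enc (f a)]) :=
      RegRun.append_frame [0, n] rfl (hp 0 n.succ_pos) σ
    exact .loop_step (by simp [frame_add]) (hdec.seq hstep)
      (ih (f a) fun i hi => hp (i + 1) (by omega))

theorem LinSpace.iterate {f : α → α} (hf : LinSpace f)
    (hb : ∃ c, ∀ n a i, i ≤ n → enc (f^[i] a) ≤ (enc (n, a) + 2) ^ (c + 1)) :
    LinSpace fun x : ℕ × α => f^[x.1] x.2 := by
  obtain ⟨p, u, ⟨d, hd⟩, hrun⟩ := hf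
  obtain ⟨c, hc⟩ := hb
  refine ⟨fun γ b => .seq (.unpair b) (.seq (.loop (b + 1) (.seq (.dec (b + 1)) (p γ (b + 2))))
      (.move (b + 2) b)),
    fun x => (enc x + 1) + (((enc x + 2) ^ (c + 1) + 2) ^ (d + 1) + (enc x + 2) ^ (c + 1)),
    (PolyLe.self.add (.const 1)).add (((((PolyLe.self.add (.const 2)).pow _).add (.const 2)).pow
      _).add ((PolyLe.self.add (.const 2)).pow _)), ?_⟩
  rintro γ tape B b σ ⟨n, a⟩ hB
  beta_reduce at hB ⊢
  have hu : ∀ i < n, u (f^[i] a) ≤ B := fun i hi => by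
    have := (hd (f^[i] a)).trans (Nat.pow_le_pow_left (Nat.add_le_add_right (hc n a i hi.le) 2) _)
    omega
  have hunpair : RegRun tape B (.unpair b) (frame σ b [enc (n, a)])
      (frame σ b [0, n, enc a]) :=
    RegRun.unpair σ b n (enc a) (show enc (n, a) + 1 ≤ B by omega)
  have hmove : RegRun tape B (.move (b + 2) b) (frame σ b [0, 0, enc (f^[n] a)])
      (frame σ b [enc (f^[n] a)]) := by
    have hle := hc n a n le_rfl
    rw [← frame_pad₂]
    simpa using RegRun.move_frame (tape := tape) (B := B) σ b (i := 2) (j := 0)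
      (l := [0, 0, enc (f^[n] a)]) (by simp) (by simp) (by simp) (by simp; omega)
  refine hunpair.seq ((RegRun.iterate_loop σ n a fun i hi σ => ?_).seq hmove)
  rw [Function.iterate_succ_apply']
  exact hrun γ tape B _ σ _ (hu i hi)

end

/-! ### Arithmetic in linear space -/

theorem cpair_mono {a b c d : ℕ} (h : a ≤ c) (h' : b ≤ d) : cpair a b ≤ cpair c d :=
  Nat.add_le_add (tri_mono (Nat.add_le_add h h')) h'

section

variable {α β δ : Type} [Enc α] [Enc β] [Enc δ]

theorem LinSpace.comp₂ {f : α → β} {g : α → δ} {ε : Type} [Enc ε] {h : β × δ → ε} (hh : LinSpace h)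
    (hf : LinSpace f) (hg : LinSpace g) : LinSpace fun a => h (f a, g a) :=
  hh.comp (hf.pair hg)

theorem LinSpace.add {f g : α → ℕ} (hf : LinSpace f) (hg : LinSpace g) :
    LinSpace fun a => f a + g a := by
  have hiterate := LinSpace.succ.iterate ⟨2, fun n x i hi => by
    rw [Nat.succ_iterate, enc_pair]
    have hn := left_le_cpair (enc n) (enc x)
    have hx := right_le_cpair (enc n) (enc x)
    simp only [enc_nat] at *
    nlinarith [pow_succ (cpair n x + 2) 2, sq_nonneg (cpair n x)]⟩
  exact (hiterate.comp₂ hg hf).of_eq fun a => Nat.succ_iterate _ _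

theorem iterate_succ_shift (i : ℕ) (x : ℕ × ℕ) :
    (fun x : ℕ × ℕ => (x.2, x.2 + 1))^[i + 1] x = (x.2 + i, x.2 + i + 1) := by
  induction i with
  | zero => rfl
  | succ i ih => rw [Function.iterate_succ_apply', ih, add_assoc x.2 i 1]

theorem LinSpace.pred {f : α → ℕ} (hf : LinSpace f) : LinSpace fun a => f a - 1 := by
  have hbound : PolyLe enc fun x : ℕ × ℕ × ℕ => cpair (enc x + enc x) (enc x + enc x + 1) :=
    (PolyLe.self.add .self).cpair ((PolyLe.self.add .self).add (.const 1))
  have hiterate := (LinSpace.snd.pair (LinSpace.succ.comp LinSpace.snd) :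
    LinSpace fun x : ℕ × ℕ => (x.2, x.2 + 1)).iterate (by
      obtain ⟨c, hc⟩ := hbound
      refine ⟨c, fun n x i hi => le_trans ?_ (hc (n, x))⟩
      have hn := left_le_cpair (enc n) (enc x)
      have hx := right_le_cpair (enc n) (enc x)
      have hfst := left_le_cpair x.1 x.2
      have hsnd := right_le_cpair x.1 x.2
      simp only [enc_pair, enc_nat] at *
      cases i with
      | zero => exact cpair_mono (by simp; omega) (by simp; omega)
      | succ i =>
        rw [iterate_succ_shift]
        exact cpair_mono (by simp; omega) (by simp; omega))
  have hzero : LinSpace fun _ : α => (0, 0) := (LinSpace.const 0).pair (.const 0)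
  refine (LinSpace.fst.comp (hiterate.comp₂ hf hzero)).of_eq fun a => ?_
  cases f a with
  | zero => simp
  | succ n => simp [iterate_succ_shift]

theorem iterate_pred (i x : ℕ) : (fun n : ℕ => n - 1)^[i] x = x - i := by
  induction i generalizing x with
  | zero => rfl
  | succ i ih =>
    rw [Function.iterate_succ_apply, ih]
    omega

theorem LinSpace.sub {f g : α → ℕ} (hf : LinSpace f) (hg : LinSpace g) :
    LinSpace fun a => f a - g a := by
  have hiterate := (LinSpace.id.pred : LinSpace fun n : ℕ => n - 1).iterate ⟨0, fun n x i _ => by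
    rw [iterate_pred, enc_pair]
    have hx := right_le_cpair (enc n) (enc x)
    simp only [enc_nat, zero_add, pow_one] at *
    omega⟩
  exact (hiterate.comp₂ hg hf).of_eq fun a => iterate_pred _ _

theorem LinSpace.ite_le {u v : α → ℕ} {f g : α → β} (hu : LinSpace u) (hv : LinSpace v)
    (hf : LinSpace f) (hg : LinSpace g) : LinSpace fun a => if u a ≤ v a then f a else g a :=
  (LinSpace.ite_zero (hu.sub hv) hf hg).of_eq fun a => by simp only [Nat.sub_eq_zero_iff_le]

theorem LinSpace.ite_lt {u v : α → ℕ} {f g : α → β} (hu : LinSpace u) (hv : LinSpace v)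
    (hf : LinSpace f) (hg : LinSpace g) : LinSpace fun a => if u a < v a then f a else g a :=
  (LinSpace.ite_le (LinSpace.succ.comp hu) hv hf hg).of_eq fun a => by simp only [Nat.succ_le_iff]

theorem LinSpace.ite_eq {u v : α → ℕ} {f g : α → β} (hu : LinSpace u) (hv : LinSpace v)
    (hf : LinSpace f) (hg : LinSpace g) : LinSpace fun a => if u a = v a then f a else g a :=
  (LinSpace.ite_zero ((hu.sub hv).add (hv.sub hu)) hf hg).of_eq fun a =>
    if_congr (by omega) rfl rfl

theorem LinSpace.inf {f g : α → ℕ} (hf : LinSpace f) (hg : LinSpace g) :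
    LinSpace fun a => min (f a) (g a) :=
  (LinSpace.ite_le hf hg hf hg).of_eq fun a => by rw [Nat.min_def]

theorem LinSpace.switch {n : ℕ} {u : α → ℕ} (hu : LinSpace u) (h : ∀ a, u a < n) {F : ℕ → α → β}
    (hF : ∀ i, LinSpace (F i)) : LinSpace fun a => F (u a) a := by
  have hlt : ∀ m, LinSpace fun a => if u a < m then F (u a) a else F m a := by
    intro m
    induction m with
    | zero => simpa using hF 0
    | succ m ih =>
      refine (LinSpace.ite_lt hu (.const (m + 1)) ih (hF (m + 1))).of_eq fun a => ?_
      rcases lt_trichotomy (u a) m with hlt | heq | hgt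
      · simp [hlt, hlt.trans (Nat.lt_succ_self m)]
      · simp [heq]
      · simp [show ¬ u a < m + 1 by omega]
  exact (hlt n).of_eq fun a => if_pos (h a)

end

section

variable {α : Type} {r : α → ℕ → ℕ}

/-- An argument and an index of a recursion with values `r`; the encoding carries the current
value, so that a step of the recursion is computed from the code alone. -/
structure RecState (α : Type) (r : α → ℕ → ℕ) where
  arg : α
  idx : ℕ

/-- The argument, the index and the current value. -/
def RecState.triple (s : RecState α r) : α × ℕ × ℕ :=
  (s.arg, s.idx, r s.arg s.idx)

/-- The transition to the next index. -/
def RecState.next (s : RecState α r) : RecState α r := ⟨s.arg, s.idx + 1⟩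

theorem RecState.iterate_next (k : ℕ) (s : RecState α r) :
    next^[k] s = ⟨s.arg, s.idx + k⟩ := by
  induction k generalizing s with
  | zero => rfl
  | succ k ih =>
    rw [Function.iterate_succ_apply, ih, next, add_assoc, add_comm 1]

instance [Enc α] : Enc (RecState α r) := ⟨fun s => enc s.triple⟩

theorem enc_recState [Enc α] (s : RecState α r) : enc s = enc s.triple := rfl

end

section

variable {α : Type} [Enc α]

theorem LinSpace.recState_next {n : α → ℕ} {f : α × ℕ × ℕ → ℕ} {r : α → ℕ → ℕ} (hn : LinSpace n)
    (hf : LinSpace f) (hlt : ∀ a i, i < n a → r a (i + 1) = f (a, i, r a i))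
    (hge : ∀ a i, n a ≤ i → r a (i + 1) = r a i) :
    LinSpace (RecState.next : RecState α r → RecState α r) := by
  have hstep : LinSpace fun t : α × ℕ × ℕ =>
      (t.1, t.2.1 + 1, if t.2.1 < n t.1 then f t else t.2.2) :=
    LinSpace.fst.pair ((LinSpace.succ.comp (LinSpace.fst.comp .snd)).pair
      (.ite_lt (LinSpace.fst.comp .snd) (hn.comp .fst) hf (LinSpace.snd.comp .snd)))
  refine hstep.recode RecState.triple (fun _ => rfl) _ fun s => ?_
  rw [enc_recState]
  rcases lt_or_ge s.triple.2.1 (n s.triple.1) with h | h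
  · rw [if_pos h]
    simp only [RecState.triple, RecState.next, hlt s.arg s.idx h]
  · rw [if_neg h.not_gt]
    simp only [RecState.triple, RecState.next, hge s.arg s.idx h]

theorem LinSpace.recState_iterate {r : α → ℕ → ℕ} {w : α → ℕ} (hw : PolyLe enc w)
    (hr : ∀ a i, r a i ≤ w a) (hnext : LinSpace (RecState.next : RecState α r → RecState α r)) :
    LinSpace fun x : ℕ × RecState α r => RecState.next^[x.1] x.2 := by
  have hbound : PolyLe enc fun t : ℕ × RecState α r =>
      cpair (enc t) (cpair (enc t + enc t) (w t.2.arg)) :=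
    PolyLe.self.cpair ((PolyLe.self.add .self).cpair (hw.comp (PolyLe.self.mono fun t =>
      (left_le_cpair (enc t.2.arg) _).trans (right_le_cpair (enc t.1) (enc t.2)))))
  obtain ⟨c, hc⟩ := hbound
  refine hnext.iterate ⟨c, fun k s i hi => le_trans ?_ (hc (k, s))⟩
  rw [RecState.iterate_next]
  have hk : k ≤ enc (k, s) := left_le_cpair (enc k) (enc s)
  have hs : enc s ≤ enc (k, s) := right_le_cpair (enc k) (enc s)
  have harg : enc s.arg ≤ enc s := left_le_cpair _ _
  have hidx : s.idx ≤ enc s :=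
    (left_le_cpair s.idx (r s.arg s.idx)).trans (right_le_cpair (enc s.arg) _)
  refine cpair_mono (harg.trans hs) (cpair_mono ?_ (hr _ _))
  change s.idx + i ≤ _
  omega

theorem LinSpace.natRec {x n w : α → ℕ} {f : α × ℕ × ℕ → ℕ} (hx : LinSpace x) (hn : LinSpace n)
    (hf : LinSpace f) (hw : PolyLe enc w)
    (hb : ∀ a i, i ≤ n a → Nat.rec (motive := fun _ => ℕ) (x a) (fun j y => f (a, j, y)) i ≤ w a) :
    LinSpace fun a => Nat.rec (motive := fun _ => ℕ) (x a) (fun j y => f (a, j, y)) (n a) := by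
  let r : α → ℕ → ℕ := fun a i =>
    Nat.rec (motive := fun _ => ℕ) (x a) (fun j y => f (a, j, y)) (min i (n a))
  have hnext : LinSpace (RecState.next : RecState α r → RecState α r) := by
    refine LinSpace.recState_next hn hf (fun a i hi => ?_) fun a i hi => ?_
    · simp only [r, min_eq_left (Nat.succ_le_of_lt hi), min_eq_left hi.le]
    · simp only [r, min_eq_right hi, min_eq_right (hi.trans (Nat.le_succ i))]
  have hiterate := LinSpace.recState_iterate hw (fun a i => hb a _ (min_le_right i (n a))) hnext
  have hstart : LinSpace fun a => (⟨a, 0⟩ : RecState α r) :=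
    (LinSpace.id.pair ((LinSpace.const 0).pair hx)).recode _ (fun _ => rfl) _ fun a => by
      rw [enc_recState]
      simp [RecState.triple, r]
  have hvalue : LinSpace fun s : RecState α r => r s.arg s.idx :=
    (LinSpace.snd.comp (LinSpace.snd) : LinSpace fun t : α × ℕ × ℕ => t.2.2).recode
      RecState.triple (fun _ => rfl) _ fun _ => rfl
  refine (hvalue.comp (hiterate.comp₂ hn hstart)).of_eq fun a => ?_
  rw [RecState.iterate_next]
  simp [r]

theorem LinSpace.capRec {x n w : α → ℕ} {f : α × ℕ × ℕ → ℕ} (hx : LinSpace x) (hn : LinSpace n)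
    (hf : LinSpace f) (hw : LinSpace w) : LinSpace fun a => Nat.rec (motive := fun _ => ℕ) (x a)
      (fun j y => min (f (a, j, y)) (w a)) (n a) :=
  LinSpace.natRec (f := fun t => min (f t) (w t.1)) hx hn (hf.inf (hw.comp .fst))
    (hx.polyLe.add hw.polyLe) fun a i _ => by
      cases i with
      | zero => exact Nat.le_add_right _ _
      | succ i => exact (min_le_right _ _).trans (Nat.le_add_left _ _)

theorem LinSpace.mul {f g : α → ℕ} (hf : LinSpace f) (hg : LinSpace g) :
    LinSpace fun a => f a * g a := by
  have hrec : ∀ a i, Nat.rec (motive := fun _ => ℕ) 0 (fun _ y => y + f a) i = f a * i := by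
    intro a i
    induction i with
    | zero => rfl
    | succ i ih =>
      simp only [ih]
      ring
  have hlin := LinSpace.natRec (f := fun t : α × ℕ × ℕ => t.2.2 + f t.1) (.const 0) hg
    ((LinSpace.snd.comp .snd).add (hf.comp .fst)) (hf.polyLe.mul hg.polyLe)
    fun a i hi => by
      simp only [hrec]
      exact Nat.mul_le_mul_left _ hi
  exact hlin.of_eq fun a => hrec a _

theorem LinSpace.div {f g : α → ℕ} (hf : LinSpace f) (hg : LinSpace g) :
    LinSpace fun a => f a / g a := by
  have hrec : ∀ a, g a ≠ 0 → ∀ i, Nat.rec (motive := fun _ => ℕ) 0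
      (fun _ y => min (if (y + 1) * g a ≤ f a then y + 1 else y) (f a)) i = min i (f a / g a) := by
    intro a ha i
    induction i with
    | zero => simp
    | succ i ih =>
      have hle := Nat.div_le_self (f a) (g a)
      simp only [ih]
      simp only [← Nat.le_div_iff_mul_le (Nat.pos_of_ne_zero ha)]
      split_ifs <;> omega
  have hquot : LinSpace fun t : α × ℕ × ℕ => t.2.2 := LinSpace.snd.comp .snd
  have hlin := LinSpace.capRec
    (f := fun t : α × ℕ × ℕ => if (t.2.2 + 1) * g t.1 ≤ f t.1 then t.2.2 + 1 else t.2.2)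
    (.const 0) hf (.ite_le ((LinSpace.succ.comp hquot).mul (hg.comp .fst)) (hf.comp .fst)
      (LinSpace.succ.comp hquot) hquot) hf
  refine (LinSpace.ite_zero hg (.const 0) hlin).of_eq fun a => ?_
  split_ifs with ha
  · rw [ha, Nat.div_zero]
  · exact (hrec a ha _).trans (min_eq_right (Nat.div_le_self _ _))

theorem LinSpace.mod {f g : α → ℕ} (hf : LinSpace f) (hg : LinSpace g) :
    LinSpace fun a => f a % g a :=
  (hf.sub (hg.mul (hf.div hg))).of_eq fun a => by
    have := Nat.div_add_mod (f a) (g a)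
    omega

end

/-! ### Loops of functions computed in linear space -/

section

variable {γ : Type} {tape : List (InputSymbol γ)} {B : ℕ}

theorem RegRun.move_down (σ : ℕ → ℕ) (b v : ℕ) (hB : v ≤ B) :
    RegRun tape B (.move (b + 1) b) (frame σ b [0, v, 0]) (frame σ b [v]) := by
  rw [← frame_pad₂]
  simpa using RegRun.move_frame (tape := tape) (B := B) σ b (i := 1) (j := 0)
    (l := [0, v, 0]) (by simp) (by simp) (by simp) (by simpa)

/-- The loop runs on the registers `0, x, t x`: it drops the old test value `t x`, applies `q`,
which replaces `x` by the pair of `f x` and `t (f x)`, and unpairs. -/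
theorem RegRun.while_loop {q : Prog γ} (σ : ℕ → ℕ) (b : ℕ) {x t : ℕ → ℕ} {n : ℕ}
    (hq : ∀ i < n, RegRun tape B q (frame σ b [x i])
      (frame σ b [cpair (x (i + 1)) (t (i + 1))]))
    (ht : ∀ i < n, t i ≠ 0) (htn : t n = 0) (hB : ∀ i ≤ n, cpair (x i) (t i) + 1 ≤ B) :
    RegRun tape B (.loop (b + 2) (.seq (.clear (b + 2)) (.seq (.move (b + 1) b)
      (.seq q (.unpair b))))) (frame σ b [0, x 0, t 0]) (frame σ b [0, x n, 0]) := by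
  induction n generalizing x t with
  | zero => rw [htn]; exact .loop_done (by simp [frame_add])
  | succ n ih =>
    have hle : x 0 ≤ B := by
      have := left_le_cpair (x 0) (t 0)
      have := hB 0 (Nat.zero_le _)
      omega
    exact .loop_step (by simpa [frame_add] using ht 0 n.succ_pos)
      ((RegRun.clear_frame σ b 2 (l := [0, x 0, t 0]) (by simp)).seq
        ((RegRun.move_down σ b _ hle).seq ((hq 0 n.succ_pos).seq
          (RegRun.unpair σ b _ _ (hB 1 (by omega))))))
      (ih (x := fun i => x (i + 1)) (t := fun i => t (i + 1)) (fun i hi => hq (i + 1) (by omega))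
        (fun i hi => ht (i + 1) (by omega)) htn fun i hi => hB (i + 1) (by omega))

end

theorem LinSpace.exists_while {α : Type} [Enc α] {f : α → α} {t : α → ℕ} (hf : LinSpace f)
    (ht : LinSpace t) : ∃ (p : (γ : Type) → ℕ → Prog γ) (u : α → ℕ), PolyLe enc u ∧
      ∀ (γ : Type) (tape : List (InputSymbol γ)) (B b : ℕ) (σ : ℕ → ℕ) (x : ℕ → α) (n : ℕ),
        (∀ i < n, x (i + 1) = f (x i)) → (∀ i < n, t (x i) ≠ 0) → t (x n) = 0 →
        (∀ i ≤ n, u (x i) ≤ B) →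
        RegRun tape B (p γ b) (frame σ b [enc (x 0)]) (frame σ b [enc (x n)]) := by
  have hinit : LinSpace fun a => (a, t a) := LinSpace.id.pair ht
  have hstep : LinSpace fun a => (f a, t (f a)) := hf.pair (ht.comp hf)
  have hinit_le := hinit.polyLe
  obtain ⟨p, u, hu, hp⟩ := hinit
  obtain ⟨q, v, hv, hq⟩ := hstep
  refine ⟨fun γ b => .seq (p γ b) (.seq (.unpair b) (.seq (.loop (b + 2) (.seq (.clear (b + 2))
      (.seq (.move (b + 1) b) (.seq (q γ b) (.unpair b))))) (.move (b + 1) b))),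
    fun a => (u a + v a) + (enc (a, t a) + 1),
    (hu.add hv).add (hinit_le.add (.const 1)), fun γ tape B b σ x n hx htn ht0 hB => ?_⟩
  beta_reduce at hB
  have hpair : ∀ i ≤ n, cpair (enc (x i)) (t (x i)) + 1 ≤ B := fun i hi =>
    show enc (x i, t (x i)) + 1 ≤ B by have := hB i hi; omega
  have hq' : ∀ i < n, RegRun tape B (q γ b) (frame σ b [enc (x i)])
      (frame σ b [cpair (enc (x (i + 1))) (t (x (i + 1)))]) := fun i hi => by
    rw [hx i hi]
    exact hq γ tape B b σ (x i) (by have := hB i hi.le; omega)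
  have hle := (left_le_cpair _ _).trans (Nat.le_of_succ_le (hpair n le_rfl))
  exact (hp γ tape B b σ (x 0) (by have := hB 0 n.zero_le; omega)).seq
    ((RegRun.unpair σ b _ _ (hpair 0 n.zero_le)).seq
      ((RegRun.while_loop σ b (x := fun i => enc (x i)) (t := fun i => t (x i)) hq' htn ht0
        hpair).seq (RegRun.move_down σ b _ hle)))

/-! ### Numbers for the elements of finite types -/

/-- An injective numbering of a finite type by numbers below `card`, with an inverse. -/
structure Coding (X : Type) where
  card : ℕ
  code : X → ℕ
  decode : ℕ → X
  code_lt : ∀ x, code x < card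
  decode_code : ∀ x, decode (code x) = x

theorem exists_coding {X : Type} [Finite X] (x₀ : X) : ∃ C : Coding X, C.code x₀ = 0 := by
  classical
  obtain ⟨n, ⟨e⟩⟩ := Finite.exists_equiv_fin X
  have hn : 0 < n := (Nat.zero_le _).trans_lt (e x₀).2
  let e₀ := e.trans (Equiv.swap (e x₀) ⟨0, hn⟩)
  exact ⟨⟨n, fun x => e₀ x, fun i => if h : i < n then e₀.symm ⟨i, h⟩ else x₀,
    fun x => (e₀ x).2, fun x => by simp⟩, by simp [e₀]⟩

/-! ### Digits -/

/-- `d k` is the digit of `a` at the place `G ^ k`. -/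
def HasDigits (G a : ℕ) (d : ℕ → ℕ) : Prop :=
  ∀ k, a / G ^ k % G = d k

section

variable {G a : ℕ} {d : ℕ → ℕ}

theorem HasDigits.mod_eq (h : HasDigits G a d) : a % G = d 0 := by
  simpa using h 0

theorem HasDigits.div (h : HasDigits G a d) : HasDigits G (a / G) fun k => d (k + 1) := fun k => by
  simp only [← h (k + 1), pow_succ', Nat.div_div_eq_div_mul]

theorem HasDigits.congr {e : ℕ → ℕ} (h : HasDigits G a d) (hde : ∀ k, d k = e k) :
    HasDigits G a e := fun k => (h k).trans (hde k)

theorem HasDigits.push {w : ℕ} (h : HasDigits G a fun k => d (k + 1)) (hw : w < G)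
    (hd : d 0 = w) : HasDigits G (a * G + w) d := by
  rintro (_ | k)
  · rw [pow_zero, Nat.div_one, Nat.mul_comm, Nat.mul_add_mod, Nat.mod_eq_of_lt hw, hd]
  · rw [pow_succ', ← Nat.div_div_eq_div_mul, Nat.mul_comm, Nat.mul_add_div (by omega),
      Nat.div_eq_of_lt hw, Nat.add_zero, h]

theorem HasDigits.eq_zero (hG : 1 < G) (h : HasDigits G a fun _ => 0) : a = 0 := by
  induction a using Nat.strong_induction_on with
  | _ a ih =>
    by_contra ha
    have hdiv := ih (a / G) (Nat.div_lt_self (Nat.pos_of_ne_zero ha) hG) h.div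
    have hmod := h.mod_eq
    have := Nat.div_add_mod a G
    rw [hmod, hdiv] at this
    omega

theorem HasDigits.lt_pow {S : ℕ} (hG : 1 < G) (h : HasDigits G a d) (hd : ∀ k, S ≤ k → d k = 0) :
    a < G ^ S := by
  have hzero : a / G ^ S = 0 := HasDigits.eq_zero hG fun k => by
    rw [Nat.div_div_eq_div_mul, ← pow_add, h, hd _ (Nat.le_add_right _ _)]
  exact (Nat.div_eq_zero_iff.1 hzero).resolve_left (by positivity)

end

/-! ### Work tapes as pairs of numbers -/

/-- The pair `p` represents a work tape `f` with the head in position `z`: the digits of `p.1` are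
the symbols to the left of the head, read leftwards, and the digits of `p.2` are the others, read
rightwards. -/
structure TapeRep {Γ : Type} (k : Coding Γ) (f : ℤ → Γ) (z : ℤ) (p : ℕ × ℕ) : Prop where
  left : HasDigits (k.card + 1) p.1 fun i => k.code (f (z - 1 - i))
  right : HasDigits (k.card + 1) p.2 fun i => k.code (f (z + i))

/-- Writing a digit at the head of a represented tape. -/
def tapeWrite (G w : ℕ) (p : ℕ × ℕ) : ℕ × ℕ :=
  (p.1, p.2 / G * G + w)

/-- Moving the head of a represented tape. -/
def tapeMove (G : ℕ) : Move → ℕ × ℕ → ℕ × ℕ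
  | .left, p => (p.1 / G, p.2 * G + p.1 % G)
  | .stay, p => p
  | .right, p => (p.1 * G + p.2 % G, p.2 / G)

section

variable {Γ : Type} {k : Coding Γ} {f : ℤ → Γ} {z : ℤ} {p : ℕ × ℕ}

theorem TapeRep.write (h : TapeRep k f z p) (g : Γ) :
    TapeRep k (Function.update f z g) z (tapeWrite (k.card + 1) (k.code g) p) := by
  have hne : ∀ y : ℤ, y ≠ z → k.code (f y) = k.code (Function.update f z g y) := fun y hy => by
    rw [Function.update_of_ne hy]
  exact ⟨h.left.congr fun i => hne _ (by omega), (h.right.div.congr fun i => hne _ (by omega)).push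
    ((k.code_lt g).trans k.card.lt_succ_self) (by simp)⟩

theorem TapeRep.move (h : TapeRep k f z p) (m : Move) :
    TapeRep k f (m.onWork z) (tapeMove (k.card + 1) m p) := by
  have hmod : ∀ a, a % (k.card + 1) < k.card + 1 := fun a => Nat.mod_lt _ k.card.succ_pos
  have hcell : ∀ {y y' : ℤ}, y = y' → k.code (f y) = k.code (f y') := fun h => h ▸ rfl
  cases m with
  | left =>
    exact ⟨h.left.div.congr fun i => hcell (by simp only [Move.onWork]; push_cast; ring),
      (h.right.congr fun i => hcell (by simp only [Move.onWork]; push_cast; ring)).push (hmod _)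
        (by simp [h.left.mod_eq, Move.onWork])⟩
  | stay => exact h
  | right =>
    exact ⟨(h.left.congr fun i => hcell (by simp only [Move.onWork]; push_cast; ring)).push (hmod _)
        (by simp [h.right.mod_eq, Move.onWork]),
      h.right.div.congr fun i => hcell (by simp only [Move.onWork]; push_cast; ring)⟩

theorem TapeRep.lt_pow (h : TapeRep k f z p) {lo : ℤ} {S : ℕ} (hz : z ∈ Set.Ico lo (lo + S))
    (hf : ∀ y ∉ Set.Ico lo (lo + S), k.code (f y) = 0) :
    p.1 < (k.card + 1) ^ S ∧ p.2 < (k.card + 1) ^ S := by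
  have hcard : 1 < k.card + 1 := by have := k.code_lt (f 0); omega
  rw [Set.mem_Ico] at hz
  exact ⟨h.left.lt_pow hcard fun i hi => hf _ (by rw [Set.mem_Ico]; omega),
    h.right.lt_pow hcard fun i hi => hf _ (by rw [Set.mem_Ico]; omega)⟩

end

/-! ### Direct simulation of a machine with a unary input alphabet -/

/-- A configuration of a machine on the input `1 ^ len` in numbers; `out` is the number that has
been printed in binary. -/
structure SimState where
  len : ℕ
  state : ℕ
  pos : ℕ
  work : ℕ × ℕ
  out : ℕ

/-- The components of a represented configuration. -/
def SimState.tuple (x : SimState) : ℕ × ℕ × ℕ × (ℕ × ℕ) × ℕ :=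
  (x.len, x.state, x.pos, x.work, x.out)

instance : Enc SimState := ⟨fun x => enc x.tuple⟩

theorem SimState.linSpace_len : LinSpace SimState.len :=
  LinSpace.fst.recode tuple (fun _ => rfl) _ fun _ => rfl

theorem SimState.linSpace_state : LinSpace SimState.state :=
  (LinSpace.fst.comp .snd).recode tuple (fun _ => rfl) _ fun _ => rfl

theorem SimState.linSpace_pos : LinSpace SimState.pos :=
  (LinSpace.fst.comp (LinSpace.snd.comp .snd)).recode tuple (fun _ => rfl) _ fun _ => rfl

theorem SimState.linSpace_work : LinSpace SimState.work :=
  (LinSpace.fst.comp (LinSpace.snd.comp (LinSpace.snd.comp .snd))).recode tuple (fun _ => rfl) _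
    fun _ => rfl

theorem SimState.linSpace_out : LinSpace SimState.out :=
  (LinSpace.snd.comp (LinSpace.snd.comp (LinSpace.snd.comp .snd))).recode tuple (fun _ => rfl) _
    fun _ => rfl

theorem SimState.linSpace_mk {α : Type} [Enc α] {l q i o : α → ℕ} {w : α → ℕ × ℕ} (hl : LinSpace l)
    (hq : LinSpace q) (hi : LinSpace i) (hw : LinSpace w) (ho : LinSpace o) :
    LinSpace fun a => (⟨l a, q a, i a, w a, o a⟩ : SimState) :=
  (hl.pair (hq.pair (hi.pair (hw.pair ho)))).recode id (fun _ => rfl) _ fun _ => rfl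

theorem linSpace_tapeWrite (G w : ℕ) : LinSpace (tapeWrite G w) :=
  LinSpace.fst.pair (((LinSpace.snd.div (.const G)).mul (.const G)).add (.const w))

theorem linSpace_tapeMove (G : ℕ) (m : Move) : LinSpace (tapeMove G m) := by
  have hG : LinSpace fun _ : ℕ × ℕ => G := .const G
  cases m with
  | left => exact (LinSpace.fst.div hG).pair ((LinSpace.snd.mul hG).add (LinSpace.fst.mod hG))
  | stay => exact .id
  | right => exact ((LinSpace.fst.mul hG).add (LinSpace.snd.mod hG)).pair (LinSpace.snd.div hG)

/-- The symbols `⊢`, `1` and `⊣` of a unary input tape, by number. -/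
def unarySymbol : ℕ → InputSymbol Unit
  | 0 => .leftEnd
  | 1 => .letter ()
  | _ => .rightEnd

/-- The number of the symbol in position `i` of the input tape `⊢ 1ⁿ ⊣`. -/
def unaryCode (n i : ℕ) : ℕ := if i = 0 then 0 else if i ≤ n then 1 else 2

theorem unaryCode_lt (n i : ℕ) : unaryCode n i < 3 := by
  unfold unaryCode
  split_ifs <;> omega

theorem unarySymbol_unaryCode (n i : ℕ) :
    unarySymbol (unaryCode n i) = (unaryTape n).getD i .rightEnd := by
  rw [getD_unaryTape, unaryCode]
  split_ifs <;> rfl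

section

variable {Γ : Type} {M : Machine Unit Γ} (kQ : Coding M.Q) (kΓ : Coding Γ)

/-- The effect of an action on a represented configuration. -/
def simAction (t : Action M.Q Γ) (x : SimState) : SimState where
  len := x.len
  state := kQ.code t.state
  pos := match t.inputMove with
    | .left => x.pos - 1
    | .stay => x.pos
    | .right => min (x.pos + 1) (x.len + 1)
  work := tapeMove (kΓ.card + 1) t.workMove (tapeWrite (kΓ.card + 1) (kΓ.code t.write) x.work)
  out := match t.print with
    | none => x.out
    | some b => 2 * x.out + b.toNat

theorem linSpace_simAction (t : Action M.Q Γ) : LinSpace (simAction kQ kΓ t) := by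
  refine SimState.linSpace_mk SimState.linSpace_len (.const _) ?_
    ((linSpace_tapeMove _ _).comp ((linSpace_tapeWrite _ _).comp SimState.linSpace_work)) ?_
  · cases t.inputMove with
    | left => exact SimState.linSpace_pos.pred
    | stay => exact SimState.linSpace_pos
    | right =>
      exact (SimState.linSpace_pos.add (.const 1)).inf (SimState.linSpace_len.add (.const 1))
  · cases t.print with
    | none => exact SimState.linSpace_out
    | some b => exact ((LinSpace.const 2).mul SimState.linSpace_out).add (.const _)

/-- The action of the machine for given numbers of the state, the input symbol and the work
symbol. -/
def simAct (q a g : ℕ) : Option (Action M.Q Γ) :=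
  M.δ (kQ.decode q) (unarySymbol a) (kΓ.decode g)

/-- The action of the machine in a represented configuration. The remainders are there to make the
number of cases finite. -/
def SimState.act (x : SimState) : Option (Action M.Q Γ) :=
  simAct kQ kΓ (x.state % (kQ.card + 1)) (unaryCode x.len x.pos) (x.work.2 % (kΓ.card + 1))

theorem LinSpace.simState_act {β : Type} [Enc β] {F : Option (Action M.Q Γ) → SimState → β}
    (hF : ∀ t, LinSpace (F t)) : LinSpace fun x : SimState => F (x.act kQ kΓ) x := by
  have hstate : LinSpace fun x : SimState => x.state % (kQ.card + 1) :=
    SimState.linSpace_state.mod (.const _)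
  have hinput : LinSpace fun x : SimState => unaryCode x.len x.pos :=
    .ite_eq SimState.linSpace_pos (.const 0) (.const 0)
      (.ite_le SimState.linSpace_pos SimState.linSpace_len (.const 1) (.const 2))
  have hwork : LinSpace fun x : SimState => x.work.2 % (kΓ.card + 1) :=
    (LinSpace.snd.comp SimState.linSpace_work).mod (.const _)
  refine LinSpace.switch (F := fun q x =>
    F (simAct kQ kΓ q (unaryCode x.len x.pos) (x.work.2 % (kΓ.card + 1))) x)
    hstate (fun _ => Nat.mod_lt _ (Nat.succ_pos _)) fun q => ?_
  refine LinSpace.switch (F := fun a x => F (simAct kQ kΓ q a (x.work.2 % (kΓ.card + 1))) x)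
    hinput (fun x => unaryCode_lt x.len x.pos) fun a => ?_
  exact LinSpace.switch (F := fun g x => F (simAct kQ kΓ q a g) x)
    hwork (fun _ => Nat.mod_lt _ (Nat.succ_pos _)) fun g => hF _

/-- One step of the simulation; a halted configuration is left unchanged. -/
def simStep (x : SimState) : SimState := (x.act kQ kΓ).elim x fun t => simAction kQ kΓ t x

/-- `1` if the machine makes another step, and `0` if it has halted. -/
def simRunning (x : SimState) : ℕ := (x.act kQ kΓ).elim 0 fun _ => 1

theorem linSpace_simStep : LinSpace (simStep kQ kΓ) :=
  LinSpace.simState_act kQ kΓ (F := fun t x => t.elim x fun t => simAction kQ kΓ t x) fun t => by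
    cases t with
    | none => exact .id
    | some t => exact linSpace_simAction kQ kΓ t

theorem linSpace_simRunning : LinSpace (simRunning kQ kΓ) :=
  LinSpace.simState_act kQ kΓ (F := fun t _ => t.elim 0 fun _ => 1) fun _ => .const _

/-- `x` represents the configuration `c` of a computation on `1ⁿ`. -/
structure SimRep (n : ℕ) (c : Config M.Q Γ) (x : SimState) : Prop where
  len : x.len = n
  state : x.state = kQ.code c.state
  pos : x.pos = c.inputPos
  work : TapeRep kΓ c.work c.workPos x.work
  out : x.out = bitVal c.output

/-- The representation of the initial configuration on `1ⁿ`. -/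
def simInit (n : ℕ) : SimState := ⟨n, kQ.code M.start, 0, (0, 0), 0⟩

variable {kQ kΓ} {n : ℕ} {c c' : Config M.Q Γ} {x : SimState}

theorem SimRep.act_eq (h : SimRep kQ kΓ n c x) : x.act kQ kΓ =
    M.δ c.state ((unaryTape n).getD c.inputPos .rightEnd) (c.work c.workPos) := by
  have hwork : x.work.2 % (kΓ.card + 1) = kΓ.code (c.work c.workPos) := by
    simpa using h.work.right.mod_eq
  have := kQ.code_lt c.state
  rw [SimState.act, simAct, unarySymbol_unaryCode, hwork, kΓ.decode_code, h.state,
    Nat.mod_eq_of_lt (by omega), kQ.decode_code, h.len, h.pos]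

theorem SimRep.running_of_some (h : SimRep kQ kΓ n c x)
    (hs : M.step (unaryTape n) c = some c') : simRunning kQ kΓ x ≠ 0 := by
  unfold Machine.step at hs
  obtain ⟨t, ht, -⟩ := Option.map_eq_some_iff.1 hs
  rw [simRunning, h.act_eq, ht]
  exact one_ne_zero

theorem SimRep.running_of_none (h : SimRep kQ kΓ n c x)
    (hs : M.step (unaryTape n) c = none) : simRunning kQ kΓ x = 0 := by
  unfold Machine.step at hs
  rw [Option.map_eq_none_iff] at hs
  rw [simRunning, h.act_eq, hs]
  rfl

theorem SimRep.step (h : SimRep kQ kΓ n c x) (hs : M.step (unaryTape n) c = some c') :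
    SimRep kQ kΓ n c' (simStep kQ kΓ x) := by
  unfold Machine.step at hs
  obtain ⟨t, ht, rfl⟩ := Option.map_eq_some_iff.1 hs
  rw [simStep, h.act_eq, ht]
  refine ⟨h.len, rfl, ?_, (h.work.write t.write).move t.workMove, ?_⟩
  · simp only [simAction, Option.elim, length_unaryTape, h.pos, h.len]
    cases t.inputMove <;> simp [Move.onInput]
  · simp only [simAction, Option.elim, h.out]
    cases t.print <;> simp [bitVal, List.foldl_append]

theorem SimRep.init [Inhabited Γ] (h : kΓ.code default = 0) (n : ℕ) :
    SimRep kQ kΓ n M.init (simInit kQ n) :=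
  ⟨rfl, rfl, rfl, ⟨fun k => by simp [simInit, Machine.init, h],
    fun k => by simp [simInit, Machine.init, h]⟩, rfl⟩

theorem IsRun.simRep [Inhabited Γ] (hk : kΓ.code default = 0) {c : ℕ → Config M.Q Γ} {T : ℕ}
    (hc : IsRun M (unaryTape n) c T) {i : ℕ} (hi : i ≤ T) :
    SimRep kQ kΓ n (c i) ((simStep kQ kΓ)^[i] (simInit kQ n)) := by
  induction i with
  | zero => rw [hc.zero]; exact .init hk n
  | succ i ih =>
    rw [Function.iterate_succ_apply']
    exact (ih (by omega)).step (hc.step i (by omega))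

theorem IsRun.simRep_le [Inhabited Γ] (hk : kΓ.code default = 0) {c : ℕ → Config M.Q Γ}
    {T S : ℕ} (hc : IsRun M (unaryTape n) c T)
    (hS : (M.usedCells (unaryTape n)).encard ≤ S) {i : ℕ} (hi : i ≤ T)
    (hx : SimRep kQ kΓ n (c i) x) :
    x.len = n ∧ x.state < kQ.card ∧ x.pos ≤ n + 1 ∧ x.work.1 < (kΓ.card + 1) ^ S ∧
      x.work.2 < (kΓ.card + 1) ^ S ∧ x.out ≤ bitVal (c T).output := by
  obtain ⟨lo, hlo⟩ := hc.exists_workPos_mem_Ico hS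
  have hblank : ∀ y ∉ Set.Ico lo (lo + S), kΓ.code ((c i).work y) = 0 := fun y hy => by
    rw [hc.work_eq_default hi fun j hj hjy => hy (by rw [← hjy]; exact hlo j (by omega)), hk]
  have hwork := hx.work.lt_pow (hlo i hi) hblank
  refine ⟨hx.len, hx.state ▸ kQ.code_lt _, ?_, hwork.1, hwork.2, ?_⟩
  · rw [hx.pos]; simpa [length_unaryTape] using hc.inputPos_le hi
  · rw [hx.out]; exact bitVal_mono (hc.output_prefix hi)

end

/-! ### Transition tables of a machine with a cyclic binary work tape -/

/-- The actual move of the input head, which cannot leave the tape. -/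
def effMove {α : Type} : InputSymbol α → Move → Move
  | .leftEnd, .left => .stay
  | .rightEnd, .right => .stay
  | _, m => m

theorem effMove_leftEnd_ne {α : Type} (m : Move) :
    effMove (.leftEnd : InputSymbol α) m ≠ .left := by
  cases m <;> simp [effMove]

theorem effMove_rightEnd_ne {α : Type} (m : Move) :
    effMove (.rightEnd : InputSymbol α) m ≠ .right := by
  cases m <;> simp [effMove]

/-- The rotation of a cyclic binary tape with `P` possible contents by a move of the head; the
scanned bit is the lowest one. -/
def rotate (P : ℕ) : Move → ℕ → ℕ
  | .left, v => 2 * v % P + 2 * v / P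
  | .stay, v => v
  | .right, v => v / 2 + v % 2 * (P / 2)

theorem rotate_lt {P v : ℕ} (hP : Even P) (m : Move) (hv : v < P) : rotate P m v < P := by
  obtain ⟨p, rfl⟩ := hP
  rw [← two_mul] at hv ⊢
  cases m with
  | left =>
    have hmod : v % p < p := Nat.mod_lt _ (by omega)
    have hdiv : v / p < 2 := by rwa [Nat.div_lt_iff_lt_mul (by omega)]
    rw [rotate, Nat.mul_mod_mul_left, Nat.mul_div_mul_left _ _ (by norm_num)]
    omega
  | stay => exact hv
  | right =>
    rw [rotate, Nat.mul_div_cancel_left _ (by norm_num)]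
    rcases Nat.mod_two_eq_zero_or_one v with h | h <;> rw [h] <;> omega

theorem writeBit_lt {P v : ℕ} (hP : Even P) (b : Bool) (hv : v < P) :
    v / 2 * 2 + b.toNat < P := by
  obtain ⟨p, rfl⟩ := hP
  have := Bool.toNat_lt b
  omega

section

variable {α : Type} {M : Machine α Bool} (kQ : Coding M.Q)

/-- The number of pairs `j` of a state and the last printed bit, if any: the state has the code
`j / 3`, and `j % 3` is `0` if nothing has been printed and `1 + b` if the last bit is `b`. -/
def nControl : ℕ := 3 * kQ.card

/-- The number of configurations on a cyclic work tape with `P` possible contents: the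
configuration `c` has the control part `c % nControl` and the tape `c / nControl`. -/
def nConf (P : ℕ) : ℕ := nControl kQ * P

/-- The number of possible entries of a table: `0` stands for halting without output or for no
information, `1` and `2` for halting with an output bit, and `3 + c` for leaving to the right in
the configuration `c`. -/
def nEntry (P : ℕ) : ℕ := nConf kQ P + 3

/-- The action in the configuration `c` on the input symbol `a`. -/
def confAction (a : InputSymbol α) (c : ℕ) : Option (Action M.Q Bool) :=
  M.δ (kQ.decode (c % nControl kQ / 3)) a (decide (c / nControl kQ % 2 = 1))

/-- The configuration after an action in the configuration with control part `j` and tape `v`. -/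
def confNextAt (P : ℕ) (t : Action M.Q Bool) (j v : ℕ) : ℕ :=
  rotate P t.workMove (v / 2 * 2 + t.write.toNat) * nControl kQ +
    (3 * kQ.code t.state + t.print.elim (j % 3) fun b => 1 + b.toNat)

/-- The effect of an action on a configuration. -/
def confNext (P : ℕ) (t : Action M.Q Bool) (c : ℕ) : ℕ :=
  confNextAt kQ P t (c % nControl kQ) (c / nControl kQ)

/-- Entry `c` of the table `T`, which is a number in base `nEntry`. -/
def tableEntry (P T c : ℕ) : ℕ := T / nEntry kQ P ^ c % nEntry kQ P

/-- How a computation goes on in configuration `d` after a move of the input head, where `T` is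
the table of the cell to the left. Numbers below `nEntry` are final results, and `nEntry + c` means
that the computation is on the same cell in configuration `c`. -/
def afterMove (P T : ℕ) : Move → ℕ → ℕ
  | .left, d =>
    if tableEntry kQ P T d < 3 then tableEntry kQ P T d
    else nEntry kQ P + (tableEntry kQ P T d - 3)
  | .stay, d => nEntry kQ P + d
  | .right, d => 3 + d

/-- One step of a computation on a cell with symbol `a`, for a given control part `j`, a
given scanned bit `g` and the tape `v`. -/
def tableStepAt (a : InputSymbol α) (j g P T v : ℕ) : ℕ :=
  (M.δ (kQ.decode (j / 3)) a (decide (g = 1))).elim (j % 3) fun t =>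
    afterMove kQ P T (effMove a t.inputMove) (confNextAt kQ P t j v)

/-- One step of a computation on a cell with symbol `a`, where `T` is the table of the cell to
the left. -/
def tableStep (a : InputSymbol α) (P T y : ℕ) : ℕ :=
  if y < nEntry kQ P then y
  else tableStepAt kQ a ((y - nEntry kQ P) % nControl kQ) ((y - nEntry kQ P) / nControl kQ % 2) P T
    ((y - nEntry kQ P) / nControl kQ)

/-- The first `n` steps of the computation that starts in configuration `c`; the cap, which is
never reached, makes the linear space bound evident. -/
def tableRun (a : InputSymbol α) (P T c n : ℕ) : ℕ :=
  Nat.rec (motive := fun _ => ℕ) (nEntry kQ P + c)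
    (fun _ y => min (tableStep kQ a P T y) (nEntry kQ P + nConf kQ P)) n

/-- The entry for configuration `c` of the table of a cell with symbol `a`, from the table of the
cell to the left. A computation that is still on the cell after `nConf` steps does not halt. -/
def newEntry (a : InputSymbol α) (P T c : ℕ) : ℕ :=
  if tableRun kQ a P T c (nConf kQ P) < nEntry kQ P then tableRun kQ a P T c (nConf kQ P) else 0

/-- The last `n` entries of the new table; `N` is a cap as in `tableRun`. -/
def tableBuild (a : InputSymbol α) (P N T n : ℕ) : ℕ :=
  Nat.rec (motive := fun _ => ℕ) 0
    (fun j y => min (y * nEntry kQ P + newEntry kQ a P T (nConf kQ P - 1 - j)) N) n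

/-- The state of the scan of the input: the number of contents of the work tape, a bound for all
tables, the table of the cell that was read last, and the result so far, which is coded like a
table entry. -/
structure TableState where
  contents : ℕ
  bound : ℕ
  table : ℕ
  result : ℕ

/-- The table of a cell with symbol `a`, from the table of the cell to the left. -/
def newTable (a : InputSymbol α) (x : TableState) : ℕ :=
  tableBuild kQ a x.contents x.bound x.table (nConf kQ x.contents)

/-- Processing a cell of the input tape. -/
def scanCell (a : InputSymbol α) (x : TableState) : TableState where
  contents := x.contents
  bound := x.bound
  table := newTable kQ a x
  result := if x.result < 3 then x.result
    else tableEntry kQ x.contents (newTable kQ a x) (x.result - 3)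

theorem nControl_pos : 0 < nControl kQ :=
  Nat.mul_pos (by norm_num) ((Nat.zero_le _).trans_lt (kQ.code_lt M.start))

theorem nEntry_pos (P : ℕ) : 0 < nEntry kQ P := Nat.succ_pos _

end

/-! ### Transition tables in linear space -/

/-- The components of a state of the scan. -/
def TableState.tuple (x : TableState) : ℕ × ℕ × ℕ × ℕ :=
  (x.contents, x.bound, x.table, x.result)

instance : Enc TableState := ⟨fun x => enc x.tuple⟩

theorem TableState.linSpace_contents : LinSpace TableState.contents :=
  LinSpace.fst.recode tuple (fun _ => rfl) _ fun _ => rfl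

theorem TableState.linSpace_bound : LinSpace TableState.bound :=
  (LinSpace.fst.comp .snd).recode tuple (fun _ => rfl) _ fun _ => rfl

theorem TableState.linSpace_table : LinSpace TableState.table :=
  (LinSpace.fst.comp (LinSpace.snd.comp .snd)).recode tuple (fun _ => rfl) _ fun _ => rfl

theorem TableState.linSpace_result : LinSpace TableState.result :=
  (LinSpace.snd.comp (LinSpace.snd.comp .snd)).recode tuple (fun _ => rfl) _ fun _ => rfl

theorem TableState.linSpace_mk {β : Type} [Enc β] {p n t r : β → ℕ} (hp : LinSpace p)
    (hn : LinSpace n)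
    (ht : LinSpace t) (hr : LinSpace r) : LinSpace fun x => (⟨p x, n x, t x, r x⟩ : TableState) :=
  (hp.pair (hn.pair (ht.pair hr))).recode id (fun _ => rfl) _ fun _ => rfl

section

variable {α : Type} {M : Machine α Bool} (kQ : Coding M.Q)
variable {β : Type} [Enc β] {p u v : β → ℕ}

theorem linSpace_nConf
    (hp : LinSpace p) : LinSpace fun x => nConf kQ (p x) := (LinSpace.const _).mul hp

theorem linSpace_nEntry (hp : LinSpace p) : LinSpace fun x => nEntry kQ (p x) :=
  (linSpace_nConf kQ hp).add (.const 3)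

theorem linSpace_tableEntry (hp : LinSpace p) (hu : LinSpace u) (hv : LinSpace v) :
    LinSpace fun x => tableEntry kQ (p x) (u x) (v x) := by
  have hrec : ∀ x i, Nat.rec (motive := fun _ => ℕ) (u x)
      (fun _ y => min (y / nEntry kQ (p x)) (u x)) i = u x / nEntry kQ (p x) ^ i := by
    intro x i
    induction i with
    | zero => simp
    | succ i ih =>
      simp only [ih]
      rw [Nat.div_div_eq_div_mul, ← pow_succ, min_eq_left (Nat.div_le_self _ _)]
  have hlin := LinSpace.capRec (f := fun t : β × ℕ × ℕ => t.2.2 / nEntry kQ (p t.1)) hu hv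
    ((LinSpace.snd.comp .snd).div (linSpace_nEntry kQ (hp.comp .fst))) hu
  exact (hlin.mod (linSpace_nEntry kQ hp)).of_eq fun x => by rw [hrec]; rfl

theorem linSpace_rotate (m : Move) (hp : LinSpace p) (hv : LinSpace v) :
    LinSpace fun x => rotate (p x) m (v x) := by
  have htwo : LinSpace fun _ : β => 2 := .const 2
  cases m with
  | left => exact ((htwo.mul hv).mod hp).add ((htwo.mul hv).div hp)
  | stay => exact hv
  | right => exact (hv.div htwo).add ((hv.mod htwo).mul (hp.div htwo))

theorem linSpace_confNextAt (t : Action M.Q Bool) (j : ℕ) (hp : LinSpace p) (hv : LinSpace v) :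
    LinSpace fun x => confNextAt kQ (p x) t j (v x) :=
  ((linSpace_rotate t.workMove hp (((hv.div (.const 2)).mul (.const 2)).add (.const _))).mul
    (.const _)).add (.const _)

theorem linSpace_afterMove (m : Move) (hp : LinSpace p) (hu : LinSpace u) (hv : LinSpace v) :
    LinSpace fun x => afterMove kQ (p x) (u x) m (v x) := by
  have he := linSpace_tableEntry kQ hp hu hv
  cases m with
  | left => exact .ite_lt he (.const 3) he ((linSpace_nEntry kQ hp).add (he.sub (.const 3)))
  | stay => exact (linSpace_nEntry kQ hp).add hv
  | right => exact (LinSpace.const 3).add hv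

theorem linSpace_tableStepAt (a : InputSymbol α) (j g : ℕ) (hp : LinSpace p) (hu : LinSpace u)
    (hv : LinSpace v) : LinSpace fun x => tableStepAt kQ a j g (p x) (u x) (v x) := by
  cases h : M.δ (kQ.decode (j / 3)) a (decide (g = 1)) with
  | none => exact (LinSpace.const (j % 3)).of_eq fun x => by simp [tableStepAt, h]
  | some t =>
    exact (linSpace_afterMove kQ (effMove a t.inputMove) hp hu
      (linSpace_confNextAt kQ t j hp hv)).of_eq fun x => by simp [tableStepAt, h]

theorem linSpace_tableStep (a : InputSymbol α) (hp : LinSpace p) (hu : LinSpace u)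
    (hv : LinSpace v) : LinSpace fun x => tableStep kQ a (p x) (u x) (v x) := by
  have hc : LinSpace fun x => v x - nEntry kQ (p x) := hv.sub (linSpace_nEntry kQ hp)
  have htape : LinSpace fun x => (v x - nEntry kQ (p x)) / nControl kQ := hc.div (.const _)
  refine .ite_lt hv (linSpace_nEntry kQ hp) hv ?_
  refine LinSpace.switch
    (F := fun j x => tableStepAt kQ a j ((v x - nEntry kQ (p x)) / nControl kQ % 2)
      (p x) (u x) ((v x - nEntry kQ (p x)) / nControl kQ)) (hc.mod (.const _))
    (fun _ => Nat.mod_lt _ (nControl_pos kQ)) fun j => ?_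
  exact LinSpace.switch (F := fun g x => tableStepAt kQ a j g
    (p x) (u x) ((v x - nEntry kQ (p x)) / nControl kQ)) (htape.mod (.const 2))
    (fun _ => Nat.mod_lt _ (by norm_num)) fun g => linSpace_tableStepAt kQ a j g hp hu htape

theorem linSpace_newEntry (a : InputSymbol α) (hp : LinSpace p) (hu : LinSpace u)
    (hv : LinSpace v) : LinSpace fun x => newEntry kQ a (p x) (u x) (v x) := by
  have hrun : LinSpace fun x => tableRun kQ a (p x) (u x) (v x) (nConf kQ (p x)) :=
    LinSpace.capRec (f := fun t : β × ℕ × ℕ => tableStep kQ a (p t.1) (u t.1) t.2.2)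
      ((linSpace_nEntry kQ hp).add hv) (linSpace_nConf kQ hp)
      (linSpace_tableStep kQ a (hp.comp .fst) (hu.comp .fst) (LinSpace.snd.comp .snd))
      ((linSpace_nEntry kQ hp).add (linSpace_nConf kQ hp))
  exact .ite_lt hrun (linSpace_nEntry kQ hp) hrun (.const 0)

theorem linSpace_newTable (a : InputSymbol α) : LinSpace (newTable kQ a) := by
  have hp : LinSpace fun t : TableState × ℕ × ℕ => t.1.contents :=
    TableState.linSpace_contents.comp .fst
  exact LinSpace.capRec (f := fun t : TableState × ℕ × ℕ => t.2.2 * nEntry kQ t.1.contents +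
    newEntry kQ a t.1.contents t.1.table (nConf kQ t.1.contents - 1 - t.2.1)) (.const 0)
    (linSpace_nConf kQ TableState.linSpace_contents)
    (((LinSpace.snd.comp .snd).mul (linSpace_nEntry kQ hp)).add (linSpace_newEntry kQ a hp
      (TableState.linSpace_table.comp .fst) (((linSpace_nConf kQ hp).sub (.const 1)).sub
        (LinSpace.fst.comp .snd)))) TableState.linSpace_bound

theorem linSpace_scanCell (a : InputSymbol α) : LinSpace (scanCell kQ a) :=
  TableState.linSpace_mk TableState.linSpace_contents TableState.linSpace_bound
    (linSpace_newTable kQ a)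
    (.ite_lt TableState.linSpace_result (.const 3) TableState.linSpace_result
      (linSpace_tableEntry kQ TableState.linSpace_contents (linSpace_newTable kQ a)
        (TableState.linSpace_result.sub (.const 3))))

end

/-! ### Correctness of transition tables -/

/-- The position of the input head after a move. -/
def headPos : Move → ℕ → ℕ
  | .left, i => i - 1
  | .stay, i => i
  | .right, i => i + 1

section

variable {α : Type} {M : Machine α Bool} (kQ : Coding M.Q)

/-- The computation that starts in configuration `c` on cell `i` halts after `t` steps with
result `b`. -/
def HaltsIn (sym : ℕ → InputSymbol α) (P b : ℕ) : ℕ → ℕ → ℕ → Prop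
  | 0, c, i => confAction kQ (sym i) c = none ∧ c % nControl kQ % 3 = b
  | t + 1, c, i => ∃ A, confAction kQ (sym i) c = some A ∧
      HaltsIn sym P b t (confNext kQ P A c) (headPos (effMove (sym i) A.inputMove) i)

/-- The number `y` is right as a table entry, or as the result of a scan of cell `i`, for a
computation that starts on cell `i` and halts after `t` steps with result `b`. -/
def CorrectEntry (sym : ℕ → InputSymbol α) (P b t i y : ℕ) : Prop :=
  y = b ∨ ∃ c < nConf kQ P, ∃ t' < t, y = 3 + c ∧ sym i ≠ .rightEnd ∧
    HaltsIn kQ sym P b t' c (i + 1)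

/-- The table `T` describes the computations that start on cell `i` until they move on to
cell `i + 1`. -/
def GoodTable (sym : ℕ → InputSymbol α) (P b T i : ℕ) : Prop :=
  ∀ c < nConf kQ P, ∀ t, HaltsIn kQ sym P b t c i →
    CorrectEntry kQ sym P b t i (tableEntry kQ P T c)

/-- The table `T` describes the computations that start on the cell to the left of cell `i`, if
there is one. -/
def GoodLeftTable (sym : ℕ → InputSymbol α) (P b T i : ℕ) : Prop :=
  sym i = .leftEnd ∨ 0 < i ∧ GoodTable kQ sym P b T (i - 1)

/-- The number `y` describes a computation on cell `i` that halts in at most `t` steps. The set `V`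
consists of `n` earlier configurations on the same cell; they are different because their distances
to halting are. -/
def RunningAfter (sym : ℕ → InputSymbol α) (P b t i n y : ℕ) : Prop :=
  ∃ c < nConf kQ P, ∃ t' ≤ t, y = nEntry kQ P + c ∧ HaltsIn kQ sym P b t' c i ∧
    ∃ V ⊆ Finset.range (nConf kQ P), V.card = n ∧ ∀ v ∈ V, ∃ t'' > t', HaltsIn kQ sym P b t'' v i

variable {kQ} {sym : ℕ → InputSymbol α} {P b T t c i : ℕ}

theorem HaltsIn.unique {t' : ℕ} (h : HaltsIn kQ sym P b t c i)
    (h' : HaltsIn kQ sym P b t' c i) : t = t' := by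
  induction t generalizing t' c i with
  | zero =>
    cases t' with
    | zero => rfl
    | succ t' =>
      obtain ⟨A, hA, -⟩ := h'
      cases h.1.symm.trans hA
  | succ t ih =>
    obtain ⟨A, hA, h⟩ := h
    cases t' with
    | zero => cases h'.1.symm.trans hA
    | succ t' =>
      obtain ⟨A', hA', h'⟩ := h'
      cases hA.symm.trans hA'
      rw [ih h h']

theorem confNext_lt (hP : Even P) (A : Action M.Q Bool) (hc : c < nConf kQ P) :
    confNext kQ P A c < nConf kQ P := by
  have htape := rotate_lt hP A.workMove (writeBit_lt hP A.write (Nat.div_lt_of_lt_mul hc))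
  have hlast : (A.print.elim (c % nControl kQ % 3) fun b => 1 + b.toNat) < 3 := by
    cases A.print with
    | none => exact Nat.mod_lt _ (by norm_num)
    | some b => have := Bool.toNat_lt b; simp only [Option.elim]; omega
  have hcontrol : 3 * kQ.code A.state +
      (A.print.elim (c % nControl kQ % 3) fun b => 1 + b.toNat) < nControl kQ := by
    have := kQ.code_lt A.state
    rw [show nControl kQ = 3 * kQ.card from rfl] at hlast ⊢
    omega
  unfold confNext confNextAt
  calc _ < rotate P A.workMove (c / nControl kQ / 2 * 2 + A.write.toNat) * nControl kQ +
      nControl kQ := Nat.add_lt_add_left hcontrol _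
    _ = (rotate P A.workMove (c / nControl kQ / 2 * 2 + A.write.toNat) + 1) * nControl kQ := by
      ring
    _ ≤ P * nControl kQ := Nat.mul_le_mul_right _ htape
    _ = nConf kQ P := Nat.mul_comm _ _

theorem tableStep_of_lt (a : InputSymbol α) {y : ℕ} (hy : y < nEntry kQ P) :
    tableStep kQ a P T y = y :=
  if_pos hy

theorem tableStep_nEntry_add (a : InputSymbol α) : tableStep kQ a P T (nEntry kQ P + c) =
    (confAction kQ a c).elim (c % nControl kQ % 3) fun A =>
      afterMove kQ P T (effMove a A.inputMove) (confNext kQ P A c) := by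
  rw [tableStep, if_neg (by simp)]
  simp only [tableStepAt, Nat.add_sub_cancel_left]
  rfl

theorem afterMove_spec (hb : b < 3) (hT : GoodLeftTable kQ sym P b T i) (A : Action M.Q Bool)
    (hc : c < nConf kQ P)
    (h : HaltsIn kQ sym P b t c (headPos (effMove (sym i) A.inputMove) i)) :
    CorrectEntry kQ sym P b (t + 1) i (afterMove kQ P T (effMove (sym i) A.inputMove) c) ∨
    ∃ c' < nConf kQ P, ∃ t' ≤ t, afterMove kQ P T (effMove (sym i) A.inputMove) c =
      nEntry kQ P + c' ∧ HaltsIn kQ sym P b t' c' i := by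
  cases hmove : effMove (sym i) A.inputMove with
  | stay =>
    rw [hmove] at h
    exact Or.inr ⟨c, hc, t, le_rfl, rfl, h⟩
  | right =>
    rw [hmove] at h
    refine Or.inl (Or.inr ⟨c, hc, t, t.lt_succ_self, rfl, fun hr => ?_, h⟩)
    exact effMove_rightEnd_ne A.inputMove (hr ▸ hmove)
  | left =>
    rw [hmove] at h
    obtain hl | ⟨hi, hT⟩ := hT
    · exact absurd (hl ▸ hmove) (effMove_leftEnd_ne A.inputMove)
    · rcases hT c hc t h with hres | ⟨c', hc', t', ht', hres, -, hh⟩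
      · exact Or.inl (Or.inl (by simp [afterMove, hres, hb]))
      · rw [Nat.sub_add_cancel hi] at hh
        exact Or.inr ⟨c', hc', t', ht'.le, by simp [afterMove, hres], hh⟩

theorem tableStep_spec (hP : Even P) (hb : b < 3) (hT : GoodLeftTable kQ sym P b T i)
    (hc : c < nConf kQ P) (h : HaltsIn kQ sym P b t c i) :
    CorrectEntry kQ sym P b t i (tableStep kQ (sym i) P T (nEntry kQ P + c)) ∨
    ∃ c' < nConf kQ P, ∃ t' < t, tableStep kQ (sym i) P T (nEntry kQ P + c) =
      nEntry kQ P + c' ∧ HaltsIn kQ sym P b t' c' i := by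
  rw [tableStep_nEntry_add]
  cases t with
  | zero =>
    rw [h.1]
    exact Or.inl (Or.inl h.2)
  | succ t =>
    obtain ⟨A, hA, h⟩ := h
    rw [hA]
    simpa only [Option.elim, Nat.lt_succ_iff] using
      afterMove_spec hb hT A (confNext_lt hP A hc) h

theorem CorrectEntry.lt_nEntry {y : ℕ} (hb : b < 3) (h : CorrectEntry kQ sym P b t i y) :
    y < nEntry kQ P := by
  rw [show nEntry kQ P = nConf kQ P + 3 from rfl]
  rcases h with rfl | ⟨c, hc, -, -, rfl, -⟩ <;> omega

theorem CorrectEntry.mono {y t' : ℕ} (ht : t' ≤ t) (h : CorrectEntry kQ sym P b t' i y) :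
    CorrectEntry kQ sym P b t i y :=
  h.imp id fun ⟨c, hc, u, hu, hrest⟩ => ⟨c, hc, u, hu.trans_le ht, hrest⟩

theorem RunningAfter.tableStep {n y : ℕ} (hP : Even P) (hb : b < 3)
    (hT : GoodLeftTable kQ sym P b T i) (h : RunningAfter kQ sym P b t i n y) :
    CorrectEntry kQ sym P b t i (tableStep kQ (sym i) P T y) ∨
      RunningAfter kQ sym P b t i (n + 1) (tableStep kQ (sym i) P T y) := by
  obtain ⟨c, hc, t', ht', rfl, hhalt, V, hV, hcard, hVt⟩ := h
  refine (tableStep_spec hP hb hT hc hhalt).imp (CorrectEntry.mono ht') ?_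
  rintro ⟨d, hd, u, hu, hstep, hhalt'⟩
  refine ⟨d, hd, u, hu.le.trans ht', hstep, hhalt', insert c V,
    Finset.insert_subset (Finset.mem_range.2 hc) hV, ?_, fun v hv => ?_⟩
  · rw [Finset.card_insert_of_notMem, hcard]
    intro hmem
    obtain ⟨t'', ht'', hc''⟩ := hVt c hmem
    exact ht''.ne (hhalt.unique hc'')
  · rcases Finset.mem_insert.1 hv with rfl | hv
    · exact ⟨t', hu, hhalt⟩
    · obtain ⟨t'', ht'', hv'⟩ := hVt v hv
      exact ⟨t'', hu.trans ht'', hv'⟩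

theorem RunningAfter.lt {n y : ℕ} (h : RunningAfter kQ sym P b t i n y) : n < nConf kQ P := by
  obtain ⟨c, hc, t', -, -, hhalt, V, hV, rfl, hVt⟩ := h
  refine (Finset.card_le_card hV).trans_eq (Finset.card_range _) |>.lt_of_ne fun hcard => ?_
  have hVe := Finset.eq_of_subset_of_card_le hV (by rw [hcard, Finset.card_range])
  obtain ⟨t'', ht'', hc'⟩ := hVt c (hVe ▸ Finset.mem_range.2 hc)
  exact ht''.ne (hhalt.unique hc')

theorem tableRun_spec (hP : Even P) (hb : b < 3) (hT : GoodLeftTable kQ sym P b T i)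
    (hc : c < nConf kQ P) (h : HaltsIn kQ sym P b t c i) (n : ℕ) :
    CorrectEntry kQ sym P b t i (tableRun kQ (sym i) P T c n) ∨
      RunningAfter kQ sym P b t i n (tableRun kQ (sym i) P T c n) := by
  induction n with
  | zero => exact Or.inr ⟨c, hc, t, le_rfl, rfl, h, ∅, by simp, rfl, by simp⟩
  | succ n ih =>
    have hnext : CorrectEntry kQ sym P b t i
          (tableStep kQ (sym i) P T (tableRun kQ (sym i) P T c n)) ∨
        RunningAfter kQ sym P b t i (n + 1)
          (tableStep kQ (sym i) P T (tableRun kQ (sym i) P T c n)) := by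
      rcases ih with hdone | hrun
      · left
        rwa [tableStep_of_lt _ (hdone.lt_nEntry hb)]
      · exact hrun.tableStep hP hb hT
    have hle : tableStep kQ (sym i) P T (tableRun kQ (sym i) P T c n) ≤
        nEntry kQ P + nConf kQ P := by
      rcases hnext with hdone | ⟨c', hc', -, -, hy, -⟩
      · exact (hdone.lt_nEntry hb).le.trans (Nat.le_add_right _ _)
      · omega
    have hsucc : tableRun kQ (sym i) P T c (n + 1) =
        tableStep kQ (sym i) P T (tableRun kQ (sym i) P T c n) := min_eq_left hle
    rwa [hsucc]

theorem newEntry_spec (hP : Even P) (hb : b < 3) (hT : GoodLeftTable kQ sym P b T i)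
    (hc : c < nConf kQ P) (h : HaltsIn kQ sym P b t c i) :
    CorrectEntry kQ sym P b t i (newEntry kQ (sym i) P T c) := by
  have hdone := (tableRun_spec hP hb hT hc h (nConf kQ P)).resolve_right fun hrun =>
    lt_irrefl _ hrun.lt
  rwa [newEntry, if_pos (hdone.lt_nEntry hb)]

theorem newEntry_lt (a : InputSymbol α) (P T c : ℕ) : newEntry kQ a P T c < nEntry kQ P := by
  unfold newEntry
  split_ifs with h
  · exact h
  · exact nEntry_pos kQ P

theorem hasDigits_tableBuild (a : InputSymbol α) {n N : ℕ} (T : ℕ)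
    (hN : nEntry kQ P ^ nConf kQ P ≤ N) (hn : n ≤ nConf kQ P) :
    HasDigits (nEntry kQ P) (tableBuild kQ a P N T n) fun k =>
      if k < n then newEntry kQ a P T (nConf kQ P - n + k) else 0 := by
  induction n with
  | zero => exact fun k => by simp [tableBuild]
  | succ n ih =>
    have hdigits : HasDigits (nEntry kQ P) (tableBuild kQ a P N T n * nEntry kQ P +
        newEntry kQ a P T (nConf kQ P - 1 - n)) fun k =>
          if k < n + 1 then newEntry kQ a P T (nConf kQ P - (n + 1) + k) else 0 := by
      refine ((ih (by omega)).congr fun k => ?_).push (newEntry_lt a _ _ _) ?_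
      · rw [show nConf kQ P - (n + 1) + (k + 1) = nConf kQ P - n + k by omega]
        simp only [Nat.add_lt_add_iff_right]
      · rw [if_pos n.succ_pos, Nat.add_zero, Nat.sub_sub, Nat.add_comm 1]
    have hG : 1 < nEntry kQ P := Nat.succ_lt_succ (Nat.succ_pos _)
    have hlt := hdigits.lt_pow (S := n + 1) hG fun k hk => if_neg hk.not_gt
    have hle : nEntry kQ P ^ (n + 1) ≤ N :=
      (Nat.pow_le_pow_right (nEntry_pos kQ P) hn).trans hN
    have hsucc : tableBuild kQ a P N T (n + 1) = tableBuild kQ a P N T n * nEntry kQ P +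
        newEntry kQ a P T (nConf kQ P - 1 - n) := min_eq_left (hlt.le.trans hle)
    rwa [hsucc]

theorem tableEntry_newTable (a : InputSymbol α) {x : TableState}
    (hN : nEntry kQ x.contents ^ nConf kQ x.contents ≤ x.bound) (hc : c < nConf kQ x.contents) :
    tableEntry kQ x.contents (newTable kQ a x) c = newEntry kQ a x.contents x.table c := by
  have hdigit := hasDigits_tableBuild a x.table hN le_rfl c
  simp only [if_pos hc, Nat.sub_self, Nat.zero_add] at hdigit
  exact hdigit

theorem goodTable_newTable {x : TableState} (hP : Even x.contents)
    (hN : nEntry kQ x.contents ^ nConf kQ x.contents ≤ x.bound) (hb : b < 3)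
    (hT : GoodLeftTable kQ sym x.contents b x.table i) :
    GoodTable kQ sym x.contents b (newTable kQ (sym i) x) i := fun c hc t h => by
  rw [tableEntry_newTable _ hN hc]
  exact newEntry_spec hP hb hT hc h

theorem result_scanCell_spec {x : TableState} (hb : b < 3)
    (hT : GoodTable kQ sym x.contents b (newTable kQ (sym i) x) i)
    (hD : x.result = b ∨ ∃ c < nConf kQ x.contents, ∃ t, x.result = 3 + c ∧
      HaltsIn kQ sym x.contents b t c i) :
    ∃ t, CorrectEntry kQ sym x.contents b t i (scanCell kQ (sym i) x).result := by
  simp only [scanCell]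
  rcases hD with hD | ⟨c, hc, t, hD, h⟩
  · exact ⟨0, Or.inl (by rw [hD, if_pos hb])⟩
  · rw [hD, if_neg (by omega), Nat.add_sub_cancel_left]
    exact ⟨t, hT c hc t h⟩

theorem table_scanCell_le (a : InputSymbol α) (x : TableState) :
    (scanCell kQ a x).table ≤ x.bound := by
  simp only [scanCell, newTable]
  cases nConf kQ x.contents with
  | zero => exact Nat.zero_le _
  | succ n => exact min_le_right _ _

theorem result_scanCell_le (a : InputSymbol α) {x : TableState}
    (hN : nEntry kQ x.contents ≤ x.bound) : (scanCell kQ a x).result ≤ x.bound := by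
  simp only [scanCell]
  split_ifs with h
  · rw [show nEntry kQ x.contents = nConf kQ x.contents + 3 from rfl] at hN
    omega
  · exact (Nat.mod_lt _ (nEntry_pos kQ _)).le.trans hN

end

/-! ### Computations on a cyclic work tape -/

theorem testBit_write (v k : ℕ) (b : Bool) :
    (v / 2 * 2 + b.toNat).testBit k = if k = 0 then b else v.testBit k := by
  rw [Nat.mul_comm, ← pow_one 2,
    Nat.testBit_two_pow_mul_add _ (by rw [pow_one]; exact Bool.toNat_lt b)]
  cases k with
  | zero => cases b <;> rfl
  | succ k => simp [Nat.testBit_succ]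

theorem testBit_rotate_right {n v : ℕ} (hv : v < 2 ^ (n + 1)) (k : ℕ) :
    (rotate (2 ^ (n + 1)) .right v).testBit k =
      if k < n then v.testBit (k + 1) else (v % 2).testBit (k - n) := by
  have hhalf : v / 2 < 2 ^ n := by
    rw [pow_succ] at hv
    omega
  rw [rotate, pow_succ, Nat.mul_div_cancel _ two_pos, Nat.add_comm, Nat.mul_comm,
    Nat.testBit_two_pow_mul_add _ hhalf, Nat.testBit_succ]

theorem testBit_rotate_left {n v k : ℕ} (hv : v < 2 ^ (n + 1)) (hk : k ≤ n) :
    (rotate (2 ^ (n + 1)) .left v).testBit k =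
      if k = 0 then v.testBit n else v.testBit (k - 1) := by
  have hlow : 2 * v % 2 ^ (n + 1) = 2 ^ 1 * (v % 2 ^ n) := by
    rw [pow_succ', Nat.mul_mod_mul_left, pow_one]
  have hhigh : 2 * v / 2 ^ (n + 1) = v / 2 ^ n := by
    rw [pow_succ', Nat.mul_div_mul_left _ _ two_pos]
  have hlt : v / 2 ^ n < 2 ^ 1 := by
    rwa [Nat.div_lt_iff_lt_mul (by positivity), ← pow_add, Nat.add_comm]
  rw [rotate, hlow, hhigh, Nat.testBit_two_pow_mul_add _ hlt]
  cases k with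
  | zero => rw [if_pos rfl, Nat.testBit_div_two_pow, Nat.zero_add, if_pos one_pos]
  | succ k => simp [Nat.testBit_mod_two_pow, Nat.lt_of_succ_le hk]

/-- The bits of `v` are the contents `f` of the window of `m + 1` cells that starts at `lo`, listed
cyclically from the cell `z`. -/
structure CycTape (m : ℕ) (lo : ℤ) (f : ℤ → Bool) (z : ℤ) (v : ℕ) : Prop where
  lt : v < 2 ^ (m + 1)
  bits : ∀ k ≤ m, v.testBit k = f (if z + k ≤ lo + m then z + k else z + k - (m + 1))

section

variable {m v : ℕ} {lo z : ℤ} {f : ℤ → Bool}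

theorem CycTape.mod_two (h : CycTape m lo f z v) (hz : z ≤ lo + m) :
    decide (v % 2 = 1) = f z := by
  have hbit := h.bits 0 (Nat.zero_le m)
  rwa [Nat.cast_zero, add_zero, if_pos hz, Nat.testBit_zero] at hbit

theorem CycTape.write (h : CycTape m lo f z v) (hz : z ∈ Set.Icc lo (lo + m)) (b : Bool) :
    CycTape m lo (Function.update f z b) z (v / 2 * 2 + b.toNat) := by
  obtain ⟨_, _⟩ := hz
  refine ⟨writeBit_lt (Nat.even_pow.2 ⟨even_two, m.succ_ne_zero⟩) b h.lt, fun k hk => ?_⟩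
  rw [testBit_write]
  split_ifs with hk₀ hle hle
  · rw [hk₀, Nat.cast_zero, add_zero, Function.update_self]
  · omega
  · rw [h.bits k hk, if_pos hle, Function.update_of_ne (by omega)]
  · rw [h.bits k hk, if_neg hle, Function.update_of_ne (by omega)]

theorem CycTape.rotate_right (h : CycTape m lo f z v) (hlo : lo ≤ z) (hz : z + 1 ≤ lo + m) :
    CycTape m lo f (z + 1) (rotate (2 ^ (m + 1)) .right v) := by
  refine ⟨rotate_lt (Nat.even_pow.2 ⟨even_two, m.succ_ne_zero⟩) _ h.lt, fun k hk => ?_⟩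
  rw [testBit_rotate_right h.lt]
  split_ifs with hkm hle hle
  · rw [h.bits _ hkm, if_pos (by push_cast; omega)]
    exact congrArg f (by push_cast; ring)
  · rw [h.bits _ hkm, if_neg (by push_cast; omega)]
    exact congrArg f (by push_cast; ring)
  · omega
  · obtain rfl : k = m := by omega
    rw [Nat.sub_self, Nat.testBit_zero, Nat.mod_mod, h.mod_two (by omega)]
    exact congrArg f (by ring)

theorem CycTape.rotate_left (h : CycTape m lo f z v) (hlo : lo ≤ z - 1) (hz : z ≤ lo + m) :
    CycTape m lo f (z - 1) (rotate (2 ^ (m + 1)) .left v) := by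
  refine ⟨rotate_lt (Nat.even_pow.2 ⟨even_two, m.succ_ne_zero⟩) _ h.lt, fun k hk => ?_⟩
  rw [testBit_rotate_left h.lt hk]
  cases k with
  | zero =>
    rw [if_pos rfl, h.bits m le_rfl, if_neg (by omega), if_pos (by push_cast; omega)]
    exact congrArg f (by push_cast; ring)
  | succ k =>
    rw [if_neg k.succ_ne_zero, Nat.add_sub_cancel, h.bits k (by omega)]
    refine congrArg f ?_
    push_cast
    split_ifs <;> omega

theorem CycTape.rotate (h : CycTape m lo f z v) (hz : z ∈ Set.Icc lo (lo + m)) {mv : Move}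
    (hz' : mv.onWork z ∈ Set.Icc lo (lo + m)) :
    CycTape m lo f (mv.onWork z) (rotate (2 ^ (m + 1)) mv v) := by
  cases mv with
  | left => exact h.rotate_left hz'.1 hz.2
  | stay => exact h
  | right => exact h.rotate_right hz.1 hz'.2

end

/-- The last printed bit: `0` if nothing has been printed, `1` for `false`, `2` for `true`. -/
def lastBit (l : List Bool) : ℕ := l.getLast?.elim 0 fun b => 1 + b.toNat

theorem lastBit_lt (l : List Bool) : lastBit l < 3 := by
  unfold lastBit
  cases l.getLast? with
  | none => exact three_pos
  | some b => exact Nat.add_lt_add_left (Bool.toNat_lt b) 1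

theorem lastBit_append (l : List Bool) (p : Option Bool) :
    lastBit (l ++ p.toList) = p.elim (lastBit l) fun b => 1 + b.toNat := by
  cases p <;> simp [lastBit]

theorem onInput_plainTape {α : Type} (w : List α) {p : ℕ} (hp : p ≤ w.length + 1) (m : Move) :
    m.onInput (plainTape w).length p =
      headPos (effMove ((plainTape w).getD p .rightEnd) m) p := by
  rw [getD_plainTape, length_plainTape]
  split_ifs with hp₀
  · subst hp₀
    cases m <;> simp [Move.onInput, headPos, effMove]
  · rcases Nat.lt_or_ge (p - 1) w.length with hlt | hge
    · rw [List.getElem?_eq_getElem hlt]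
      cases m
      case right => exact min_eq_left (by omega)
      all_goals rfl
    · rw [List.getElem?_eq_none hge]
      cases m
      case right => exact (min_eq_right (by omega)).trans (by change w.length + 1 = p; omega)
      all_goals rfl

section

variable {α : Type} {M : Machine α Bool} {kQ : Coding M.Q} {m : ℕ} {lo : ℤ}

/-- The number `d` represents the configuration `c` on a cyclic work tape of `m + 1` cells, as in
`nConf`. -/
structure CycRep (kQ : Coding M.Q) (m : ℕ) (lo : ℤ) (c : Config M.Q Bool) (d : ℕ) : Prop where
  tape : CycTape m lo c.work c.workPos (d / nControl kQ)
  control : d % nControl kQ = 3 * kQ.code c.state + lastBit c.output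

theorem code_lastBit_lt_nControl (q : M.Q) (l : List Bool) :
    3 * kQ.code q + lastBit l < nControl kQ := by
  have hcode := kQ.code_lt q
  have hbit := lastBit_lt l
  unfold nControl
  omega

theorem CycRep.init : CycRep kQ m lo M.init (3 * kQ.code M.start) := by
  have h : 3 * kQ.code M.start < nControl kQ := code_lastBit_lt_nControl M.start []
  refine ⟨⟨?_, fun k _ => ?_⟩, Nat.mod_eq_of_lt h⟩
  · rw [Nat.div_eq_of_lt h]
    positivity
  · rw [Nat.div_eq_of_lt h, Nat.zero_testBit]
    rfl

theorem CycRep.action_eq {c : Config M.Q Bool} {d : ℕ} (h : CycRep kQ m lo c d)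
    (hz : c.workPos ≤ lo + m) (a : InputSymbol α) :
    confAction kQ a d = M.δ c.state a (c.work c.workPos) := by
  rw [confAction, h.tape.mod_two hz, h.control, Nat.mul_add_div three_pos,
    Nat.div_eq_of_lt (lastBit_lt _), Nat.add_zero, kQ.decode_code]

theorem CycRep.next {c : Config M.Q Bool} {d : ℕ} (h : CycRep kQ m lo c d)
    (hz : c.workPos ∈ Set.Icc lo (lo + m)) (A : Action M.Q Bool) (p : ℕ)
    (hz' : A.workMove.onWork c.workPos ∈ Set.Icc lo (lo + m)) :
    CycRep kQ m lo ⟨A.state, p, Function.update c.work c.workPos A.write,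
      A.workMove.onWork c.workPos, c.output ++ A.print.toList⟩
      (confNext kQ (2 ^ (m + 1)) A d) := by
  have hcontrol : d % nControl kQ % 3 = lastBit c.output := by
    rw [h.control, Nat.mul_add_mod, Nat.mod_eq_of_lt (lastBit_lt _)]
  have hlt := code_lastBit_lt_nControl (kQ := kQ) A.state (c.output ++ A.print.toList)
  have hnext : confNext kQ (2 ^ (m + 1)) A d = nControl kQ *
      rotate (2 ^ (m + 1)) A.workMove (d / nControl kQ / 2 * 2 + A.write.toNat) +
        (3 * kQ.code A.state + lastBit (c.output ++ A.print.toList)) := by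
    rw [confNext, confNextAt, hcontrol, lastBit_append, Nat.mul_comm]
  constructor
  · rw [hnext, Nat.mul_add_div (by omega), Nat.div_eq_of_lt hlt, Nat.add_zero]
    exact (h.tape.write hz A.write).rotate hz hz'
  · rw [hnext, Nat.mul_add_mod, Nat.mod_eq_of_lt hlt]

theorem IsRun.haltsIn {w : List α} {c : ℕ → Config M.Q Bool} {T : ℕ}
    (hc : IsRun M (plainTape w) c T) (hz : ∀ i ≤ T, (c i).workPos ∈ Set.Icc lo (lo + m))
    {i : ℕ} (hi : i ≤ T) {d : ℕ} (hd : CycRep kQ m lo (c i) d) :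
    HaltsIn kQ (fun p => (plainTape w).getD p .rightEnd) (2 ^ (m + 1))
      (lastBit (c T).output) (T - i) d (c i).inputPos := by
  induction hi using Nat.decreasingInduction generalizing d with
  | self =>
    rw [Nat.sub_self]
    constructor
    · rw [hd.action_eq (hz T le_rfl).2]
      exact Option.map_eq_none_iff.1 hc.halt
    · rw [hd.control, Nat.mul_add_mod, Nat.mod_eq_of_lt (lastBit_lt _)]
  | of_succ i hi ih =>
    rw [show T - i = T - (i + 1) + 1 by omega]
    obtain ⟨A, hA, hsucc⟩ := Option.map_eq_some_iff.1 (hc.step i hi)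
    refine ⟨A, (hd.action_eq (hz i hi.le).2 _).trans hA, ?_⟩
    have hpos := hc.inputPos_le hi.le
    rw [length_plainTape] at hpos
    have hz' := hz (i + 1) hi
    rw [← hsucc] at hz'
    have hnext := hd.next (hz i hi.le) A
      (A.inputMove.onInput (plainTape w).length (c i).inputPos) hz'
    rw [hsucc] at hnext
    have hhalts := ih hnext
    rwa [← hsucc, onInput_plainTape w (by omega)] at hhalts

theorem exists_haltsIn {w : List α} {b : Bool} (h : M.Outputs (plainTape w) [b])
    (hm : (M.usedCells (plainTape w)).encard ≤ (m + 1 : ℕ)) :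
    ∃ t, HaltsIn kQ (fun p => (plainTape w).getD p .rightEnd) (2 ^ (m + 1)) (1 + b.toNat) t
      (3 * kQ.code M.start) 0 := by
  obtain ⟨c, T, hc, hb⟩ := h.exists_isRun
  obtain ⟨lo, hlo⟩ := hc.exists_workPos_mem_Ico hm
  have hz : ∀ i ≤ T, (c i).workPos ∈ Set.Icc lo (lo + m) := fun i hi => by
    have hmem := hlo i hi
    rw [Set.mem_Ico, Nat.cast_succ] at hmem
    exact ⟨hmem.1, by omega⟩
  have hinit : CycRep kQ m lo (c 0) (3 * kQ.code M.start) := by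
    rw [hc.zero]
    exact .init
  have hhalts := hc.haltsIn hz (Nat.zero_le T) hinit
  rw [hb, hc.zero] at hhalts
  exact ⟨_, hhalts⟩

end

/-! ### Programs with polynomially bounded registers -/

/-- The registers when only register `0` is in use. -/
def single (v : ℕ) : ℕ → ℕ := frame (fun _ => 0) 0 [v]

/-- Some program takes `src i` to `dst i` in register `0`, uniformly in `i` and in the input tape,
with registers that are bounded by a polynomial in `S i`. -/
def PolyRun {ι : Type} (S src dst : ι → ℕ) : Prop :=
  ∃ (p : (γ : Type) → Prog γ) (u : ι → ℕ), PolyLe S u ∧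
    ∀ (γ : Type) (tape : List (InputSymbol γ)) (B : ℕ) (i : ι), u i ≤ B →
      RegRun tape B (p γ) (single (src i)) (single (dst i))

section

variable {ι κ : Type} {S : ι → ℕ}

theorem PolyRun.trans {u v w : ι → ℕ} (h : PolyRun S u v) (h' : PolyRun S v w) :
    PolyRun S u w := by
  obtain ⟨p, a, ha, hp⟩ := h
  obtain ⟨q, b, hb, hq⟩ := h'
  exact ⟨fun γ => .seq (p γ) (q γ), _, ha.add hb, fun γ tape B i hB =>
    (hp γ tape B i ((Nat.le_add_right _ _).trans hB)).seq
      (hq γ tape B i ((Nat.le_add_left _ _).trans hB))⟩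

theorem PolyRun.comp {src dst : ι → ℕ} (h : PolyRun S src dst) {T : κ → ℕ} {g : κ → ι}
    (hg : PolyLe T fun k => S (g k)) : PolyRun T (fun k => src (g k)) fun k => dst (g k) := by
  obtain ⟨p, u, hu, hp⟩ := h
  exact ⟨p, _, hu.comp hg, fun γ tape B k => hp γ tape B (g k)⟩

variable {α : Type} [Enc α]

theorem LinSpace.polyRun {β : Type} [Enc β] {f : α → β} (hf : LinSpace f) {x : ι → α}
    (hx : PolyLe S fun i => enc (x i)) :
    PolyRun S (fun i => enc (x i)) fun i => enc (f (x i)) := by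
  obtain ⟨p, u, hu, hp⟩ := hf
  exact ⟨fun γ => p γ 0, _, hu.comp hx, fun γ tape B i => hp γ tape B 0 _ (x i)⟩

theorem LinSpace.polyRun_while {f : α → α} {t : α → ℕ} (hf : LinSpace f)
    (ht : LinSpace t) {x : ι → ℕ → α}
    {n : ι → ℕ} (hx : ∀ i, ∀ j < n i, x i (j + 1) = f (x i j))
    (hpos : ∀ i, ∀ j < n i, t (x i j) ≠ 0) (hzero : ∀ i, t (x i (n i)) = 0) {X : ι → ℕ}
    (hX : PolyLe S X) (hle : ∀ i, ∀ j ≤ n i, enc (x i j) ≤ X i) :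
    PolyRun S (fun i => enc (x i 0)) fun i => enc (x i (n i)) := by
  obtain ⟨p, u, hu, hp⟩ := LinSpace.exists_while hf ht
  obtain ⟨v, hv, huv⟩ := hu.exists_bound hX
  exact ⟨fun γ => p γ 0, v, hv, fun γ tape B i hB =>
    hp γ tape B 0 _ (x i) (n i) (hx i) (hpos i) (hzero i) fun j hj =>
      (huv i _ (hle i j hj)).trans hB⟩

end

theorem polyRun_pow {ι : Type} {S k b : ι → ℕ} (hb : ∀ i, 0 < b i) (hk : PolyLe S k)
    (hbS : PolyLe S b) (hpow : PolyLe S fun i => b i ^ k i) :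
    PolyRun S (fun i => enc (k i, b i, 1)) fun i => enc (0, b i, b i ^ k i) := by
  have hfst : LinSpace fun x : ℕ × ℕ × ℕ => x.1 := .fst
  have hbase : LinSpace fun x : ℕ × ℕ × ℕ => x.2.1 := LinSpace.fst.comp .snd
  have hacc : LinSpace fun x : ℕ × ℕ × ℕ => x.2.2 := LinSpace.snd.comp .snd
  have hrun := (hfst.pred.pair (hbase.pair (hacc.mul hbase))).polyRun_while hfst
    (x := fun i j => (k i - j, b i, b i ^ j)) (n := k) (fun i j _ => by rw [pow_succ]; rfl)
    (fun i j hj => (Nat.sub_pos_of_lt hj).ne') (fun i => Nat.sub_self (k i))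
    (hk.cpair (hbS.cpair hpow)) fun i j hj =>
      cpair_mono (Nat.sub_le _ _) (cpair_mono le_rfl (Nat.pow_le_pow_right (hb i) hj))
  simpa only [pow_zero, Nat.sub_zero, Nat.sub_self] using hrun

/-- The code of the simulation state all of whose entries are `Y`. -/
def simBound (Y : ℕ) : ℕ := enc (⟨Y, Y, Y, (Y, Y), Y⟩ : SimState)

theorem PolyLe.simBound {ι : Type} {S u : ι → ℕ} (hu : PolyLe S u) :
    PolyLe S fun i => simBound (u i) :=
  hu.cpair (hu.cpair (hu.cpair ((hu.cpair hu).cpair hu)))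

section

variable {Γ : Type} [Inhabited Γ]

theorem IsRun.enc_iterate_simStep_le {M : Machine Unit Γ} {kQ : Coding M.Q} {kΓ : Coding Γ}
    (hk : kΓ.code default = 0) {n T S Y : ℕ} {c : ℕ → Config M.Q Γ}
    (hc : IsRun M (unaryTape n) c T) (hS : (M.usedCells (unaryTape n)).encard ≤ S)
    (hY : n + (kΓ.card + 1) ^ S + bitVal (c T).output + (kQ.card + 1) ≤ Y) {j : ℕ} (hj : j ≤ T) :
    enc ((simStep kQ kΓ)^[j] (simInit kQ n)) ≤ simBound Y := by
  obtain ⟨hlen, hstate, hpos, hleft, hright, hres⟩ := hc.simRep_le hk hS hj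
    (hc.simRep (kQ := kQ) hk hj)
  have hpow : (kΓ.card + 1) ^ S ≤ Y := by omega
  have hres : _ ≤ Y := hres.trans (by omega)
  have hlen : _ ≤ Y := hlen.trans_le (by omega)
  have hstate : _ ≤ Y := hstate.le.trans (by omega)
  have hpos : _ ≤ Y := hpos.trans (by omega)
  exact cpair_mono hlen (cpair_mono hstate (cpair_mono hpos
    (cpair_mono (cpair_mono (hleft.le.trans hpow) (hright.le.trans hpow)) hres)))

theorem Machine.ComputesInSpace.exists_isRun {M : Machine Unit Γ} {f s : ℕ → ℕ}
    (h : M.ComputesInSpace plainTape (fun w => binary (f w.length)) s) (n : ℕ) :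
    (∃ c T, IsRun M (unaryTape n) c T ∧ bitVal (c T).output = f n) ∧
      (M.usedCells (unaryTape n)).encard ≤ s n := by
  obtain ⟨hout, hspace⟩ := h (List.replicate n ())
  simp only [List.length_replicate] at hout hspace
  obtain ⟨c, T, hc, hcout⟩ := hout.exists_isRun
  exact ⟨⟨c, T, hc, by rw [hcout, bitVal_binary]⟩, hspace⟩

theorem polyRun_of_computesInSpace [Finite Γ] {M : Machine Unit Γ} {f s : ℕ → ℕ}
    (hM : M.ComputesInSpace plainTape (fun w => binary (f w.length)) s) :
    ∃ g, PolyRun (fun n => n + g ^ s n + f n) (fun n => n) f := by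
  have := M.finite_Q
  obtain ⟨kQ, -⟩ := exists_coding M.start
  obtain ⟨kΓ, hk⟩ := exists_coding (default : Γ)
  choose hrun hspace using hM.exists_isRun
  choose c T hc hout using hrun
  have hrep := fun n {j} (hj : j ≤ T n) => (hc n).simRep (kQ := kQ) hk hj
  set S : ℕ → ℕ := fun n => n + (kΓ.card + 1) ^ s n + f n with hS
  have hX : PolyLe S fun n => simBound (S n + (kQ.card + 1)) :=
    (PolyLe.self.add (.const _)).simBound
  have hle : ∀ n, ∀ j ≤ T n, enc ((simStep kQ kΓ)^[j] (simInit kQ n)) ≤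
      simBound (S n + (kQ.card + 1)) := fun n j hj =>
    (hc n).enc_iterate_simStep_le hk (hspace n) (by rw [hout]) hj
  have hinit : LinSpace (simInit kQ) :=
    SimState.linSpace_mk .id (.const _) (.const 0) ((LinSpace.const 0).pair (.const 0)) (.const 0)
  have hsetup := hinit.polyRun (S := S) (x := fun n => n)
    (PolyLe.self.mono fun n => by simp only [hS, enc_nat]; omega)
  have hsim := (linSpace_simStep kQ kΓ).polyRun_while (linSpace_simRunning kQ kΓ)
    (x := fun n j => (simStep kQ kΓ)^[j] (simInit kQ n)) (n := T)
    (fun n j _ => Function.iterate_succ_apply' _ _ _)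
    (fun n j hj => (hrep n hj.le).running_of_some ((hc n).step j hj))
    (fun n => (hrep n le_rfl).running_of_none (hc n).halt) hX hle
  have hread := SimState.linSpace_out.polyRun (hX.mono fun n => hle n (T n) le_rfl)
  have hres : ∀ n, ((simStep kQ kΓ)^[T n] (simInit kQ n)).out = f n := fun n =>
    (hrep n le_rfl).out.trans (hout n)
  simp only [hres] at hread
  exact ⟨kΓ.card + 1, (hsetup.trans hsim).trans hread⟩

end

/-! ### Processing the cells of the input tape -/

section

variable {α : Type} {M : Machine α Bool} (kQ : Coding M.Q)

/-- A bound for the transition tables of computations in `m` cells: the number of functions from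
configurations to table entries. -/
def tableBound (m : ℕ) : ℕ := nEntry kQ (2 ^ m) ^ nConf kQ (2 ^ m)

/-- The data from which the scan of the input tape starts, for computations in `m` cells. -/
def tableInit (m : ℕ) : TableState where
  contents := 2 ^ m
  bound := tableBound kQ m
  table := 0
  result := 3 + 3 * kQ.code M.start

/-- The data after `i` cells of the input tape have been processed. -/
def scanState (w : List α) (m : ℕ) : ℕ → TableState
  | 0 => tableInit kQ m
  | i + 1 => scanCell kQ ((plainTape w).getD i .rightEnd) (scanState w m i)

theorem nConf_le_nEntry (P : ℕ) : nConf kQ P ≤ nEntry kQ P := Nat.le_add_right _ _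

theorem le_nConf (P : ℕ) : P ≤ nConf kQ P := Nat.le_mul_of_pos_left P (nControl_pos kQ)

theorem nEntry_le_tableBound (m : ℕ) : nEntry kQ (2 ^ m) ≤ tableBound kQ m :=
  Nat.le_self_pow ((Nat.two_pow_pos m).trans_le (le_nConf kQ _)).ne' _

theorem two_pow_le_tableBound (m : ℕ) : 2 ^ m ≤ tableBound kQ m :=
  ((le_nConf kQ _).trans (nConf_le_nEntry kQ _)).trans (nEntry_le_tableBound kQ m)

theorem startCode_lt_nConf {P : ℕ} (hP : 0 < P) : 3 * kQ.code M.start < nConf kQ P :=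
  (Nat.mul_lt_mul_of_pos_left (kQ.code_lt _) three_pos).trans_le (Nat.le_mul_of_pos_right _ hP)

theorem polyRun_tableInit :
    PolyRun (tableBound kQ) (fun m => m) fun m => enc (tableInit kQ m) := by
  have hbase : LinSpace fun x : ℕ × ℕ × ℕ => x.2.1 := LinSpace.fst.comp .snd
  have hacc : LinSpace fun x : ℕ × ℕ × ℕ => x.2.2 := LinSpace.snd.comp .snd
  have hE : PolyLe (tableBound kQ) fun m => nEntry kQ (2 ^ m) :=
    PolyLe.self.mono (nEntry_le_tableBound kQ)
  have hC : PolyLe (tableBound kQ) fun m => nConf kQ (2 ^ m) :=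
    hE.mono fun m => nConf_le_nEntry kQ _
  have hP : PolyLe (tableBound kQ) fun m => 2 ^ m := PolyLe.self.mono (two_pow_le_tableBound kQ)
  have hm : PolyLe (tableBound kQ) fun m => m := hP.mono fun m => Nat.lt_two_pow_self.le
  have hstart := (LinSpace.id.pair ((LinSpace.const 2).pair (.const 1))).polyRun
    (x := fun m => m) hm
  have hpow := polyRun_pow (b := fun _ => 2) (fun _ => two_pos) hm (.const 2) hP
  have hsizes := ((linSpace_nConf kQ hacc).pair ((linSpace_nEntry kQ hacc).pair (.const 1))).polyRun
    (x := fun m => (0, 2, 2 ^ m)) ((PolyLe.const 0).cpair ((PolyLe.const 2).cpair hP))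
  have hbound := polyRun_pow (fun m => nEntry_pos kQ (2 ^ m)) hC hE .self
  have hfinal := (TableState.linSpace_mk ((hbase.sub (.const 3)).div (.const (nControl kQ))) hacc
    (.const 0) (.const (3 + 3 * kQ.code M.start))).polyRun
    (x := fun m => (0, nEntry kQ (2 ^ m), tableBound kQ m))
    ((PolyLe.const 0).cpair (hE.cpair .self))
  have hcontents : ∀ m, (nEntry kQ (2 ^ m) - 3) / nControl kQ = 2 ^ m := fun m =>
    Nat.mul_div_cancel_left _ (nControl_pos kQ)
  simp only [hcontents] at hfinal
  exact (((hstart.trans hpow).trans hsizes).trans hbound).trans hfinal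

variable (w : List α) (m : ℕ)

theorem contents_scanState (i : ℕ) : (scanState kQ w m i).contents = 2 ^ m := by
  induction i with
  | zero => rfl
  | succ _ ih => exact ih

theorem bound_scanState (i : ℕ) : (scanState kQ w m i).bound = tableBound kQ m := by
  induction i with
  | zero => rfl
  | succ _ ih => exact ih

theorem table_scanState_le (i : ℕ) : (scanState kQ w m i).table ≤ tableBound kQ m := by
  cases i with
  | zero => exact Nat.zero_le _
  | succ i => exact (table_scanCell_le _ _).trans_eq (bound_scanState kQ w m i)

theorem result_scanState_le (i : ℕ) : (scanState kQ w m i).result ≤ tableBound kQ m := by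
  have hN := nEntry_le_tableBound kQ m
  cases i with
  | zero =>
    have hstart := startCode_lt_nConf kQ (Nat.two_pow_pos m)
    refine le_trans ?_ hN
    simp only [scanState, tableInit, nEntry]
    omega
  | succ i =>
    refine (result_scanCell_le _ ?_).trans_eq (bound_scanState kQ w m i)
    rwa [contents_scanState, bound_scanState]

theorem enc_scanState_le (i : ℕ) : enc (scanState kQ w m i) ≤
    cpair (tableBound kQ m) (cpair (tableBound kQ m) (cpair (tableBound kQ m) (tableBound kQ m))) :=
  cpair_mono ((contents_scanState kQ w m i).trans_le (two_pow_le_tableBound kQ m))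
    (cpair_mono (bound_scanState kQ w m i).le
      (cpair_mono (table_scanState_le kQ w m i) (result_scanState_le kQ w m i)))

end

section

variable {α : Type} {M : Machine α Bool} {kQ : Coding M.Q}

/-- The data `x` are right when cell `i` is about to be processed, for a computation with
result `b`. -/
structure GoodState (kQ : Coding M.Q) (sym : ℕ → InputSymbol α) (b i : ℕ) (x : TableState) :
    Prop where
  table : GoodLeftTable kQ sym x.contents b x.table i
  result : x.result = b ∨ ∃ c < nConf kQ x.contents, ∃ t, x.result = 3 + c ∧
    HaltsIn kQ sym x.contents b t c i

theorem GoodState.scanCell {sym : ℕ → InputSymbol α} {b i : ℕ} {x : TableState}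
    (h : GoodState kQ sym b i x) (hP : Even x.contents)
    (hN : nEntry kQ x.contents ^ nConf kQ x.contents ≤ x.bound) (hb : b < 3) :
    GoodState kQ sym b (i + 1) (scanCell kQ (sym i) x) ∧
      (sym i = .rightEnd → (scanCell kQ (sym i) x).result = b) := by
  have htable := goodTable_newTable hP hN hb h.table
  obtain ⟨t, hresult⟩ := result_scanCell_spec hb htable h.result
  refine ⟨⟨Or.inr ⟨i.succ_pos, htable⟩, hresult.imp_right ?_⟩, fun hend => ?_⟩
  · rintro ⟨c, hc, t', -, hy, -, hhalts⟩
    exact ⟨c, hc, t', hy, hhalts⟩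
  · exact hresult.resolve_right fun ⟨_, _, _, _, _, hne, _⟩ => hne hend

variable {w : List α} {m t : ℕ} {b : Bool}

theorem goodState_scanState_succ (hm : m ≠ 0) {i : ℕ}
    (h : GoodState kQ (fun p => (plainTape w).getD p .rightEnd) (1 + b.toNat) i
      (scanState kQ w m i)) :
    GoodState kQ (fun p => (plainTape w).getD p .rightEnd) (1 + b.toNat) (i + 1)
        (scanState kQ w m (i + 1)) ∧
      ((plainTape w).getD i .rightEnd = .rightEnd →
        (scanState kQ w m (i + 1)).result = 1 + b.toNat) := by
  refine h.scanCell ?_ ?_ (Nat.add_lt_add_left (Bool.toNat_lt b) 1)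
  · rw [contents_scanState]
    exact Nat.even_pow.2 ⟨even_two, hm⟩
  · rw [contents_scanState, bound_scanState]
    exact le_rfl

theorem goodState_scanState (hm : m ≠ 0)
    (h : HaltsIn kQ (fun p => (plainTape w).getD p .rightEnd) (2 ^ m) (1 + b.toNat) t
      (3 * kQ.code M.start) 0) (i : ℕ) :
    GoodState kQ (fun p => (plainTape w).getD p .rightEnd) (1 + b.toNat) i
      (scanState kQ w m i) := by
  induction i with
  | zero =>
    exact ⟨Or.inl rfl, Or.inr ⟨_, startCode_lt_nConf kQ (Nat.two_pow_pos m), t, rfl, h⟩⟩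
  | succ i ih => exact (goodState_scanState_succ hm ih).1

theorem getD_plainTape_length_add_one (w : List α) :
    (plainTape w).getD (w.length + 1) .rightEnd = .rightEnd := by
  rw [getD_plainTape, if_neg (Nat.succ_ne_zero _), Nat.add_sub_cancel,
    List.getElem?_eq_none le_rfl]
  rfl

theorem result_scanState (hm : m ≠ 0)
    (h : HaltsIn kQ (fun p => (plainTape w).getD p .rightEnd) (2 ^ m) (1 + b.toNat) t
      (3 * kQ.code M.start) 0) : (scanState kQ w m (w.length + 2)).result = 1 + b.toNat :=
  (goodState_scanState_succ hm (goodState_scanState hm h (w.length + 1))).2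
    (getD_plainTape_length_add_one w)

end

/-! ### Reading the shifted input -/

/-- Applies programs to the registers while reading the input, until a symbol for which no program
is given. Register `1` controls the loop. -/
def Prog.scan {α : Type} (body : InputSymbol α → Option (Prog α)) : Prog α :=
  .seq (.inc 1) (.loop 1 (.seq (.dec 1) (.switch fun a =>
    (body a).elim .skip fun p => .seq p (.seq .advance (.inc 1)))))

/-- Counts in register `0` the blanks between the left endmarker and the input word. -/
def Prog.countBlanks {α : Type} : Prog α :=
  .seq .advance (.scan fun
    | .blank => some (.inc 0)
    | _ => none)

/-- Reads the input word and applies the program `q a` to the registers for every letter `a`. -/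
def Prog.scanLetters {α : Type} (q : α → Prog α) : Prog α :=
  .scan fun
    | .letter a => some (q a)
    | _ => none

/-- Prints the bit in register `0`. -/
def Prog.printBit {α : Type} : Prog α := .ifz 0 (.print false) (.print true)

section

variable {α : Type} {tape : List (InputSymbol α)} {B : ℕ}

theorem frame_pad₁ (v : ℕ) : frame (fun _ => 0) 0 [v, 0] = single v := frame_append_zero _ _ [v] 1

theorem single_zero : single 0 = fun _ => 0 := funext fun j => by cases j <;> rfl

theorem RegRun.inc_control (hB : 1 ≤ B) (v : ℕ) :
    RegRun tape B (.inc 1) (single v) (frame (fun _ => 0) 0 [v, 1]) := by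
  rw [← frame_pad₁]
  exact .inc_frame _ 0 1 (l := [v, 0]) Nat.one_lt_two hB

theorem RegRun.dec_control (v : ℕ) :
    RegRun tape B (.dec 1) (frame (fun _ => 0) 0 [v, 1]) (single v) := by
  rw [← frame_pad₁]
  exact .dec_frame _ 0 1 (l := [v, 1]) Nat.one_lt_two one_ne_zero

theorem RegRun.inc_single {v : ℕ} (hB : v + 1 ≤ B) :
    RegRun tape B (.inc 0) (single v) (single (v + 1)) :=
  .inc_frame _ 0 0 (l := [v]) Nat.one_pos hB

theorem Run.advance_of_lt {i : ℕ} (hi : i + 1 < tape.length) (σ : ℕ → ℕ) (o : List Bool) :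
    Run tape B .advance ⟨σ, i, o⟩ ⟨σ, i + 1, o⟩ := by
  have h := Run.advance (tape := tape) (B := B) ⟨σ, i, o⟩
  rwa [Move.onInput, min_eq_left (Nat.le_sub_one_of_lt hi)] at h

theorem Run.scan {body : InputSymbol α → Option (Prog α)} (hB : 1 ≤ B) (v : ℕ → ℕ) (i n : ℕ)
    (o : List Bool) (hlen : i + n < tape.length)
    (h : ∀ j < n, ∃ p, body (tape.getD (i + j) .rightEnd) = some p ∧
      RegRun tape B p (single (v j)) (single (v (j + 1))))
    (hn : body (tape.getD (i + n) .rightEnd) = none) :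
    Run tape B (.scan body) ⟨single (v 0), i, o⟩ ⟨single (v n), i + n, o⟩ := by
  refine .seq (RegRun.inc_control hB _ _ _) ?_
  induction n generalizing i v with
  | zero =>
    refine .loop_step one_ne_zero (.seq (RegRun.dec_control _ _ _) (.switch ?_)) (.loop_done rfl)
    rw [show body (tape.getD i .rightEnd) = none from hn]
    exact .skip _
  | succ n ih =>
    obtain ⟨p, hp, hrun⟩ := h 0 n.succ_pos
    rw [show i + (n + 1) = i + 1 + n by omega] at hlen hn ⊢
    refine .loop_step one_ne_zero (.seq (RegRun.dec_control _ _ _) (.switch ?_))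
      (ih (fun j => v (j + 1)) (i + 1) hlen (fun j hj => ?_) hn)
    · rw [show body (tape.getD i .rightEnd) = some p from hp]
      exact .seq (hrun i o) (.seq (.advance_of_lt (by omega) _ _) (RegRun.inc_control hB _ _ _))
    · rw [show i + 1 + j = i + (j + 1) by omega]
      exact h (j + 1) (Nat.succ_lt_succ hj)

theorem Run.printBit (b : Bool) (i : ℕ) (o : List Bool) :
    Run tape B .printBit ⟨single b.toNat, i, o⟩ ⟨single b.toNat, i, o ++ [b]⟩ := by
  cases b with
  | false => exact .ifz_zero rfl (.print false _)
  | true => exact .ifz_pos one_ne_zero (.print true _)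

end

section

variable {α : Type} (w : List α)

theorem length_shiftedTape : (shiftedTape w).length = 2 * w.length + 2 := by
  simp only [shiftedTape, List.length_cons, List.length_append, List.length_replicate,
    List.length_map, List.length_nil]
  omega

theorem getD_shiftedTape_blank {w : List α} {j : ℕ} (hj : j < w.length) :
    (shiftedTape w).getD (1 + j) .rightEnd = .blank := by
  rw [shiftedTape, Nat.add_comm, List.getD_cons_succ, List.append_assoc,
    List.getD_append _ _ _ _ (by simpa), List.getD_replicate _ hj]

theorem getD_shiftedTape (j : ℕ) :
    (shiftedTape w).getD (1 + w.length + j) .rightEnd = (plainTape w).getD (1 + j) .rightEnd := by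
  rw [shiftedTape, plainTape, Nat.add_assoc, Nat.add_comm 1, Nat.add_comm 1, List.getD_cons_succ,
    List.getD_cons_succ, List.append_assoc, List.getD_append_right _ _ _ _ (by simp),
    List.length_replicate, Nat.add_sub_cancel_left]

theorem getD_plainTape_letter {w : List α} {j : ℕ} (hj : j < w.length) :
    (plainTape w).getD (j + 1) .rightEnd = .letter w[j] := by
  rw [getD_plainTape, if_neg j.succ_ne_zero, Nat.add_sub_cancel, List.getElem?_eq_getElem hj]
  rfl

variable {B : ℕ}

theorem Run.countBlanks (hB : w.length + 1 ≤ B) (o : List Bool) :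
    Run (shiftedTape w) B .countBlanks ⟨fun _ => 0, 0, o⟩ ⟨single w.length, 1 + w.length, o⟩ := by
  have hlen := length_shiftedTape w
  rw [← single_zero]
  refine .seq (.advance_of_lt (by omega) _ _) (.scan (by omega) (fun j => j) 1 w.length o
    (by omega) (fun j hj => ?_) ?_)
  · rw [getD_shiftedTape_blank hj]
    exact ⟨_, rfl, .inc_single (by omega)⟩
  · rw [← Nat.add_zero (1 + w.length), getD_shiftedTape, getD_plainTape,
      if_neg (by omega)]
    cases w[1 + 0 - 1]? <;> rfl

theorem Run.scanLetters {q : α → Prog α} (hB : 1 ≤ B) (v : ℕ → ℕ)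
    (h : ∀ j (hj : j < w.length),
      RegRun (shiftedTape w) B (q w[j]) (single (v j)) (single (v (j + 1)))) (o : List Bool) :
    Run (shiftedTape w) B (.scanLetters q) ⟨single (v 0), 1 + w.length, o⟩
      ⟨single (v w.length), 1 + w.length + w.length, o⟩ := by
  have hlen := length_shiftedTape w
  refine .scan hB v _ _ o (by omega) (fun j hj => ?_) ?_
  · rw [getD_shiftedTape, Nat.add_comm 1, getD_plainTape_letter hj]
    exact ⟨_, rfl, h j hj⟩
  · rw [getD_shiftedTape, Nat.add_comm 1, getD_plainTape_length_add_one]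

end

/-! ### The decision procedure -/

theorem PolyLe.exists_factor {ι κ : Type} {S : κ → ℕ} {g : ι → κ} {u : ι → ℕ}
    (h : PolyLe (fun i => S (g i)) u) : ∃ v, PolyLe S v ∧ ∀ i, u i ≤ v (g i) := by
  obtain ⟨c, hc⟩ := h
  exact ⟨fun k => (S k + 2) ^ (c + 1), ⟨c, fun _ => le_rfl⟩, hc⟩

theorem PolyRun.exists_progs {ι κ : Type} [Finite κ] {S : ι → ℕ} {src dst : κ → ι → ℕ}
    (h : ∀ k, PolyRun S (src k) (dst k)) :
    ∃ (p : κ → (γ : Type) → Prog γ) (u : ι → ℕ), PolyLe S u ∧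
      ∀ k γ (tape : List (InputSymbol γ)) B i, u i ≤ B →
        RegRun tape B (p k γ) (single (src k i)) (single (dst k i)) := by
  have := Fintype.ofFinite κ
  choose p u hu hp using h
  refine ⟨p, _, .sum Finset.univ hu, fun k γ tape B i hB => hp k γ tape B i (le_trans ?_ hB)⟩
  exact Finset.single_le_sum (f := fun k => u k i) (fun _ _ => Nat.zero_le _) (Finset.mem_univ k)

section

variable {α : Type} {M : Machine α Bool} (kQ : Coding M.Q) {S m : ℕ → ℕ}

theorem polyLe_enc_scanState (hS : PolyLe S fun n => tableBound kQ (m n)) :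
    PolyLe (fun x : List α × ℕ => S x.1.length)
      fun x => enc (scanState kQ x.1 (m x.1.length) x.2) :=
  have h := hS.comp (S := fun x : List α × ℕ => S x.1.length) (f := fun x => x.1.length) .self
  (h.cpair (h.cpair (h.cpair h))).mono fun _ => enc_scanState_le kQ _ _ _

theorem polyRun_scanState_one (hm : PolyRun S (fun n => n) m)
    (hS : PolyLe S fun n => tableBound kQ (m n)) :
    PolyRun (fun w : List α => S w.length) (fun w => w.length)
      fun w => enc (scanState kQ w (m w.length) 1) := by
  have hinit := (hm.trans ((polyRun_tableInit kQ).comp hS)).comp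
    (T := fun w : List α => S w.length) (g := List.length) .self
  exact hinit.trans ((linSpace_scanCell kQ .leftEnd).polyRun
    ((polyLe_enc_scanState kQ hS).comp (f := fun w => (w, 0)) .self))

theorem exists_scanLetters_run [Finite α] (hS : PolyLe S fun n => tableBound kQ (m n)) :
    ∃ (q : α → Prog α) (u : List α → ℕ), PolyLe (fun w => S w.length) u ∧
      ∀ w B o, u w ≤ B → Run (shiftedTape w) B (.scanLetters q)
        ⟨single (enc (scanState kQ w (m w.length) 1)), 1 + w.length, o⟩
        ⟨single (enc (scanState kQ w (m w.length) (w.length + 1))),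
          1 + w.length + w.length, o⟩ := by
  obtain ⟨q, u, hu, hq⟩ := PolyRun.exists_progs fun a : α =>
    (linSpace_scanCell kQ (.letter a)).polyRun (polyLe_enc_scanState kQ hS)
  obtain ⟨v, hv, huv⟩ := hu.exists_factor (g := Prod.fst) (S := fun w : List α => S w.length)
  refine ⟨fun a => q a α, _, hv.add (.const 1), fun w B o hB => ?_⟩
  refine .scanLetters w ((Nat.le_add_left _ _).trans hB)
    (fun j => enc (scanState kQ w (m w.length) (j + 1))) (fun j hj => ?_) o
  have hrun := hq w[j] α (shiftedTape w) B (w, j + 1)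
    ((huv _).trans ((Nat.le_add_right _ _).trans hB))
  rwa [← getD_plainTape_letter hj] at hrun

theorem polyRun_result {F : List α → Bool} (hS : PolyLe S fun n => tableBound kQ (m n))
    (hF : ∀ w, (scanState kQ w (m w.length) (w.length + 2)).result = 1 + (F w).toNat) :
    PolyRun (fun w : List α => S w.length)
      (fun w => enc (scanState kQ w (m w.length) (w.length + 1))) fun w => (F w).toNat := by
  have henc := polyLe_enc_scanState (α := α) kQ hS
  have hright := (linSpace_scanCell kQ .rightEnd).polyRun
    (henc.comp (f := fun w => (w, w.length + 1)) .self)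
  have hread := (TableState.linSpace_result.pred).polyRun
    (henc.comp (f := fun w => (w, w.length + 2)) .self)
  have hcell : ∀ w : List α, scanCell kQ .rightEnd (scanState kQ w (m w.length) (w.length + 1)) =
      scanState kQ w (m w.length) (w.length + 2) := fun w => by
    rw [← getD_plainTape_length_add_one w]
    rfl
  simp only [hcell] at hright
  simp only [hF, Nat.add_sub_cancel_left] at hread
  exact hright.trans hread

theorem exists_decider_prog [Finite α] {F : List α → Bool} {s : ℕ → ℕ}
    (hM : M.ComputesInSpace plainTape (fun w => [F w]) s) (hs : ∀ n, s n ≤ m n)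
    (hm₀ : ∀ n, m n ≠ 0) (hm : PolyRun S (fun n => n) m) (hn : PolyLe S fun n => n)
    (hS : PolyLe S fun n => tableBound kQ (m n)) :
    ∃ (p : Prog α) (u : List α → ℕ), PolyLe (fun w => S w.length) u ∧
      ∀ w, ∃ r, Run (shiftedTape w) (u w) p ⟨fun _ => 0, 0, []⟩ r ∧ r.out = [F w] := by
  have hF : ∀ w, (scanState kQ w (m w.length) (w.length + 2)).result = 1 + (F w).toNat :=
    fun w => by
      obtain ⟨k, hk⟩ := Nat.exists_eq_succ_of_ne_zero (hm₀ w.length)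
      obtain ⟨t, ht⟩ := exists_haltsIn (kQ := kQ) (m := k) (hM w).1
        ((hM w).2.trans (by exact_mod_cast (hs w.length).trans_eq hk))
      rw [hk]
      exact result_scanState k.succ_ne_zero ht
  obtain ⟨p₁, u₁, hu₁, hp₁⟩ := polyRun_scanState_one kQ hm hS
  obtain ⟨q, u₂, hu₂, hq⟩ := exists_scanLetters_run kQ hS
  obtain ⟨p₃, u₃, hu₃, hp₃⟩ := polyRun_result kQ hS hF
  refine ⟨.seq .countBlanks (.seq (p₁ α) (.seq (.scanLetters q) (.seq (p₃ α) .printBit))),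
    fun w => w.length + 1 + u₁ w + u₂ w + u₃ w,
    ((((hn.comp (f := List.length) .self).add (.const 1)).add hu₁).add hu₂).add hu₃, fun w => ?_⟩
  beta_reduce
  exact ⟨_, .seq (.countBlanks w (by omega) _) (.seq (hp₁ α _ _ w (by omega) _ _)
    (.seq (hq w _ _ (by omega)) (.seq (hp₃ α _ _ w (by omega) _ _) (.printBit (F w) _ _)))), rfl⟩

end

/-! ### The space bound -/

/-- `u` is at most exponential in `T`: `u ≤ 2 ^ (A * (T + 1))` for some constant `A`. -/
def ExpLe {ι : Type} (T u : ι → ℕ) : Prop :=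
  ∃ A, ∀ i, u i ≤ 2 ^ (A * (T i + 1))

section

variable {ι : Type} {T u v : ι → ℕ}

theorem ExpLe.mono (h : ExpLe T u) (hv : ∀ i, v i ≤ u i) : ExpLe T v := by
  obtain ⟨A, hA⟩ := h
  exact ⟨A, fun i => (hv i).trans (hA i)⟩

theorem ExpLe.mono_left {T' : ι → ℕ} (h : ExpLe T u) (hT : ∀ i, T i ≤ T' i) : ExpLe T' u := by
  obtain ⟨A, hA⟩ := h
  refine ⟨A, fun i => (hA i).trans (Nat.pow_le_pow_right two_pos ?_)⟩
  exact Nat.mul_le_mul_left A (Nat.succ_le_succ (hT i))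

theorem ExpLe.mul (hu : ExpLe T u) (hv : ExpLe T v) : ExpLe T fun i => u i * v i := by
  obtain ⟨A, hA⟩ := hu
  obtain ⟨A', hA'⟩ := hv
  refine ⟨A + A', fun i => ?_⟩
  rw [add_mul, pow_add]
  exact Nat.mul_le_mul (hA i) (hA' i)

theorem ExpLe.const_pow (b : ℕ) (h : ∀ i, u i ≤ T i) : ExpLe T fun i => b ^ u i := by
  refine ⟨b, fun i => ?_⟩
  calc b ^ u i ≤ (2 ^ b) ^ u i := Nat.pow_le_pow_left Nat.lt_two_pow_self.le _
    _ = 2 ^ (b * u i) := (pow_mul 2 b _).symm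
    _ ≤ 2 ^ (b * (T i + 1)) :=
      Nat.pow_le_pow_right two_pos (Nat.mul_le_mul_left b ((h i).trans (Nat.le_succ _)))

theorem ExpLe.of_le (h : ∀ i, u i ≤ T i) : ExpLe T u :=
  (ExpLe.const_pow 2 h).mono fun _ => Nat.lt_two_pow_self.le

theorem ExpLe.const (k : ℕ) : ExpLe T fun _ => k :=
  ⟨k, fun _ => Nat.lt_two_pow_self.le.trans
    (Nat.pow_le_pow_right two_pos (Nat.le_mul_of_pos_right k (Nat.succ_pos _)))⟩

theorem ExpLe.add (hu : ExpLe T u) (hv : ExpLe T v) : ExpLe T fun i => u i + v i := by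
  obtain ⟨A, hA⟩ := hu
  obtain ⟨A', hA'⟩ := hv
  refine ⟨A + A' + 1, fun i => ?_⟩
  have hpow : ∀ {B}, B ≤ A + A' → 2 ^ (B * (T i + 1)) ≤ 2 ^ ((A + A') * (T i + 1)) := fun hB =>
    Nat.pow_le_pow_right two_pos (Nat.mul_le_mul_right _ hB)
  calc u i + v i ≤ 2 ^ ((A + A') * (T i + 1)) * 2 := by
        rw [mul_two]
        exact Nat.add_le_add ((hA i).trans (hpow (Nat.le_add_right A A')))
          ((hA' i).trans (hpow (Nat.le_add_left A' A)))
    _ ≤ 2 ^ ((A + A') * (T i + 1)) * 2 ^ (T i + 1) :=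
      Nat.mul_le_mul_left _ (Nat.le_self_pow (Nat.succ_ne_zero _) 2)
    _ = 2 ^ ((A + A' + 1) * (T i + 1)) := by rw [← pow_add, ← Nat.succ_mul]

end

theorem expLe_of_computesInSpace {Γ : Type} [Inhabited Γ] [Finite Γ] {M : Machine Unit Γ}
    {f s : ℕ → ℕ} (hM : M.ComputesInSpace plainTape (fun w => binary (f w.length)) s)
    (hf : Tendsto f atTop atTop) : ExpLe (fun n => s n + f n) fun n => n :=
  have hs : ∀ n, s n ≤ s n + f n := fun _ => Nat.le_add_right _ _
  have hfs : ExpLe (fun n => s n + f n) f := .of_le fun _ => Nat.le_add_left _ _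
  ((ExpLe.const _).mul ((ExpLe.const_pow _ hs).mul
    ((ExpLe.of_le hs).mul (hfs.add (.const 1))))).mono (le_of_computesInSpace hM hf)

theorem tableBound_le {α : Type} {M : Machine α Bool} (kQ : Coding M.Q) (m : ℕ) :
    tableBound kQ m ≤ 2 ^ ((nControl kQ + m + 3) * (nControl kQ * 2 ^ m)) := by
  have hentry : nEntry kQ (2 ^ m) ≤ 2 ^ (nControl kQ + m + 3) := by
    have hcontrol := Nat.mul_le_mul_right (2 ^ m) (Nat.lt_two_pow_self (n := nControl kQ)).le
    have hpos := Nat.two_pow_pos (nControl kQ + m)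
    rw [← pow_add] at hcontrol
    change nControl kQ * 2 ^ m + 3 ≤ _
    rw [pow_add _ _ 3]
    omega
  exact (Nat.pow_le_pow_left hentry _).trans_eq (pow_mul 2 _ _).symm

theorem expLe_tableBound {α : Type} {M : Machine α Bool} (kQ : Coding M.Q) (C : ℕ) :
    ExpLe (fun m => m * 2 ^ m) fun m => tableBound kQ (m + C) := by
  refine ⟨nControl kQ * 2 ^ C * (nControl kQ + C + 4), fun m =>
    (tableBound_le kQ _).trans (Nat.pow_le_pow_right two_pos ?_)⟩
  generalize nControl kQ = a
  have hpow : 2 ^ m ≤ m * 2 ^ m + 1 := by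
    rcases Nat.eq_zero_or_pos m with rfl | hm
    · rfl
    · exact (Nat.le_mul_of_pos_left _ hm).trans (Nat.le_succ _)
  calc (a + (m + C) + 3) * (a * 2 ^ (m + C))
      = a * 2 ^ C * ((a + C + 3) * 2 ^ m + m * 2 ^ m) := by rw [pow_add]; ring
    _ ≤ a * 2 ^ C * ((a + C + 3) * (m * 2 ^ m + 1) + (m * 2 ^ m + 1)) :=
      Nat.mul_le_mul_left _ (Nat.add_le_add (Nat.mul_le_mul_left _ hpow) (Nat.le_succ _))
    _ = a * 2 ^ C * (a + C + 4) * (m * 2 ^ m + 1) := by ring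

theorem exists_online_machine {α : Type} [Finite α] {p : Prog α} {F : List α → List Bool}
    {S x : ℕ → ℕ} {u : List α → ℕ} (hu : PolyLe (fun w => S w.length) u)
    (hx : ∀ n, S n + 2 ≤ 2 ^ x n)
    (hp : ∀ w, ∃ r, Run (shiftedTape w) (u w) p ⟨fun _ => 0, 0, []⟩ r ∧ r.out = F w) :
    ∃ (Γ : Type) (_ : Finite Γ) (_ : Inhabited Γ) (M : Machine α Γ) (c : ℕ),
      M.IsOnline ∧ M.ComputesInSpace shiftedTape F fun n => x n * c + 2 := by
  obtain ⟨k, hk⟩ := p.exists_usesUpTo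
  obtain ⟨c, hc⟩ := hu
  refine ⟨_, inferInstance, inferInstance, p.toMachine k, c + 1, p.isOnline_toMachine k,
    fun w => ?_⟩
  obtain ⟨r, hrun, hout⟩ := hp w
  have hbits : u w < 2 ^ (x w.length * (c + 1) + 1) :=
    calc u w ≤ (2 ^ x w.length) ^ (c + 1) := (hc w).trans (Nat.pow_le_pow_left (hx _) _)
      _ = 2 ^ (x w.length * (c + 1)) := (pow_mul 2 _ _).symm
      _ < 2 ^ (x w.length * (c + 1) + 1) := Nat.pow_lt_pow_right one_lt_two (Nat.lt_succ_self _)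
  exact hout ▸ hrun.outputs hk hbits (Nat.succ_ne_zero _)

theorem exists_forall_le_add_const {s f : ℕ → ℕ} (h : ∀ᶠ n in atTop, s n ≤ f n) :
    ∃ C, 0 < C ∧ ∀ n, s n ≤ f n + C := by
  obtain ⟨n₀, hn₀⟩ := eventually_atTop.1 h
  refine ⟨∑ i ∈ Finset.range n₀, s i + 1, Nat.succ_pos _, fun n => ?_⟩
  rcases Nat.lt_or_ge n n₀ with hn | hn
  · have := Finset.single_le_sum (f := s) (fun i _ => Nat.zero_le _) (Finset.mem_range.2 hn)
    omega
  · exact (hn₀ n hn).trans (Nat.le_add_right _ _)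

theorem isBigO_affine {s G : ℕ → ℕ} (hs : (fun n => (s n : ℝ)) =O[atTop] fun n => (G n : ℝ))
    (hG : ∀ᶠ n in atTop, 1 ≤ G n) (A c : ℕ) :
    (fun n => ((A * (s n + G n + 1) * c + 2 : ℕ) : ℝ)) =O[atTop] fun n => (G n : ℝ) := by
  have hconst : ∀ k : ℝ, (fun _ : ℕ => k) =O[atTop] fun n => (G n : ℝ) := fun k =>
    .of_bound |k| <| hG.mono fun n hn => by
      rw [Real.norm_eq_abs, Real.norm_natCast]
      exact le_mul_of_one_le_right (abs_nonneg k) (by exact_mod_cast hn)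
  push_cast
  have hsum := ((hs.add (isBigO_refl _ _)).add (hconst 1)).const_mul_left A
  exact ((hsum.const_mul_left c).congr_left fun n => mul_comm _ _).add (hconst 2)

theorem tendsto_atTop_of_log_log_isBigO {f : ℕ → ℕ}
    (hf : (fun n : ℕ => Real.log (Real.log (n : ℝ))) =O[atTop] (fun n : ℕ => (f n : ℝ))) :
    Tendsto f atTop atTop := by
  have hloglog : Tendsto (fun n : ℕ => Real.log (Real.log (n : ℝ))) atTop atTop :=
    Real.tendsto_log_atTop.comp (Real.tendsto_log_atTop.comp tendsto_natCast_atTop_atTop)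
  obtain ⟨c, hc, hbound⟩ := hf.exists_pos
  rw [← tendsto_natCast_atTop_iff (R := ℝ)]
  refine tendsto_atTop_mono' _ ?_ (hloglog.const_mul_atTop (inv_pos.2 hc))
  filter_upwards [hbound.bound] with n hn
  rw [inv_mul_le_iff₀ hc]
  simpa using (le_abs_self _).trans hn

theorem exists_online_prog {α Γ : Type} [Finite α] [Finite Γ] [Inhabited Γ] {M : Machine α Bool}
    {F : List α → Bool} {s : ℕ → ℕ} (hM : M.ComputesInSpace plainTape (fun w => [F w]) s)
    {U : Machine Unit Γ} {f sU : ℕ → ℕ} (hs : ∀ᶠ n in atTop, s n ≤ f n)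
    (hU : U.ComputesInSpace plainTape (fun w => binary (f w.length)) sU)
    (hf : Tendsto f atTop atTop) :
    ∃ (p : Prog α) (S : ℕ → ℕ) (u : List α → ℕ), PolyLe (fun w => S w.length) u ∧
      ExpLe (fun n => sU n + f n * 2 ^ f n) S ∧
      ∀ w, ∃ r, Run (shiftedTape w) (u w) p ⟨fun _ => 0, 0, []⟩ r ∧ r.out = [F w] := by
  have := M.finite_Q
  obtain ⟨kQ, -⟩ := exists_coding M.start
  obtain ⟨C, hC₀, hC⟩ := exists_forall_le_add_const hs
  obtain ⟨g, hrun⟩ := polyRun_of_computesInSpace hU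
  let S n := n + g ^ sU n + f n + tableBound kQ (f n + C)
  have hfS : PolyLe S f := PolyLe.self.mono fun n => by simp only [S]; omega
  have hrun' : PolyRun S (fun n => n) fun n => f n + C :=
    (hrun.comp (g := id) (PolyLe.self.mono fun n => Nat.le_add_right _ _)).trans
      ((LinSpace.id.add (.const C)).polyRun (x := f) hfS)
  obtain ⟨p, u, hu, hp⟩ := exists_decider_prog kQ hM hC
    (fun n => (Nat.add_pos_right (f n) hC₀).ne') hrun'
    (PolyLe.self.mono fun n => by simp only [S]; omega)
    (PolyLe.self.mono fun n => Nat.le_add_left _ _)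
  have hff : ∀ n, f n ≤ f n * 2 ^ f n := fun n => Nat.le_mul_of_pos_right _ (Nat.two_pow_pos _)
  obtain ⟨D, hD⟩ := expLe_tableBound kQ C
  have htable : ExpLe (fun n => f n * 2 ^ f n) fun n => tableBound kQ (f n + C) :=
    ⟨D, fun n => hD (f n)⟩
  have hlen := (expLe_of_computesInSpace hU hf).mono_left fun n => Nat.add_le_add_left (hff n) _
  exact ⟨p, S, u, hu, ((hlen.add (.const_pow g fun n => Nat.le_add_right _ _)).add
    (.of_le fun n => (hff n).trans (Nat.le_add_left _ _))).add
    (htable.mono_left fun n => Nat.le_add_left _ _), hp⟩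

end SublinearSpace

theorem mainTheorem5_general {α : Type} [Finite α] (f : ℕ → ℕ) (hf : Tendsto f atTop atTop)
    (hcomp : SublinearSpace.UnaryComputableInSpace f (fun n => f n * 2 ^ f n))
    (L : Language α) (hL : SublinearSpace.BinaryOfflineDecidable L f) :
    L ∈ SublinearSpace.OneDSpacePrime α (fun n => f n * 2 ^ f n) := by
  classical
  obtain ⟨Γ, _, _, U, sU, hsU, hU⟩ := hcomp
  obtain ⟨M, sM, hsM, hM⟩ := hL
  obtain ⟨p, S, u, hu, hS, hp⟩ := SublinearSpace.exists_online_prog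
    (F := fun w => decide (w ∈ L)) hM hsM hU hf
  obtain ⟨A, hA⟩ := hS.add (.const 2)
  obtain ⟨Δ, hΔ, hΔ', N, c, hN, hNL⟩ := SublinearSpace.exists_online_machine hu hA hp
  have hpos : ∀ᶠ n in atTop, 1 ≤ f n * 2 ^ f n :=
    (hf.eventually_ge_atTop 1).mono fun n hn => Nat.mul_pos hn (Nat.two_pow_pos _)
  exact ⟨Δ, hΔ, hΔ', N, _, hN, SublinearSpace.isBigO_affine hsU hpos A c, hNL⟩

theorem mainTheorem5 {α : Type} [Finite α] (f : ℕ → ℕ)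
    (hf : (fun n : ℕ => Real.log (Real.log (n : ℝ))) =O[atTop] (fun n : ℕ => (f n : ℝ)))
    (hcomp : SublinearSpace.UnaryComputableInSpace f (fun n => f n * 2 ^ f n))
    (L : Language α) (hL : SublinearSpace.BinaryOfflineDecidable L f) :
    L ∈ SublinearSpace.OneDSpacePrime α (fun n => f n * 2 ^ f n) :=
  mainTheorem5_general f (SublinearSpace.tendsto_atTop_of_log_log_isBigO hf) hcomp L hL
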